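/- Let $k$ be a field of characteristic $0$ (for instance $k=\mathbb{C}$). Put $$\mathsf{T}=\mathrm{Spec}\,k\left[a,b,c,t_1,t_2,\tfrac1\Delta\right],\qquad t_3=4a^3-t_2a-b^2,\qquad \Delta=27t_3^2-t_2^3 .$$ This is the moduli space of enhanced elliptic curves with two marked points. It carries the universal family of elliptic curves $X:\ y^2=4x^3-t_2x-t_3$ with the marked points $Y=\{O,P\}$, where $O$ is the point at infinity and $P=(a,b)$, and the frame $\alpha_1,\alpha_2,\alpha_3$ of the relative algebraic de Rham cohomology $H^1_{\mathrm{dR}}((X,Y)/\mathsf{T})$ given by $$\alpha_1=\mathrm{d}\Big(\frac{x-a}{x}\Big),\qquad \alpha_2=\frac{\mathrm{d}x}{y},\qquad \alpha_3=\Big(c-\frac{b}{2a}\Big)\mathrm{d}\Big(\frac{x-a}{x}\Big)+t_1\frac{\mathrm{d}x}{y}+\frac{x\,\mathrm{d}x}{y}-\mathrm{d}\Big(\frac{y}{2x}\Big).$$ These are formulas where $a$ is invertible; the three classes extend to all of $\mathsf{T}$: $\alpha_1$ is the class of $\mathrm{d}f$ for any rational function $f$, regular at $O$ and $P$, with $f(O)=1$,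 $f(P)=0$, and $\alpha_3=c\,\alpha_1+t_1\alpha_2+\omega_3$, where $\omega_3$ is the class of the Čech cocycle which is $\frac{x\,\mathrm{d}x}{y}$ on $X\setminus O$ and $\frac{x\,\mathrm{d}x}{y}+\mathrm{d}g$ on $(X\setminus\{x=a\})\cup O$, with $g=-\frac{y}{2(x-a)}$ on the intersection and with value $0$ at $O$ and at $P$. Let $\nabla$ be the Gauss–Manin connection on $H^1_{\mathrm{dR}}((X,Y)/\mathsf{T})$. Then there is a unique global vector field $\mathsf{R}_\tau$ and a unique global vector field $\mathsf{R}_z$ on $\mathsf{T}$ (over $k$) such that $$\nabla_{\mathsf{R}_\tau}\begin{pmatrix}\alpha_1\\ \alpha_2\\ \alpha_3\end{pmatrix}=\begin{pmatrix}0&0&0\\0&0&-1\\0&0&0\end{pmatrix}\begin{pmatrix}\alpha_1\\ \alpha_2\\ \alpha_3\end{pmatrix},\qquad \nabla_{\mathsf{R}_z}\begin{pmatrix}\alpha_1\\ \alpha_2\\ \alpha_3\end{pmatrix}=\begin{pmatrix}0&0&0\\-1&0&0\\0&0&0\end{pmatrix}\begin{pmatrix}\alpha_1\\ \alpha_2\\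 \alpha_3\end{pmatrix}.$$ They are $$\mathsf{R}_\tau=\Big(-2a^2+2at_1+bc+\frac{t_2}{3}\Big)\frac{\partial}{\partial a}+\Big(6a^2c-\frac{ct_2}{2}-3ab+3bt_1\Big)\frac{\partial}{\partial b}+\Big(ac+ct_1-\frac b2\Big)\frac{\partial}{\partial c}+\Big(t_1^2-\frac{t_2}{12}\Big)\frac{\partial}{\partial t_1}+(4t_1t_2-6t_3)\frac{\partial}{\partial t_2},$$ $$\mathsf{R}_z=b\frac{\partial}{\partial a}+\Big(6a^2-\frac{t_2}{2}\Big)\frac{\partial}{\partial b}+(a+t_1)\frac{\partial}{\partial c}.$$ -/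

import Mathlib

noncomputable section

open Polynomial
open scoped KaehlerDifferential

namespace RelDR

set_option linter.unusedSectionVars false

/-! ### Lifts of derivations and Lie derivatives of relative differentials -/

section Lie

variable {k A B C : Type*} [CommRing k] [CommRing A] [CommRing B] [CommRing C]
  [Algebra k A] [Algebra k B] [Algebra A B] [Algebra k C] [Algebra A C]

/-- `E` extends the derivation `D` of the base ring `A` to the `A`-algebra `B`. -/
def Extends (D : Derivation k A A) (E : Derivation k B B) : Prop :=
  ∀ r : A, E (algebraMap A B r) = algebraMap A B (D r)

/-- Auxiliary: `Ω[B⁄A] × Ω[B⁄A]` with the `B`-action `g • (m, n) = (g m, g n + E(g) m)`. -/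
def Twist (_E : Derivation k B B) (A : Type*) [CommRing A] [Algebra A B] : Type _ :=
  Ω[B⁄A] × Ω[B⁄A]

instance (E : Derivation k B B) : AddCommGroup (Twist E A) :=
  inferInstanceAs (AddCommGroup (Ω[B⁄A] × Ω[B⁄A]))

instance (E : Derivation k B B) : Module B (Twist E A) where
  smul g m := ((g • m.1, g • m.2 + E g • m.1) : Ω[B⁄A] × Ω[B⁄A])
  one_smul m := Prod.ext (one_smul B m.1) (by
    change (1 : B) • m.2 + E 1 • m.1 = m.2
    simp)
  mul_smul g h m := Prod.ext (mul_smul g h m.1) (by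
    change (g * h) • m.2 + E (g * h) • m.1 = g • (h • m.2 + E h • m.1) + E g • (h • m.1)
    simp only [Derivation.leibniz, smul_eq_mul]
    module)
  smul_zero g := Prod.ext (smul_zero g) (by
    change g • (0 : Ω[B⁄A]) + E g • (0 : Ω[B⁄A]) = 0
    simp)
  smul_add g m n := Prod.ext (smul_add g m.1 n.1) (by
    change g • (m.2 + n.2) + E g • (m.1 + n.1) = (g • m.2 + E g • m.1) + (g • n.2 + E g • n.1)
    module)
  add_smul g h m := Prod.ext (add_smul g h m.1) (by
    change (g + h) • m.2 + E (g + h) • m.1 = (g • m.2 + E g • m.1) + (h • m.2 + E h • m.1)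
    rw [map_add]
    module)
  zero_smul m := Prod.ext (zero_smul B m.1) (by
    change (0 : B) • m.2 + E 0 • m.1 = 0
    simp)

instance (E : Derivation k B B) : Module A (Twist E A) := Module.compHom _ (algebraMap A B)

instance (E : Derivation k B B) : IsScalarTower A B (Twist E A) where
  smul_assoc r g m := by
    change (r • g) • m = algebraMap A B r • (g • m)
    rw [Algebra.smul_def, mul_smul]

/-- Auxiliary: the derivation `g ↦ (dg, d(E g))`. -/
def twistDer (D : Derivation k A A) (E : Derivation k B B) (h : Extends D E) :
    Derivation A B (Twist E A) :=
  Derivation.mk'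
    { toFun := fun g =>
        ((KaehlerDifferential.D A B g, KaehlerDifferential.D A B (E g)) : Ω[B⁄A] × Ω[B⁄A])
      map_add' := fun f g => Prod.ext (map_add _ f g) (by
        change KaehlerDifferential.D A B (E (f + g)) = _
        rw [map_add, map_add]
        rfl)
      map_smul' := fun r g => Prod.ext (by
        change KaehlerDifferential.D A B (r • g) = algebraMap A B r • KaehlerDifferential.D A B g
        rw [Derivation.map_smul, algebraMap_smul]) (by
        change KaehlerDifferential.D A B (E (r • g)) =
          algebraMap A B r • KaehlerDifferential.D A B (E g) +
            E (algebraMap A B r) • KaehlerDifferential.D A B g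
        rw [Algebra.smul_def, Derivation.leibniz, h r]
        simp only [smul_eq_mul, map_add, Derivation.leibniz, Derivation.map_algebraMap, smul_zero,
          zero_add, add_zero]) }
    (fun f g => Prod.ext (Derivation.leibniz _ f g) (by
        change KaehlerDifferential.D A B (E (f * g)) =
          (f • KaehlerDifferential.D A B (E g) + E f • KaehlerDifferential.D A B g) +
            (g • KaehlerDifferential.D A B (E f) + E g • KaehlerDifferential.D A B f)
        simp only [Derivation.leibniz, smul_eq_mul, map_add]
        abel))

/-- The Lie derivative `L_E` on relative differentials: the additive map with
`L_E(dg) = d(E g)` and `L_E(g η) = E(g) η + g L_E(η)` (see the two lemmas below). -/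
def lieDeriv (D : Derivation k A A) (E : Derivation k B B) (h : Extends D E) :
    Ω[B⁄A] →+ Ω[B⁄A] where
  toFun m := ((twistDer D E h).liftKaehlerDifferential m).2
  map_zero' := by rw [map_zero]; rfl
  map_add' m n := by rw [map_add]; rfl

theorem lieDeriv_D (D : Derivation k A A) (E : Derivation k B B) (h : Extends D E) (g : B) :
    lieDeriv D E h (KaehlerDifferential.D A B g) = KaehlerDifferential.D A B (E g) := by
  change ((twistDer D E h).liftKaehlerDifferential (KaehlerDifferential.D A B g)).2 = _
  rw [Derivation.liftKaehlerDifferential_comp_D]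
  rfl

theorem twist_fst (D : Derivation k A A) (E : Derivation k B B) (h : Extends D E) (m : Ω[B⁄A]) :
    ((twistDer D E h).liftKaehlerDifferential m).1 = m := by
  have hm : m ∈ Submodule.span B (Set.range (KaehlerDifferential.D A B)) := by
    rw [KaehlerDifferential.span_range_derivation]; trivial
  induction hm using Submodule.span_induction with
  | mem x hx =>
    obtain ⟨g, rfl⟩ := hx
    rw [Derivation.liftKaehlerDifferential_comp_D]; rfl
  | zero => rw [map_zero]; rfl
  | add x y _ _ hx hy =>
    rw [map_add]
    exact congrArg₂ (· + ·) hx hy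
  | smul g x _ hx =>
    rw [map_smul]
    exact congrArg (g • ·) hx

theorem lieDeriv_smul (D : Derivation k A A) (E : Derivation k B B) (h : Extends D E) (g : B)
    (m : Ω[B⁄A]) : lieDeriv D E h (g • m) = g • lieDeriv D E h m + E g • m := by
  change ((twistDer D E h).liftKaehlerDifferential (g • m)).2 = _
  rw [map_smul]
  change g • ((twistDer D E h).liftKaehlerDifferential m).2 +
    E g • ((twistDer D E h).liftKaehlerDifferential m).1 = _
  rw [twist_fst]
  rfl

/-- Induction principle for relative differentials. -/
theorem kaehler_induction {p : Ω[B⁄A] → Prop} (m : Ω[B⁄A])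
    (hz : p 0) (hadd : ∀ x y, p x → p y → p (x + y))
    (hd : ∀ f g : B, p (f • KaehlerDifferential.D A B g)) : p m := by
  have hm : m ∈ Submodule.span B (Set.range (KaehlerDifferential.D A B)) := by
    rw [KaehlerDifferential.span_range_derivation]; trivial
  rw [← Set.image_univ] at hm
  induction hm using Submodule.span_induction with
  | mem x hx =>
    obtain ⟨g, _, rfl⟩ := hx
    simpa using hd 1 g
  | zero => exact hz
  | add x y _ _ hx hy => exact hadd _ _ hx hy
  | smul g x hx' hx =>
    clear hx
    induction hx' using Submodule.span_induction generalizing g with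
    | mem x hx =>
      obtain ⟨f, _, rfl⟩ := hx
      exact hd g f
    | zero => simpa using hz
    | add x y _ _ hx hy => rw [smul_add]; exact hadd _ _ (hx g) (hy g)
    | smul f x _ hx => rw [smul_smul]; exact hx (g * f)

/-- The difference of two derivations extending `D` is vertical, that is, `A`-linear. -/
def vert (D : Derivation k A A) (E F : Derivation k B B) (hE : Extends D E) (hF : Extends D F) :
    Derivation A B B :=
  Derivation.mk'
    { toFun := fun g => E g - F g
      map_add' := fun f g => by rw [map_add, map_add]; abel
      map_smul' := fun r g => by
        rw [RingHom.id_apply, Algebra.smul_def r g, Algebra.smul_def r (E g - F g),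
          Derivation.leibniz, Derivation.leibniz, hE r, hF r]
        simp only [smul_eq_mul]
        ring }
    (fun f g => by
      simp only [LinearMap.coe_mk, AddHom.coe_mk, Derivation.leibniz, smul_eq_mul]
      ring)

theorem vert_apply (D : Derivation k A A) (E F : Derivation k B B) (hE : Extends D E)
    (hF : Extends D F) (g : B) : vert D E F hE hF g = E g - F g := rfl

/-- On a relative curve (differentials generated by one element) the Lie derivatives along two
lifts of the same derivation differ by the differential of the contraction. -/
theorem lieDeriv_sub (D : Derivation k A A) (E F : Derivation k B B) (hE : Extends D E)
    (hF : Extends D F) (hB : ∃ w : Ω[B⁄A], ∀ m : Ω[B⁄A], ∃ g : B, m = g • w) (m : Ω[B⁄A]) :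
    lieDeriv D E hE m - lieDeriv D F hF m =
      KaehlerDifferential.D A B ((vert D E F hE hF).liftKaehlerDifferential m) := by
  obtain ⟨w, hw⟩ := hB
  refine kaehler_induction (p := fun m => lieDeriv D E hE m - lieDeriv D F hF m =
    KaehlerDifferential.D A B ((vert D E F hE hF).liftKaehlerDifferential m)) m ?_ ?_ ?_
  · simp
  · intro x y hx hy
    rw [map_add, map_add, map_add, map_add, ← hx, ← hy]
    abel
  · intro f g
    obtain ⟨b, hb⟩ := hw (KaehlerDifferential.D A B f)
    obtain ⟨c, hc⟩ := hw (KaehlerDifferential.D A B g)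
    have hf : E f - F f = b * (vert D E F hE hF).liftKaehlerDifferential w := by
      rw [← vert_apply D E F hE hF, ← (vert D E F hE hF).liftKaehlerDifferential_comp_D f, hb,
        map_smul, smul_eq_mul]
    have hg : E g - F g = c * (vert D E F hE hF).liftKaehlerDifferential w := by
      rw [← vert_apply D E F hE hF, ← (vert D E F hE hF).liftKaehlerDifferential_comp_D g, hc,
        map_smul, smul_eq_mul]
    have key : E f • KaehlerDifferential.D A B g - F f • KaehlerDifferential.D A B g =
        (E g - F g) • KaehlerDifferential.D A B f := by
      rw [← sub_smul, hf, hg, hb, hc, smul_smul, smul_smul]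
      congr 1
      ring
    rw [lieDeriv_smul, lieDeriv_smul, lieDeriv_D, lieDeriv_D, map_smul,
      Derivation.liftKaehlerDifferential_comp_D, smul_eq_mul, Derivation.leibniz, vert_apply, ← key,
      map_sub, smul_sub]
    abel

/-- Pullback of relative differentials along a homomorphism of `A`-algebras. -/
def kaehlerMap (ρ : B →ₐ[A] C) : Ω[B⁄A] →ₗ[A] Ω[C⁄A] :=
  letI := ρ.toRingHom.toAlgebra
  haveI : IsScalarTower A B C := .of_algebraMap_eq' ρ.comp_algebraMap.symm
  (KaehlerDifferential.map A A B C).restrictScalars A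

theorem kaehlerMap_D (ρ : B →ₐ[A] C) (g : B) :
    kaehlerMap ρ (KaehlerDifferential.D A B g) = KaehlerDifferential.D A C (ρ g) := by
  let _ := ρ.toRingHom.toAlgebra
  have _ : IsScalarTower A B C := .of_algebraMap_eq' ρ.comp_algebraMap.symm
  exact KaehlerDifferential.map_D A A B C g

theorem kaehlerMap_smul (ρ : B →ₐ[A] C) (g : B) (m : Ω[B⁄A]) :
    kaehlerMap ρ (g • m) = ρ g • kaehlerMap ρ m := by
  let _ := ρ.toRingHom.toAlgebra
  have _ : IsScalarTower A B C := .of_algebraMap_eq' ρ.comp_algebraMap.symm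
  exact ((KaehlerDifferential.map A A B C).map_smul g m).trans (algebraMap_smul C g _).symm

theorem kaehlerMap_lie (ρ : B →ₐ[A] C) (D : Derivation k A A) (E : Derivation k B B)
    (F : Derivation k C C) (hE : Extends D E) (hF : Extends D F)
    (h : ∀ g, F (ρ g) = ρ (E g)) (m : Ω[B⁄A]) :
    kaehlerMap ρ (lieDeriv D E hE m) = lieDeriv D F hF (kaehlerMap ρ m) := by
  refine kaehler_induction (p := fun m => kaehlerMap ρ (lieDeriv D E hE m) =
    lieDeriv D F hF (kaehlerMap ρ m)) m ?_ ?_ ?_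
  · simp
  · intro x y hx hy
    rw [map_add, map_add, map_add, map_add, hx, hy]
  · intro f g
    rw [lieDeriv_smul, map_add, kaehlerMap_smul, kaehlerMap_smul, kaehlerMap_smul, lieDeriv_smul,
      lieDeriv_D, kaehlerMap_D, kaehlerMap_D, lieDeriv_D, h, h]

end Lie

/-! ### Relative de Rham cohomology and its Gauss–Manin connection -/

section Cohomology

/-- A relative curve `X` over `Spec A` covered by two affine opens `U₀ = Spec B₀` and
`U₁ = Spec B₁` with affine intersection `U₀₁ = Spec B₀₁`, together with `Y = {O, P}`: a section `P`
contained in `U₀` and disjoint from `U₁`, and a section `O` contained in `U₁` and disjoint from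
`U₀`. So `Y ∩ U₀ = P`, `Y ∩ U₁ = O`, `Y ∩ U₀₁ = ∅`. -/
structure PairCover (A B₀ B₁ B₀₁ : Type*) [CommRing A] [CommRing B₀] [CommRing B₁] [CommRing B₀₁]
    [Algebra A B₀] [Algebra A B₁] [Algebra A B₀₁] where
  /-- restriction of functions from `U₀` to `U₀₁` -/
  res₀ : B₀ →ₐ[A] B₀₁
  /-- restriction of functions from `U₁` to `U₀₁` -/
  res₁ : B₁ →ₐ[A] B₀₁
  /-- restriction of functions from `U₀` to `P` -/
  P : B₀ →ₐ[A] A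
  /-- restriction of functions from `U₁` to `O` -/
  O : B₁ →ₐ[A] A

namespace PairCover

variable {k A B₀ B₁ B₀₁ : Type*} [CommRing k] [CommRing A] [CommRing B₀] [CommRing B₁]
  [CommRing B₀₁] [Algebra A B₀] [Algebra A B₁] [Algebra A B₀₁]
  [Algebra k A] [Algebra k B₀] [Algebra k B₁] [Algebra k B₀₁]

/-- Čech–de Rham cochains `((ω₀, p), (ω₁, o), f)` of degree one of the relative complex
`Ω^•_X ⊕ Ω^{•-1}_Y`: forms `ω₀`, `ω₁` on `U₀`, `U₁`, functions `p` on `Y ∩ U₀ = P` and `o` on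
`Y ∩ U₁ = O`, and a function `f` on `U₀₁`. -/
abbrev Cochain (_X : PairCover A B₀ B₁ B₀₁) : Type _ := (Ω[B₀⁄A] × A) × (Ω[B₁⁄A] × A) × B₀₁

variable (X : PairCover A B₀ B₁ B₀₁)

/-- The differential in degree zero,
`(f₀, f₁) ↦ ((df₀, f₀|_P), (df₁, f₁|_O), f₁ - f₀)`. -/
def d₀ : B₀ × B₁ →ₗ[A] X.Cochain where
  toFun f := ((KaehlerDifferential.D A B₀ f.1, X.P f.1), (KaehlerDifferential.D A B₁ f.2, X.O f.2),
    X.res₁ f.2 - X.res₀ f.1)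
  map_add' f g := by
    simp only [Prod.fst_add, Prod.snd_add, map_add, Prod.mk_add_mk, add_sub_add_comm]
  map_smul' r f := by
    simp only [Prod.smul_fst, Prod.smul_snd, map_smul, Prod.smul_mk, smul_sub, RingHom.id_apply,
      Derivation.map_smul]

/-- The differential in degree one, `((ω₀, p), (ω₁, o), f) ↦ ω₁ - ω₀ - df` on `U₀₁`. The other
components of the target (two-forms on a relative curve, one-forms on `Y`, functions on
`Y ∩ U₀₁ = ∅`) vanish. -/
def d₁ : X.Cochain →ₗ[A] Ω[B₀₁⁄A] where
  toFun z := kaehlerMap X.res₁ z.2.1.1 - kaehlerMap X.res₀ z.1.1 -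
    KaehlerDifferential.D A B₀₁ z.2.2
  map_add' y z := by
    simp only [Prod.fst_add, Prod.snd_add, map_add]
    abel
  map_smul' r z := by
    simp only [Prod.smul_fst, Prod.smul_snd, map_smul, Derivation.map_smul, smul_sub,
      RingHom.id_apply]

/-- The algebraic relative de Rham cohomology `H¹_dR((X, Y)/A)`. -/
abbrev H1 : Type _ :=
  LinearMap.ker X.d₁ ⧸ (LinearMap.range X.d₀).submoduleOf (LinearMap.ker X.d₁)

/-- The class of a cocycle. -/
def cls (z : X.Cochain) (hz : X.d₁ z = 0) : X.H1 :=
  Submodule.Quotient.mk ⟨z, LinearMap.mem_ker.2 hz⟩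

/-- A local lifting of the vector field `D` on the base to the pair `(X, Y)`: vector fields `e₀` on
`U₀` and `e₁` on `U₁` which lift `D` and are tangent to `Y`, with their restrictions `r₀` and `r₁`
to `U₀₁`. -/
structure Lift (D : Derivation k A A) where
  /-- the vector field on `U₀` -/
  e₀ : Derivation k B₀ B₀
  /-- the vector field on `U₁` -/
  e₁ : Derivation k B₁ B₁
  /-- the restriction of `e₀` to `U₀₁` -/
  r₀ : Derivation k B₀₁ B₀₁
  /-- the restriction of `e₁` to `U₀₁` -/
  r₁ : Derivation k B₀₁ B₀₁
  ext₀ : Extends D e₀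
  ext₁ : Extends D e₁
  res_r₀ : ∀ f, r₀ (X.res₀ f) = X.res₀ (e₀ f)
  res_r₁ : ∀ f, r₁ (X.res₁ f) = X.res₁ (e₁ f)
  tangent_P : ∀ f, X.P (e₀ f) = D (X.P f)
  tangent_O : ∀ f, X.O (e₁ f) = D (X.O f)

namespace Lift

variable {X} {D : Derivation k A A} (l : X.Lift D)

theorem ext_r₀ : Extends D l.r₀ := fun r => by
  rw [← X.res₀.commutes, l.res_r₀, l.ext₀, X.res₀.commutes]

theorem ext_r₁ : Extends D l.r₁ := fun r => by
  rw [← X.res₁.commutes, l.res_r₁, l.ext₁, X.res₁.commutes]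

/-- The vertical vector field `r₁ - r₀` on `U₀₁`. -/
def diff : Derivation A B₀₁ B₀₁ := vert D l.r₁ l.r₀ l.ext_r₁ l.ext_r₀

/-- The action of the local lifting on cochains:
`((ω₀, p), (ω₁, o), f) ↦ ((L_{e₀} ω₀, D p), (L_{e₁} ω₁, D o), r₁(f) + ⟨ω₀, r₁ - r₀⟩)`. -/
def act : X.Cochain →+ X.Cochain where
  toFun z := ((lieDeriv D l.e₀ l.ext₀ z.1.1, D z.1.2), (lieDeriv D l.e₁ l.ext₁ z.2.1.1, D z.2.1.2),
    l.r₁ z.2.2 + l.diff.liftKaehlerDifferential (kaehlerMap X.res₀ z.1.1))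
  map_zero' := by
    simp only [Prod.fst_zero, Prod.snd_zero, map_zero, add_zero]
    rfl
  map_add' y z := by
    simp only [Prod.fst_add, Prod.snd_add, map_add, Prod.mk_add_mk, add_add_add_comm]

theorem act_d₀ (f : B₀ × B₁) : l.act (X.d₀ f) = X.d₀ (l.e₀ f.1, l.e₁ f.2) := by
  change ((lieDeriv D l.e₀ l.ext₀ (KaehlerDifferential.D A B₀ f.1), D (X.P f.1)),
    (lieDeriv D l.e₁ l.ext₁ (KaehlerDifferential.D A B₁ f.2), D (X.O f.2)),
    l.r₁ (X.res₁ f.2 - X.res₀ f.1) +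
      l.diff.liftKaehlerDifferential (kaehlerMap X.res₀ (KaehlerDifferential.D A B₀ f.1))) =
    ((KaehlerDifferential.D A B₀ (l.e₀ f.1), X.P (l.e₀ f.1)),
      (KaehlerDifferential.D A B₁ (l.e₁ f.2), X.O (l.e₁ f.2)),
      X.res₁ (l.e₁ f.2) - X.res₀ (l.e₀ f.1))
  rw [lieDeriv_D, lieDeriv_D, l.tangent_P, l.tangent_O, kaehlerMap_D,
    Derivation.liftKaehlerDifferential_comp_D, diff, vert_apply, map_sub, l.res_r₁, l.res_r₀]
  congr 2
  abel

theorem d₁_act (hΩ : ∃ w : Ω[B₀₁⁄A], ∀ m : Ω[B₀₁⁄A], ∃ g : B₀₁, m = g • w) (z : X.Cochain)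
    (hz : X.d₁ z = 0) : X.d₁ (l.act z) = 0 := by
  change kaehlerMap X.res₁ z.2.1.1 - kaehlerMap X.res₀ z.1.1 -
    KaehlerDifferential.D A B₀₁ z.2.2 = 0 at hz
  change kaehlerMap X.res₁ (lieDeriv D l.e₁ l.ext₁ z.2.1.1) -
    kaehlerMap X.res₀ (lieDeriv D l.e₀ l.ext₀ z.1.1) - KaehlerDifferential.D A B₀₁
      (l.r₁ z.2.2 + l.diff.liftKaehlerDifferential (kaehlerMap X.res₀ z.1.1)) = 0
  rw [kaehlerMap_lie X.res₁ D l.e₁ l.r₁ l.ext₁ l.ext_r₁ l.res_r₁,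
    kaehlerMap_lie X.res₀ D l.e₀ l.r₀ l.ext₀ l.ext_r₀ l.res_r₀, map_add, diff,
    ← lieDeriv_sub D l.r₁ l.r₀ l.ext_r₁ l.ext_r₀ hΩ, ← lieDeriv_D D l.r₁ l.ext_r₁,
    ← sub_eq_zero.1 hz, map_sub]
  abel

/-- The map induced by a local lifting on cohomology. -/
def onH1 (hΩ : ∃ w : Ω[B₀₁⁄A], ∀ m : Ω[B₀₁⁄A], ∃ g : B₀₁, m = g • w) : X.H1 →+ X.H1 :=
  QuotientAddGroup.map _ _
    (((l.act.comp (LinearMap.ker X.d₁).subtype.toAddMonoidHom).codRestrict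
      (LinearMap.ker X.d₁).toAddSubgroup fun z =>
        LinearMap.mem_ker.2 (l.d₁_act hΩ z.1 (LinearMap.mem_ker.1 z.2))) :
      LinearMap.ker X.d₁ →+ LinearMap.ker X.d₁)
    (by
      rintro z ⟨f, hf⟩
      refine ⟨(l.e₀ f.1, l.e₁ f.2), ?_⟩
      rw [← l.act_d₀, hf]
      rfl)

theorem onH1_cls (hΩ : ∃ w : Ω[B₀₁⁄A], ∀ m : Ω[B₀₁⁄A], ∃ g : B₀₁, m = g • w) (z : X.Cochain)
    (hz : X.d₁ z = 0) : l.onH1 hΩ (X.cls z hz) = X.cls (l.act z) (l.d₁_act hΩ z hz) := rfl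

/-- The map induced on cohomology does not depend on the local lifting. -/
theorem onH1_eq (l m : X.Lift D)
    (hΩ₀ : ∃ w : Ω[B₀⁄A], ∀ m : Ω[B₀⁄A], ∃ g : B₀, m = g • w)
    (hΩ₁ : ∃ w : Ω[B₁⁄A], ∀ m : Ω[B₁⁄A], ∃ g : B₁, m = g • w)
    (hΩ : ∃ w : Ω[B₀₁⁄A], ∀ m : Ω[B₀₁⁄A], ∃ g : B₀₁, m = g • w) : l.onH1 hΩ = m.onH1 hΩ := by
  ext x
  obtain ⟨⟨z, hz⟩, rfl⟩ := Submodule.Quotient.mk_surjective _ x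
  have hz' : X.d₁ z = 0 := LinearMap.mem_ker.1 hz
  change l.onH1 hΩ (X.cls z hz') = m.onH1 hΩ (X.cls z hz')
  rw [onH1_cls, onH1_cls, cls, cls, Submodule.Quotient.eq]
  let v₀ := vert D l.e₀ m.e₀ l.ext₀ m.ext₀
  let v₁ := vert D l.e₁ m.e₁ l.ext₁ m.ext₁
  have c₀ : ∀ w : Ω[B₀⁄A], X.P (v₀.liftKaehlerDifferential w) = 0 := fun w => by
    refine kaehler_induction (p := fun w => X.P (v₀.liftKaehlerDifferential w) = 0) w ?_ ?_ ?_
    · simp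
    · intro x y hx hy
      rw [map_add, map_add, hx, hy, add_zero]
    · intro f g
      rw [map_smul, Derivation.liftKaehlerDifferential_comp_D, smul_eq_mul, map_mul, vert_apply,
        map_sub, l.tangent_P, m.tangent_P, sub_self, mul_zero]
  have c₁ : ∀ w : Ω[B₁⁄A], X.O (v₁.liftKaehlerDifferential w) = 0 := fun w => by
    refine kaehler_induction (p := fun w => X.O (v₁.liftKaehlerDifferential w) = 0) w ?_ ?_ ?_
    · simp
    · intro x y hx hy
      rw [map_add, map_add, hx, hy, add_zero]
    · intro f g
      rw [map_smul, Derivation.liftKaehlerDifferential_comp_D, smul_eq_mul, map_mul, vert_apply,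
        map_sub, l.tangent_O, m.tangent_O, sub_self, mul_zero]
  have s₀ : ∀ w : Ω[B₀⁄A], X.res₀ (v₀.liftKaehlerDifferential w) =
      (vert D l.r₀ m.r₀ l.ext_r₀ m.ext_r₀).liftKaehlerDifferential (kaehlerMap X.res₀ w) :=
    fun w => by
    refine kaehler_induction (p := fun w => X.res₀ (v₀.liftKaehlerDifferential w) =
      (vert D l.r₀ m.r₀ l.ext_r₀ m.ext_r₀).liftKaehlerDifferential (kaehlerMap X.res₀ w)) w ?_ ?_ ?_
    · simp
    · intro x y hx hy
      rw [map_add, map_add, hx, hy, map_add, map_add]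
    · intro f g
      rw [map_smul, Derivation.liftKaehlerDifferential_comp_D, smul_eq_mul, map_mul, vert_apply,
        kaehlerMap_smul, map_smul, kaehlerMap_D, Derivation.liftKaehlerDifferential_comp_D,
        vert_apply, l.res_r₀, m.res_r₀, map_sub, smul_eq_mul]
  have s₁ : ∀ w : Ω[B₁⁄A], X.res₁ (v₁.liftKaehlerDifferential w) =
      (vert D l.r₁ m.r₁ l.ext_r₁ m.ext_r₁).liftKaehlerDifferential (kaehlerMap X.res₁ w) :=
    fun w => by
    refine kaehler_induction (p := fun w => X.res₁ (v₁.liftKaehlerDifferential w) =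
      (vert D l.r₁ m.r₁ l.ext_r₁ m.ext_r₁).liftKaehlerDifferential (kaehlerMap X.res₁ w)) w ?_ ?_ ?_
    · simp
    · intro x y hx hy
      rw [map_add, map_add, hx, hy, map_add, map_add]
    · intro f g
      rw [map_smul, Derivation.liftKaehlerDifferential_comp_D, smul_eq_mul, map_mul, vert_apply,
        kaehlerMap_smul, map_smul, kaehlerMap_D, Derivation.liftKaehlerDifferential_comp_D,
        vert_apply, l.res_r₁, m.res_r₁, map_sub, smul_eq_mul]
  have hf : kaehlerMap X.res₁ z.2.1.1 =
      KaehlerDifferential.D A B₀₁ z.2.2 + kaehlerMap X.res₀ z.1.1 := by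
    have := hz'
    change kaehlerMap X.res₁ z.2.1.1 - kaehlerMap X.res₀ z.1.1 -
      KaehlerDifferential.D A B₀₁ z.2.2 = 0 at this
    rw [sub_sub, sub_eq_zero] at this
    rw [this, add_comm]
  have hdiff : l.diff + vert D l.r₀ m.r₀ l.ext_r₀ m.ext_r₀ =
      m.diff + vert D l.r₁ m.r₁ l.ext_r₁ m.ext_r₁ := by
    ext g
    simp only [diff, Derivation.add_apply, vert_apply]
    ring
  have hd' : l.diff.liftKaehlerDifferential (kaehlerMap X.res₀ z.1.1) +
      (vert D l.r₀ m.r₀ l.ext_r₀ m.ext_r₀).liftKaehlerDifferential (kaehlerMap X.res₀ z.1.1) =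
      m.diff.liftKaehlerDifferential (kaehlerMap X.res₀ z.1.1) +
      (vert D l.r₁ m.r₁ l.ext_r₁ m.ext_r₁).liftKaehlerDifferential (kaehlerMap X.res₀ z.1.1) := by
    refine kaehler_induction (p := fun w => l.diff.liftKaehlerDifferential w +
      (vert D l.r₀ m.r₀ l.ext_r₀ m.ext_r₀).liftKaehlerDifferential w =
      m.diff.liftKaehlerDifferential w +
      (vert D l.r₁ m.r₁ l.ext_r₁ m.ext_r₁).liftKaehlerDifferential w) _ ?_ ?_ ?_
    · simp
    · intro x y hx hy
      rw [map_add, map_add, map_add, map_add, add_add_add_comm, hx, hy, add_add_add_comm]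
    · intro f g
      have := congrArg (f • ·) (Derivation.congr_fun hdiff g)
      simpa only [map_smul, Derivation.liftKaehlerDifferential_comp_D, Derivation.add_apply,
        smul_add] using this
  refine ⟨(v₀.liftKaehlerDifferential z.1.1, v₁.liftKaehlerDifferential z.2.1.1), ?_⟩
  change ((KaehlerDifferential.D A B₀ (v₀.liftKaehlerDifferential z.1.1),
      X.P (v₀.liftKaehlerDifferential z.1.1)),
    (KaehlerDifferential.D A B₁ (v₁.liftKaehlerDifferential z.2.1.1),
      X.O (v₁.liftKaehlerDifferential z.2.1.1)),
    X.res₁ (v₁.liftKaehlerDifferential z.2.1.1) - X.res₀ (v₀.liftKaehlerDifferential z.1.1)) =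
    ((lieDeriv D l.e₀ l.ext₀ z.1.1 - lieDeriv D m.e₀ m.ext₀ z.1.1, D z.1.2 - D z.1.2),
      (lieDeriv D l.e₁ l.ext₁ z.2.1.1 - lieDeriv D m.e₁ m.ext₁ z.2.1.1, D z.2.1.2 - D z.2.1.2),
      (l.r₁ z.2.2 + l.diff.liftKaehlerDifferential (kaehlerMap X.res₀ z.1.1)) -
        (m.r₁ z.2.2 + m.diff.liftKaehlerDifferential (kaehlerMap X.res₀ z.1.1)))
  rw [lieDeriv_sub D l.e₀ m.e₀ l.ext₀ m.ext₀ hΩ₀, lieDeriv_sub D l.e₁ m.e₁ l.ext₁ m.ext₁ hΩ₁, c₀,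
    c₁, sub_self, sub_self, s₀, s₁, hf, map_add, Derivation.liftKaehlerDifferential_comp_D,
    vert_apply]
  congr 2
  linear_combination -hd'

end Lift

end PairCover

end Cohomology

/-! ### Double covers `y² = f(x)` of the line -/

section DoubleCover

variable {k A B C : Type*} [CommRing k] [CommRing A] [CommRing B] [CommRing C]
  [Algebra k A] [Algebra k B] [Algebra A B]

theorem solve_pair {M : Type*} [AddCommGroup M] [Module B M] {p q y g : B} (h1 : p * y ^ 2 + q * g = 1)
    {m n : M} (h2 : (2 * y) • n = g • m) :
    y • ((p * y) • m + (2 * q) • n) = m ∧ g • ((p * y) • m + (2 * q) • n) = (2 : B) • n := by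
  constructor
  · calc y • ((p * y) • m + (2 * q) • n) = (p * y ^ 2) • m + q • ((2 * y) • n) := by module
      _ = (p * y ^ 2 + q * g) • m := by rw [h2]; module
      _ = m := by rw [h1, one_smul]
  · calc g • ((p * y) • m + (2 * q) • n) = (p * y) • (g • m) + (2 * q * g) • n := by module
      _ = (2 * (p * y ^ 2 + q * g)) • n := by rw [← h2]; module
      _ = (2 : B) • n := by rw [h1, mul_one]

/-- The action of a derivation on the coefficients of a polynomial. -/
def coeffDer (D : Derivation k A A) : Derivation k A[X] A[X] :=
  PolynomialModule.equivPolynomialSelf.compDer D.mapCoeffs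

theorem coeffDer_monomial (D : Derivation k A A) (n : ℕ) (r : A) :
    coeffDer D (monomial n r) = monomial n (D r) := by
  simp [coeffDer]

theorem coeffDer_zero (f : A[X]) : coeffDer (0 : Derivation k A A) f = 0 := by
  induction f using Polynomial.induction_on' with
  | add p q hp hq => rw [map_add, hp, hq, add_zero]
  | monomial n r => rw [coeffDer_monomial, Derivation.zero_apply, map_zero]

theorem ext_aeval (D : Derivation k A A) (E : Derivation k B B) (h : Extends D E) (g : B)
    (f : A[X]) : E (aeval g f) = aeval g (coeffDer D f) + aeval g (derivative f) * E g := by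
  induction f using Polynomial.induction_on' with
  | add p q hp hq =>
    simp only [map_add, hp, hq]
    ring
  | monomial n r =>
    simp only [coeffDer_monomial, aeval_monomial, Derivation.leibniz, Derivation.leibniz_pow, h r,
      derivative_monomial, map_mul, map_natCast, smul_eq_mul, nsmul_eq_mul]
    ring

/-- The homomorphism `r ↦ r + ε D(r)` to the dual numbers. -/
def dualBase (D : Derivation k A A) (B : Type*) [CommRing B] [Algebra A B] : A →+* DualNumber B where
  toFun r := TrivSqZeroExt.inl (algebraMap A B r) + TrivSqZeroExt.inr (algebraMap A B (D r))
  map_one' := by ext <;> simp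
  map_mul' r s := by
    ext
    · simp
    · rw [TrivSqZeroExt.snd_mul]
      simp only [TrivSqZeroExt.snd_add, TrivSqZeroExt.fst_add, TrivSqZeroExt.snd_inl,
        TrivSqZeroExt.fst_inl, TrivSqZeroExt.snd_inr, TrivSqZeroExt.fst_inr, zero_add, add_zero,
        Derivation.leibniz, smul_eq_mul, map_add, map_mul, MulOpposite.smul_eq_mul_unop,
        MulOpposite.unop_op]
      ring
  map_zero' := by ext <;> simp
  map_add' r s := by
    rw [map_add, map_add, map_add, TrivSqZeroExt.inl_add, TrivSqZeroExt.inr_add]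
    abel

theorem fst_dualBase (D : Derivation k A A) (r : A) :
    (dualBase D B r).fst = algebraMap A B r := by
  change (TrivSqZeroExt.inl (algebraMap A B r) + TrivSqZeroExt.inr (algebraMap A B (D r)) :
    DualNumber B).fst = _
  rw [TrivSqZeroExt.fst_add, TrivSqZeroExt.fst_inl, TrivSqZeroExt.fst_inr, add_zero]

theorem snd_dualBase (D : Derivation k A A) (r : A) :
    (dualBase D B r).snd = algebraMap A B (D r) := by
  change (TrivSqZeroExt.inl (algebraMap A B r) + TrivSqZeroExt.inr (algebraMap A B (D r)) :
    DualNumber B).snd = _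
  rw [TrivSqZeroExt.snd_add, TrivSqZeroExt.snd_inl, TrivSqZeroExt.snd_inr, zero_add]

theorem dualBase_eval (D : Derivation k A A) (x s : B) (f : A[X]) :
    eval₂ (dualBase D B) (TrivSqZeroExt.inl x + TrivSqZeroExt.inr s) f =
      TrivSqZeroExt.inl (aeval x f) +
        TrivSqZeroExt.inr (aeval x (coeffDer D f) + aeval x (derivative f) * s) := by
  induction f using Polynomial.induction_on' with
  | add p q hp hq =>
    rw [eval₂_add, hp, hq]
    ext
    · simp
    · simp
      ring
  | monomial n r =>
    rw [eval₂_monomial]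
    ext
    · simp [fst_dualBase, aeval_monomial]
    · simp [fst_dualBase, snd_dualBase, aeval_monomial, coeffDer_monomial, derivative_monomial,
        TrivSqZeroExt.snd_pow]
      ring

/-- A derivation from a section of the dual numbers. -/
theorem exists_ofDual [IsScalarTower k A B] (D : Derivation k A A) (φ : B →+* DualNumber B)
    (h1 : ∀ g, (φ g).fst = g) (h2 : ∀ r, φ (algebraMap A B r) = dualBase D B r) :
    ∃ E : Derivation k B B, Extends D E ∧ ∀ g, E g = (φ g).snd := by
  refine ⟨Derivation.mk'
    { toFun := fun g => (φ g).snd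
      map_add' := fun f g => by simp
      map_smul' := fun c g => by
        have : c • g = algebraMap A B (algebraMap k A c) * g := by
          rw [Algebra.smul_def, IsScalarTower.algebraMap_apply k A B]
        rw [this, map_mul, h2, TrivSqZeroExt.snd_mul, fst_dualBase, snd_dualBase,
          Derivation.map_algebraMap, map_zero, smul_zero, add_zero, RingHom.id_apply,
          ← IsScalarTower.algebraMap_apply k A B, algebraMap_smul] }
    (fun f g => by simp [h1, mul_comm]), fun r => ?_, fun g => rfl⟩
  change (φ _).snd = _
  rw [h2, snd_dualBase]

/-- The coordinate ring `A[x, y]/(y² - f(x))`. -/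
abbrev DoubleCover (f : A[X]) : Type _ := AdjoinRoot (X ^ 2 - Polynomial.C f : A[X][X])

namespace DoubleCover

variable (f : A[X])

/-- The coordinate function `x`. -/
def x : DoubleCover f := AdjoinRoot.of _ X

/-- The coordinate function `y`. -/
def y : DoubleCover f := AdjoinRoot.root _

theorem of_eq (p : A[X]) :
    AdjoinRoot.of (X ^ 2 - Polynomial.C f : A[X][X]) p = aeval (x f) p := by
  induction p using Polynomial.induction_on' with
  | add p q hp hq => rw [map_add, map_add, hp, hq]
  | monomial n r =>
    rw [aeval_monomial, ← C_mul_X_pow_eq_monomial, map_mul, map_pow]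
    rfl

theorem y_sq : y f ^ 2 = aeval (x f) f := by
  have h := AdjoinRoot.eval₂_root (X ^ 2 - Polynomial.C f : A[X][X])
  rw [eval₂_sub, eval₂_pow, eval₂_X, eval₂_C, sub_eq_zero, of_eq] at h
  exact h

/-- The homomorphism with prescribed values at `x` and `y`. -/
def ringHom (φ : A →+* C) (s t : C) (h : t ^ 2 = eval₂ φ s f) : DoubleCover f →+* C :=
  AdjoinRoot.lift (eval₂RingHom φ s) t (by
    rw [eval₂_sub, eval₂_pow, eval₂_X, eval₂_C, coe_eval₂RingHom, h, sub_self])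

theorem ringHom_x (φ : A →+* C) (s t : C) (h : t ^ 2 = eval₂ φ s f) :
    ringHom f φ s t h (x f) = s := by
  simp [ringHom, x]

theorem ringHom_y (φ : A →+* C) (s t : C) (h : t ^ 2 = eval₂ φ s f) :
    ringHom f φ s t h (y f) = t := by
  simp [ringHom, y]

theorem ringHom_algebraMap (φ : A →+* C) (s t : C) (h : t ^ 2 = eval₂ φ s f) (r : A) :
    ringHom f φ s t h (algebraMap A (DoubleCover f) r) = φ r := by
  change ringHom f φ s t h (AdjoinRoot.of _ (Polynomial.C r)) = φ r
  simp [ringHom]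

/-- The homomorphism of `A`-algebras with prescribed values at `x` and `y`. -/
def algHom [Algebra A C] (s t : C) (h : t ^ 2 = aeval s f) : DoubleCover f →ₐ[A] C :=
  { ringHom f (algebraMap A C) s t h with
    commutes' := fun r => ringHom_algebraMap f (algebraMap A C) s t h r }

theorem algHom_x [Algebra A C] (s t : C) (h : t ^ 2 = aeval s f) : algHom f s t h (x f) = s :=
  ringHom_x f (algebraMap A C) s t h

theorem algHom_y [Algebra A C] (s t : C) (h : t ^ 2 = aeval s f) : algHom f s t h (y f) = t :=
  ringHom_y f (algebraMap A C) s t h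

theorem induction {p : DoubleCover f → Prop} (hx : p (x f)) (hy : p (y f))
    (hr : ∀ r : A, p (algebraMap A _ r)) (hadd : ∀ g h, p g → p h → p (g + h))
    (hmul : ∀ g h, p g → p h → p (g * h)) (g : DoubleCover f) : p g := by
  have hC : ∀ q : A[X], p (AdjoinRoot.of _ q) := fun q => by
    induction q using Polynomial.induction_on with
    | C r => exact hr r
    | add q s hq hs => rw [map_add]; exact hadd _ _ hq hs
    | monomial n r h =>
      have e : Polynomial.C r * X ^ (n + 1) = Polynomial.C r * X ^ n * X := by ring
      rw [e, map_mul]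
      exact hmul _ _ h hx
  refine AdjoinRoot.induction_on _ g fun q => ?_
  induction q using Polynomial.induction_on with
  | C r => exact hC r
  | add q s hq hs => rw [map_add]; exact hadd _ _ hq hs
  | monomial n r h =>
    have e : Polynomial.C r * X ^ (n + 1) = Polynomial.C r * X ^ n * X := by ring
    rw [e, map_mul]
    exact hmul _ _ h (by rw [AdjoinRoot.mk_X]; exact hy)

/-- A lift which is compatible with another one on the coordinates is compatible with it. -/
theorem compat {k : Type*} [CommRing k] [Algebra k A] [Algebra k C] [Algebra A C]
    (ρ : DoubleCover f →ₐ[A] C)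
    (D : Derivation k A A) (E : Derivation k (DoubleCover f) (DoubleCover f)) (F : Derivation k C C)
    (hE : Extends D E) (hF : Extends D F) (hx : F (ρ (x f)) = ρ (E (x f)))
    (hy : F (ρ (y f)) = ρ (E (y f))) (g : DoubleCover f) : F (ρ g) = ρ (E g) := by
  induction g using DoubleCover.induction with
  | hx => exact hx
  | hy => exact hy
  | hr r => rw [ρ.commutes, hE, hF, ρ.commutes]
  | hadd g h hg hh => simp only [map_add, hg, hh]
  | hmul g h hg hh => simp only [map_mul, map_add, Derivation.leibniz, smul_eq_mul, hg, hh]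

theorem y_lin (D : Derivation k A A) (E : Derivation k (DoubleCover f) (DoubleCover f))
    (h : Extends D E) : 2 * y f * E (y f) =
      aeval (x f) (coeffDer D f) + aeval (x f) (derivative f) * E (x f) := by
  rw [← ext_aeval D E h, ← y_sq, Derivation.leibniz_pow]
  simp only [Nat.add_one_sub_one, pow_one, smul_eq_mul, nsmul_eq_mul, Nat.cast_ofNat]
  ring

/-- Derivations of `A[x, y]/(y² - f(x))` are given by their values at `x` and `y`. -/
theorem exists_der (D : Derivation k A A) (s t : DoubleCover f)
    (h : 2 * y f * t = aeval (x f) (coeffDer D f) + aeval (x f) (derivative f) * s) :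
    ∃ E : Derivation k (DoubleCover f) (DoubleCover f),
      Extends D E ∧ E (x f) = s ∧ E (y f) = t := by
  have h' : (TrivSqZeroExt.inl (y f) + TrivSqZeroExt.inr t : DualNumber (DoubleCover f)) ^ 2 =
      eval₂ (dualBase D (DoubleCover f)) (TrivSqZeroExt.inl (x f) + TrivSqZeroExt.inr s) f := by
    rw [dualBase_eval, ← h, ← y_sq]
    ext
    · simp
    · simp [TrivSqZeroExt.snd_pow]
      ring
  obtain ⟨E, hE, hE'⟩ := exists_ofDual (k := k) D (ringHom f (dualBase D (DoubleCover f)) _ _ h')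
    (fun g => by
      induction g using DoubleCover.induction with
      | hx => rw [ringHom_x]; simp
      | hy => rw [ringHom_y]; simp
      | hr r => rw [ringHom_algebraMap, fst_dualBase]
      | hadd g h hg hh => rw [map_add, TrivSqZeroExt.fst_add, hg, hh]
      | hmul g h hg hh => rw [map_mul, TrivSqZeroExt.fst_mul, hg, hh])
    (fun r => ringHom_algebraMap _ _ _ _ _ r)
  refine ⟨E, hE, ?_, ?_⟩
  · rw [hE', ringHom_x]; simp
  · rw [hE', ringHom_y]; simp

variable {f}

theorem exists_bezout (hf : f.Separable) :
    ∃ p q : A[X], p * f + q * derivative f = 1 := hf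

/-- A vector field on the base lifts to a smooth double cover, tangentially to a section. -/
theorem exists_lift [Invertible (2 : A)] (hf : f.Separable) (s t : A) (h : t ^ 2 = aeval s f)
    (D : Derivation k A A) : ∃ E : Derivation k (DoubleCover f) (DoubleCover f),
      Extends D E ∧ ∀ g, algHom f s t h (E g) = D (algHom f s t h g) := by
  obtain ⟨p, q, hpq⟩ := exists_bezout hf
  have h2 : (2 : DoubleCover f) * algebraMap A _ (⅟2) = 1 := by
    rw [← map_ofNat (algebraMap A (DoubleCover f)) 2, ← map_mul, mul_invOf_self, map_one]
  set c : DoubleCover f := algebraMap A _ (⅟2) with hc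
  have hB : aeval (x f) p * y f ^ 2 + aeval (x f) q * aeval (x f) (derivative f) = 1 := by
    rw [y_sq, ← map_mul, ← map_mul, ← map_add, hpq, map_one]
  have hA : aeval s p * t ^ 2 + aeval s q * aeval s (derivative f) = 1 := by
    rw [h, ← map_mul, ← map_mul, ← map_add, hpq, map_one]
  obtain ⟨E, hE, hEx, hEy⟩ := exists_der f D
    (-(aeval (x f) q * aeval (x f) (coeffDer D f)))
    (c * aeval (x f) p * y f * aeval (x f) (coeffDer D f)) (by
      linear_combination (aeval (x f) p * y f ^ 2 * aeval (x f) (coeffDer D f)) * h2 +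
        aeval (x f) (coeffDer D f) * hB)
  set σ := algHom f s t h with hσ
  have hσx : σ (x f) = s := algHom_x f s t h
  have hσy : σ (y f) = t := algHom_y f s t h
  have hσp : ∀ p : A[X], σ (aeval (x f) p) = aeval s p := fun p => by
    rw [← aeval_algHom_apply, hσx]
  have e1 : 2 * t * D t = aeval s (coeffDer D f) + aeval s (derivative f) * D s := by
    rw [← ext_aeval D D (fun r => rfl), ← h, Derivation.leibniz_pow]
    simp only [Nat.add_one_sub_one, pow_one, smul_eq_mul, nsmul_eq_mul, Nat.cast_ofNat]
    ring
  have e2 : 2 * t * σ (E (y f)) =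
      aeval s (coeffDer D f) + aeval s (derivative f) * σ (E (x f)) := by
    have := congrArg σ (y_lin f D E hE)
    simpa only [map_mul, map_add, hσp, hσy, map_ofNat] using this
  obtain ⟨e3, e4⟩ := solve_pair (M := A) hA (m := D s - σ (E (x f))) (n := D t - σ (E (y f)))
    (by simp only [smul_eq_mul]; linear_combination e1 - e2)
  set l : A := (aeval s p * t) • (D s - σ (E (x f))) + (2 * aeval s q) • (D t - σ (E (y f)))
  simp only [smul_eq_mul] at e3 e4
  obtain ⟨F, hF, hFx, hFy⟩ := exists_der f D (E (x f) + algebraMap A _ l * y f)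
    (E (y f) + algebraMap A _ l * c * aeval (x f) (derivative f)) (by
      linear_combination y_lin f D E hE +
        (algebraMap A _ l * y f * aeval (x f) (derivative f)) * h2)
  refine ⟨F, hF, fun g => (compat f σ D F D hF (fun r => rfl) ?_ ?_ g).symm⟩
  · rw [hFx, hσx, map_add, map_mul, hσy, AlgHom.commutes, Algebra.algebraMap_self_apply]
    linear_combination -e3
  · rw [hFy, hσy, map_add, map_mul, map_mul, hσp, hc, AlgHom.commutes, AlgHom.commutes,
      Algebra.algebraMap_self_apply, Algebra.algebraMap_self_apply]
    linear_combination -(⅟2 : A) * e4 - (D t - σ (E (y f))) * invOf_mul_self (2 : A)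

/-- On a smooth double cover there is a unique relative differential `w`, usually written `dx/y`,
with `y w = dx` and `f'(x) w = 2 dy`. -/
theorem existsUnique_invDiff (hf : f.Separable) : ∃! w : Ω[DoubleCover f⁄A],
    y f • w = KaehlerDifferential.D A _ (x f) ∧
    aeval (x f) (derivative f) • w = (2 : DoubleCover f) • KaehlerDifferential.D A _ (y f) := by
  obtain ⟨p, q, hpq⟩ := exists_bezout hf
  have hB : aeval (x f) p * y f ^ 2 + aeval (x f) q * aeval (x f) (derivative f) = 1 := by
    rw [y_sq, ← map_mul, ← map_mul, ← map_add, hpq, map_one]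
  have hd : (2 * y f) • KaehlerDifferential.D A _ (y f) =
      aeval (x f) (derivative f) • KaehlerDifferential.D A _ (x f) := by
    rw [← Derivation.map_aeval, ← y_sq, Derivation.leibniz_pow]
    simp only [Nat.add_one_sub_one, pow_one]
    module
  refine ⟨_, solve_pair hB hd, fun w hw => ?_⟩
  calc w = (aeval (x f) p * y f ^ 2 + aeval (x f) q * aeval (x f) (derivative f)) • w := by
        rw [hB, one_smul]
    _ = (aeval (x f) p * y f) • (y f • w) +
        aeval (x f) q • (aeval (x f) (derivative f) • w) := by module
    _ = _ := by rw [hw.1, hw.2]; module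

/-- The relative differential `dx/y`. -/
def invDiff (hf : f.Separable) : Ω[DoubleCover f⁄A] := (existsUnique_invDiff hf).choose

theorem y_smul_invDiff (hf : f.Separable) :
    y f • invDiff hf = KaehlerDifferential.D A _ (x f) :=
  (existsUnique_invDiff hf).choose_spec.1.1

theorem deriv_smul_invDiff (hf : f.Separable) : aeval (x f) (derivative f) • invDiff hf =
    (2 : DoubleCover f) • KaehlerDifferential.D A _ (y f) :=
  (existsUnique_invDiff hf).choose_spec.1.2

theorem D_y [Invertible (2 : A)] (hf : f.Separable) : KaehlerDifferential.D A _ (y f) =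
    (algebraMap A _ (⅟2) * aeval (x f) (derivative f)) • invDiff hf := by
  rw [mul_smul, deriv_smul_invDiff, smul_smul, ← map_ofNat (algebraMap A (DoubleCover f)) 2,
    ← map_mul, invOf_mul_self, map_one, one_smul]

theorem invDiff_span [Invertible (2 : A)] (hf : f.Separable) (m : Ω[DoubleCover f⁄A]) :
    ∃ g : DoubleCover f, m = g • invDiff hf := by
  refine kaehler_induction (p := fun m => ∃ g : DoubleCover f, m = g • invDiff hf) m
    ⟨0, (zero_smul _ _).symm⟩ ?_ ?_
  · rintro _ _ ⟨g, rfl⟩ ⟨h, rfl⟩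
    exact ⟨g + h, (add_smul _ _ _).symm⟩
  · intro h g
    have : ∃ g' : DoubleCover f, KaehlerDifferential.D A _ g = g' • invDiff hf := by
      induction g using DoubleCover.induction with
      | hx => exact ⟨_, (y_smul_invDiff hf).symm⟩
      | hy => exact ⟨_, D_y hf⟩
      | hr r => exact ⟨0, by rw [Derivation.map_algebraMap, zero_smul]⟩
      | hadd g h hg hh =>
        obtain ⟨g', hg⟩ := hg
        obtain ⟨h', hh⟩ := hh
        exact ⟨g' + h', by rw [map_add, hg, hh, add_smul]⟩
      | hmul g h hg hh =>
        obtain ⟨g', hg⟩ := hg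
        obtain ⟨h', hh⟩ := hh
        exact ⟨g * h' + h * g', by rw [Derivation.leibniz, hg, hh]; module⟩
    obtain ⟨g', hg⟩ := this
    exact ⟨h * g', by rw [hg, smul_smul]⟩

/-- A lift on a smooth double cover extends to an overlap on which some lift and the vertical vector
field exist. -/
theorem exists_overlap {k C : Type*} [CommRing k] [CommRing C] [Algebra k A] [Algebra k C]
    [Algebra A C] [IsScalarTower k A C] [Invertible (2 : A)] (hf : f.Separable)
    (ρ : DoubleCover f →ₐ[A] C) (D : Derivation k A A)
    (e : Derivation k (DoubleCover f) (DoubleCover f)) (he : Extends D e) (r : Derivation k C C)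
    (hr : Extends D r) (V : Derivation A C C) (hu : V (ρ (x f)) = ρ (y f))
    (hv : 2 * V (ρ (y f)) = aeval (ρ (x f)) (derivative f)) :
    ∃ s : Derivation k C C, ∀ g, s (ρ g) = ρ (e g) := by
  obtain ⟨p, q, hpq⟩ := exists_bezout hf
  have h2 : (2 : C) * algebraMap A C (⅟2) = 1 := by
    rw [← map_ofNat (algebraMap A C) 2, ← map_mul, mul_invOf_self, map_one]
  have hs : ρ (y f) ^ 2 = aeval (ρ (x f)) f := by
    rw [← map_pow, y_sq, aeval_algHom_apply]
  have hB : aeval (ρ (x f)) p * ρ (y f) ^ 2 +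
      aeval (ρ (x f)) q * aeval (ρ (x f)) (derivative f) = 1 := by
    rw [hs, ← map_mul, ← map_mul, ← map_add, hpq, map_one]
  have e1 : 2 * ρ (y f) * ρ (e (y f)) = aeval (ρ (x f)) (coeffDer D f) +
      aeval (ρ (x f)) (derivative f) * ρ (e (x f)) := by
    have := congrArg ρ (y_lin f D e he)
    simpa only [map_mul, map_add, aeval_algHom_apply, map_ofNat] using this
  have e2 : 2 * ρ (y f) * r (ρ (y f)) = aeval (ρ (x f)) (coeffDer D f) +
      aeval (ρ (x f)) (derivative f) * r (ρ (x f)) := by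
    rw [← ext_aeval D r hr, ← hs, Derivation.leibniz_pow]
    simp only [Nat.add_one_sub_one, pow_one, smul_eq_mul, nsmul_eq_mul, Nat.cast_ofNat]
    ring
  obtain ⟨e3, e4⟩ := solve_pair (M := C) hB (m := ρ (e (x f)) - r (ρ (x f)))
    (n := ρ (e (y f)) - r (ρ (y f))) (by simp only [smul_eq_mul]; linear_combination e1 - e2)
  simp only [smul_eq_mul] at e3 e4
  set l : C := aeval (ρ (x f)) p * ρ (y f) * (ρ (e (x f)) - r (ρ (x f))) +
    2 * aeval (ρ (x f)) q * (ρ (e (y f)) - r (ρ (y f)))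
  have hs' : ∀ c, (r + (l • V).restrictScalars k) c = r c + l * V c := fun c => rfl
  refine ⟨r + (l • V).restrictScalars k,
    compat f ρ D e _ he (fun c => by rw [hs', hr, V.map_algebraMap, mul_zero, add_zero]) ?_ ?_⟩
  · rw [hs', hu]
    linear_combination e3
  · rw [hs']
    linear_combination algebraMap A C (⅟2) * (e4 + l * hv) -
      (l * V (ρ (y f)) - ρ (e (y f)) + r (ρ (y f))) * h2

end DoubleCover

/-! ### Localization -/

theorem exists_localize [IsScalarTower k A B] (D : Derivation k A A) (E : Derivation k B B)
    (hE : Extends D E) (w : B) :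
    ∃ F : Derivation k (Localization.Away w) (Localization.Away w), Extends D F ∧
      ∀ g, F (algebraMap B _ g) = algebraMap B _ (E g) := by
  have hu : IsUnit (dualBase E (Localization.Away w) w) := by
    rw [TrivSqZeroExt.isUnit_iff_isUnit_fst]
    simpa only [fst_dualBase] using IsLocalization.Away.algebraMap_isUnit (S := Localization.Away w) w
  let φ : Localization.Away w →+* DualNumber (Localization.Away w) :=
    IsLocalization.Away.lift (g := dualBase E (Localization.Away w)) w hu
  have hφ : ∀ g, φ (algebraMap B _ g) = dualBase E _ g := fun g => IsLocalization.Away.lift_eq w hu g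
  have h1 : ((TrivSqZeroExt.fstHom (Localization.Away w) (Localization.Away w)
      (Localization.Away w)).toRingHom.comp φ) =
      RingHom.id _ := IsLocalization.ringHom_ext (Submonoid.powers w) (by
    ext g
    change (φ (algebraMap B _ g)).fst = algebraMap B _ g
    rw [hφ, fst_dualBase])
  obtain ⟨F, hF, hF'⟩ := exists_ofDual (k := k) E φ (fun g => DFunLike.congr_fun h1 g) hφ
  refine ⟨F, fun r => ?_, hF⟩
  rw [IsScalarTower.algebraMap_apply A B, hF, hE, ← IsScalarTower.algebraMap_apply A B]

theorem span_localize (w : B) (η : Ω[B⁄A]) (h : ∀ m : Ω[B⁄A], ∃ g : B, m = g • η)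
    (m : Ω[Localization.Away w⁄A]) : ∃ g : Localization.Away w,
      m = g • kaehlerMap (IsScalarTower.toAlgHom A B (Localization.Away w)) η := by
  set η' := kaehlerMap (IsScalarTower.toAlgHom A B (Localization.Away w)) η with hη
  refine kaehler_induction (p := fun m => ∃ g : Localization.Away w, m = g • η') m
    ⟨0, (zero_smul _ _).symm⟩ ?_ ?_
  · rintro _ _ ⟨g, rfl⟩ ⟨h, rfl⟩
    exact ⟨g + h, (add_smul _ _ _).symm⟩
  · intro b z
    have hB : ∀ g : B, ∃ g' : Localization.Away w,
        KaehlerDifferential.D A _ (algebraMap B (Localization.Away w) g) = g' • η' := fun g => by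
      obtain ⟨c, hc⟩ := h (KaehlerDifferential.D A B g)
      refine ⟨algebraMap B _ c, ?_⟩
      have := kaehlerMap_D (IsScalarTower.toAlgHom A B (Localization.Away w)) g
      rw [hc, kaehlerMap_smul] at this
      exact this.symm
    obtain ⟨⟨g, s⟩, hz⟩ := IsLocalization.surj (Submonoid.powers w) z
    obtain ⟨s', hs'⟩ := IsLocalization.map_units (Localization.Away w) s
    obtain ⟨c, hc⟩ := hB g
    obtain ⟨d, hd⟩ := hB s
    have h3 := congrArg (KaehlerDifferential.D A (Localization.Away w)) hz
    rw [Derivation.leibniz, hc, hd] at h3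
    have h4 : KaehlerDifferential.D A (Localization.Away w) z =
        (↑s'⁻¹ * (c - z * d)) • η' := by
      have h5 : (s' : Localization.Away w) • KaehlerDifferential.D A (Localization.Away w) z =
          (c - z * d) • η' := by
        rw [hs', sub_smul, ← h3, mul_smul]
        abel
      rw [mul_smul, ← h5, smul_smul, Units.inv_mul, one_smul]
    exact ⟨b * (↑s'⁻¹ * (c - z * d)), by rw [h4, smul_smul]⟩

end DoubleCover

/-! ### Elliptic curves with two marked points -/

/-- Parameters over a ring `A` of an elliptic curve `y² = 4x³ - t₂x - t₃` with a marked point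
`(a, b)`; here `t₃ = 4a³ - t₂a - b²`, and `27t₃² - t₂³` is invertible. -/
structure EllipticPair (A : Type*) [CommRing A] where
  /-- the coefficient `t₂` -/
  t₂ : A
  /-- the first coordinate of the marked point -/
  a : A
  /-- the second coordinate of the marked point -/
  b : A
  isUnit_disc : IsUnit (27 * (4 * a ^ 3 - t₂ * a - b ^ 2) ^ 2 - t₂ ^ 3)

namespace EllipticPair

variable {A : Type*} [CommRing A] (W : EllipticPair A)

/-- The coefficient `t₃ = 4a³ - t₂a - b²`. -/
def t₃ : A := 4 * W.a ^ 3 - W.t₂ * W.a - W.b ^ 2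

/-- The polynomial `4x³ - t₂x - t₃`. -/
def f₀ : A[X] := 4 * X ^ 3 - C W.t₂ * X - C W.t₃

/-- The polynomial `4u + 12a u² + (12a² - t₂)u³ + b²u⁴`, which is `u⁴ f₀(a + 1/u)`. -/
def f₁ : A[X] := 4 * X + C (12 * W.a) * X ^ 2 + C (12 * W.a ^ 2 - W.t₂) * X ^ 3 + C (W.b ^ 2) * X ^ 4

/-- The affine curve `U₀ = X ∖ O`, with coordinates `x`, `y` and equation `y² = 4x³ - t₂x - t₃`. -/
abbrev B₀ : Type _ := DoubleCover W.f₀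

/-- The affine curve `U₁ = (X ∖ {x = a}) ∪ O`, with coordinates `u = 1/(x - a)`, `v = y/(x - a)²`
and equation `v² = 4u + 12a u² + (12a² - t₂)u³ + b²u⁴`. The point `O` at infinity is
`u = v = 0`. -/
abbrev B₁ : Type _ := DoubleCover W.f₁

/-- The intersection `U₀₁ = U₀ ∖ {x = a}`. -/
abbrev B₀₁ : Type _ := Localization.Away (DoubleCover.x W.f₀ - algebraMap A W.B₀ W.a)

theorem derivative_f₀ : derivative W.f₀ = 12 * X ^ 2 - C W.t₂ := by
  simp only [f₀, derivative_sub, derivative_mul, derivative_ofNat, derivative_X_pow,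
    derivative_C, derivative_X, Nat.add_one_sub_one, Nat.cast_ofNat, map_ofNat]
  ring

theorem derivative_f₁ : derivative W.f₁ = 4 + 24 * C W.a * X +
    3 * (12 * C W.a ^ 2 - C W.t₂) * X ^ 2 + 4 * C W.b ^ 2 * X ^ 3 := by
  simp only [f₁, derivative_add, derivative_mul, derivative_ofNat, derivative_X_pow,
    derivative_C, derivative_X, Nat.add_one_sub_one, Nat.cast_ofNat, map_ofNat]
  simp only [map_mul, map_sub, map_pow, map_ofNat]
  ring

theorem aeval_f₀ {B : Type*} [CommRing B] [Algebra A B] (g : B) : aeval g W.f₀ =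
    4 * g ^ 3 - algebraMap A B W.t₂ * g - algebraMap A B W.t₃ := by
  simp only [f₀, map_sub, map_mul, map_pow, map_ofNat, aeval_X, aeval_C]

theorem aeval_f₁ {B : Type*} [CommRing B] [Algebra A B] (g : B) : aeval g W.f₁ =
    4 * g + 12 * algebraMap A B W.a * g ^ 2 +
      (12 * algebraMap A B W.a ^ 2 - algebraMap A B W.t₂) * g ^ 3 +
      algebraMap A B W.b ^ 2 * g ^ 4 := by
  simp only [f₁, map_add, map_mul, map_pow, map_ofNat, aeval_X, aeval_C, map_sub]

theorem aeval_derivative_f₀ {B : Type*} [CommRing B] [Algebra A B] (g : B) :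
    aeval g (derivative W.f₀) = 12 * g ^ 2 - algebraMap A B W.t₂ := by
  simp only [derivative_f₀, map_sub, map_mul, map_pow, map_ofNat, aeval_X, aeval_C]

theorem aeval_derivative_f₁ {B : Type*} [CommRing B] [Algebra A B] (g : B) :
    aeval g (derivative W.f₁) = 4 + 24 * algebraMap A B W.a * g +
      3 * (12 * algebraMap A B W.a ^ 2 - algebraMap A B W.t₂) * g ^ 2 +
      4 * algebraMap A B W.b ^ 2 * g ^ 3 := by
  simp only [derivative_f₁, map_add, map_sub, map_mul, map_pow, map_ofNat, aeval_X, aeval_C]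

set_option maxHeartbeats 2000000 in
theorem bezout₁ {R : Type*} [CommRing R] (a b t u : R) : ∃ p q : R,
    p * (4 * u + 12 * a * u ^ 2 + (12 * a ^ 2 - t) * u ^ 3 + b ^ 2 * u ^ 4) +
      q * (4 + 24 * a * u + 3 * (12 * a ^ 2 - t) * u ^ 2 + 4 * b ^ 2 * u ^ 3) =
    -32 * (27 * (4 * a ^ 3 - t * a - b ^ 2) ^ 2 - t ^ 3) :=
  ⟨(2 * t ^ 2 * b ^ 2 + 2304 * a * b ^ 4 - 90 * a * t ^ 3 +
        4848 * a ^ 2 * t * b ^ 2 + 2376 * a ^ 3 * t ^ 2 - 16992 * a ^ 4 * b ^ 2 - 18144 * a ^ 5 * t + 31104 * a ^ 7) +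
      (-240 * t * b ^ 4 + 9 * t ^ 4 - 480 * a * t ^ 2 * b ^ 2
        + 1728 * a ^ 2 * b ^ 4 - 324 * a ^ 2 * t ^ 3 + 6336 * a ^ 3 * t * b ^ 2 + 3888 * a ^ 4 * t ^ 2 - 6912 * a ^ 5 * b ^ 2 -
        15552 * a ^ 6 * t) * u +
      (288 * b ^ 6 - 12 * t ^ 3 * b ^ 2 + 672 * a * t * b ^ 4
        + 288 * a ^ 2 * t ^ 2 * b ^ 2 - 1152 * a ^ 3 * b ^ 4 - 1728 * a ^ 4 * t * b ^ 2) * u ^ 2,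
    (-216 * b ^ 4 + 8 * t ^ 3 - 432 * a * t * b ^ 2 - 216 * a ^ 2 * t ^ 2 + 1728 * a ^ 3 * b ^ 2 + 1728 * a ^ 4 * t -
        3456 * a ^ 6) +
      (-2 * t ^ 2 * b ^ 2 - 1008 * a * b ^ 4 + 42 * a * t ^ 3
        - 2256 * a ^ 2 * t * b ^ 2 - 1080 * a ^ 3 * t ^ 2 + 6624 * a ^ 4 * b ^ 2 + 7776 * a ^ 5 * t - 10368 * a ^ 7) * u +
      (78 * t * b ^ 4 - 3 * t ^ 4 + 162 * a * t ^ 2 * b ^ 2 -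
        648 * a ^ 2 * b ^ 4 + 108 * a ^ 2 * t ^ 3 - 2160 * a ^ 3 * t * b ^ 2 - 1296 * a ^ 4 * t ^ 2 + 2592 * a ^ 5 * b ^ 2 + 5184 * a ^ 6 * t) * u ^ 2 +
      (-72 * b ^ 6 + 3 * t ^ 3 * b ^ 2 - 168 * a * t * b ^ 4 -
        72 * a ^ 2 * t ^ 2 * b ^ 2 + 288 * a ^ 3 * b ^ 4 + 432 * a ^ 4
        * t * b ^ 2) * u ^ 3, by ring⟩

variable [Invertible (2 : A)]

theorem separable₀ : W.f₀.Separable := by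
  obtain ⟨d, hd⟩ := W.isUnit_disc.exists_left_inv
  have hd' : C d * (27 * C W.t₃ ^ 2 - C W.t₂ ^ 3) = (1 : A[X]) := by
    rw [← C_1, ← hd, t₃]
    simp only [map_mul, map_sub, map_pow, map_ofNat]
  refine ⟨C d * (-108 * X ^ 3 + 27 * C W.t₂ * X - 27 * C W.t₃),
    C d * (36 * X ^ 4 - 15 * C W.t₂ * X ^ 2 + C W.t₂ ^ 2), ?_⟩
  rw [W.derivative_f₀, f₀]
  linear_combination hd'

theorem separable₁ : W.f₁.Separable := by
  obtain ⟨d, hd⟩ := W.isUnit_disc.exists_left_inv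
  have hd' : C d * (27 * (4 * C W.a ^ 3 - C W.t₂ * C W.a - C W.b ^ 2) ^ 2 - C W.t₂ ^ 3) =
      (1 : A[X]) := by
    rw [← C_1, ← hd]
    simp only [map_mul, map_sub, map_pow, map_ofNat]
  have h2 : (32 : A[X]) * C (⅟2 : A) ^ 5 = 1 := by
    have : (2 : A[X]) * C (⅟2 : A) = 1 := by
      rw [← map_ofNat (C : A →+* A[X]) 2, ← map_mul, mul_invOf_self, map_one]
    calc (32 : A[X]) * C (⅟2 : A) ^ 5 = (2 * C (⅟2 : A)) ^ 5 := by ring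
      _ = 1 := by rw [this, one_pow]
  obtain ⟨p, q, hb⟩ := bezout₁ (C W.a) (C W.b) (C W.t₂) (X : A[X])
  have hf : W.f₁ = 4 * X + 12 * C W.a * X ^ 2 + (12 * C W.a ^ 2 - C W.t₂) * X ^ 3 +
      C W.b ^ 2 * X ^ 4 := by
    simp only [f₁, map_mul, map_sub, map_pow, map_ofNat]
  rw [← W.derivative_f₁, ← hf] at hb
  refine ⟨-(C (⅟2 : A) ^ 5 * C d) * p, -(C (⅟2 : A) ^ 5 * C d) * q, ?_⟩
  linear_combination (-(C (⅟2 : A) ^ 5 * C d)) * hb + h2 + (32 * C (⅟2 : A) ^ 5) * hd'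

/-- `1/(x - a)` on `U₀₁`. -/
def inv : W.B₀₁ := IsLocalization.Away.invSelf (DoubleCover.x W.f₀ - algebraMap A W.B₀ W.a)

/-- The function `x` on `U₀₁`. -/
def x₀₁ : W.B₀₁ := algebraMap W.B₀ W.B₀₁ (DoubleCover.x W.f₀)

/-- The function `y` on `U₀₁`. -/
def y₀₁ : W.B₀₁ := algebraMap W.B₀ W.B₀₁ (DoubleCover.y W.f₀)

theorem mul_inv : (W.x₀₁ - algebraMap A W.B₀₁ W.a) * W.inv = 1 := by
  have := IsLocalization.Away.mul_invSelf (S := W.B₀₁)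
    (DoubleCover.x W.f₀ - algebraMap A W.B₀ W.a)
  rwa [map_sub, ← IsScalarTower.algebraMap_apply A W.B₀ W.B₀₁] at this

theorem y₀₁_sq : W.y₀₁ ^ 2 = 4 * W.x₀₁ ^ 3 - algebraMap A _ W.t₂ * W.x₀₁ - algebraMap A _ W.t₃ := by
  have := congrArg (algebraMap W.B₀ W.B₀₁) (DoubleCover.y_sq W.f₀)
  rw [map_pow, ← aeval_algebraMap_apply, aeval_f₀] at this
  exact this

theorem chart_eq : (W.y₀₁ * W.inv ^ 2) ^ 2 = aeval W.inv W.f₁ := by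
  have h := W.mul_inv
  have h2 := W.y₀₁_sq
  simp only [t₃, map_sub, map_mul, map_pow, map_ofNat] at h2
  rw [aeval_f₁]
  generalize algebraMap A W.B₀₁ W.a = a at *
  generalize algebraMap A W.B₀₁ W.b = b at *
  generalize algebraMap A W.B₀₁ W.t₂ = t at *
  have hx : W.x₀₁ * W.inv = 1 + a * W.inv := by linear_combination h
  calc (W.y₀₁ * W.inv ^ 2) ^ 2 = W.inv ^ 4 * W.y₀₁ ^ 2 := by ring
    _ = 4 * W.inv * (W.x₀₁ * W.inv) ^ 3 - t * W.inv ^ 3 * (W.x₀₁ * W.inv) -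
        (4 * a ^ 3 - t * a - b ^ 2) * W.inv ^ 4 := by rw [h2]; ring
    _ = _ := by rw [hx]; ring

/-- The pair `(X, Y)`, `Y = {O, P}` with `P = (a, b)`, with its affine cover `{U₀, U₁}`. -/
def cover : PairCover A W.B₀ W.B₁ W.B₀₁ where
  res₀ := IsScalarTower.toAlgHom A W.B₀ W.B₀₁
  res₁ := DoubleCover.algHom W.f₁ W.inv (W.y₀₁ * W.inv ^ 2) W.chart_eq
  P := DoubleCover.algHom W.f₀ W.a W.b (by
    rw [aeval_f₀, t₃, Algebra.algebraMap_self_apply, Algebra.algebraMap_self_apply]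
    ring)
  O := DoubleCover.algHom W.f₁ 0 0 (by
    rw [aeval_f₁]
    ring)

/-- The first relative de Rham cohomology `H¹_dR((X, Y)/A)`. -/
abbrev H1 : Type _ := W.cover.H1

/-- `dx/y` on `U₀`. -/
def w₀ : Ω[W.B₀⁄A] := DoubleCover.invDiff W.separable₀

/-- `dx/y` on `U₁`, where it is `-du/v`. -/
def w₁ : Ω[W.B₁⁄A] := -DoubleCover.invDiff W.separable₁

theorem span₀ : ∃ w : Ω[W.B₀⁄A], ∀ m : Ω[W.B₀⁄A], ∃ g : W.B₀, m = g • w :=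
  ⟨_, DoubleCover.invDiff_span W.separable₀⟩

theorem span₁ : ∃ w : Ω[W.B₁⁄A], ∀ m : Ω[W.B₁⁄A], ∃ g : W.B₁, m = g • w :=
  ⟨_, DoubleCover.invDiff_span W.separable₁⟩

theorem span₀₁ : ∃ w : Ω[W.B₀₁⁄A], ∀ m : Ω[W.B₀₁⁄A], ∃ g : W.B₀₁, m = g • w :=
  ⟨_, span_localize _ _ (DoubleCover.invDiff_span W.separable₀)⟩

theorem res₀_apply (g : W.B₀) : W.cover.res₀ g = algebraMap W.B₀ W.B₀₁ g := rfl

theorem res₁_u : W.cover.res₁ (DoubleCover.x W.f₁) = W.inv := DoubleCover.algHom_x _ _ _ _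

theorem res₁_v : W.cover.res₁ (DoubleCover.y W.f₁) = W.y₀₁ * W.inv ^ 2 :=
  DoubleCover.algHom_y _ _ _ _

theorem D_inv : KaehlerDifferential.D A W.B₀₁ W.inv =
    (-W.inv ^ 2) • KaehlerDifferential.D A W.B₀₁ W.x₀₁ := by
  have h := Derivation.leibniz_of_mul_eq_one (KaehlerDifferential.D A W.B₀₁)
    ((mul_comm _ _).trans W.mul_inv)
  rw [h, map_sub, Derivation.map_algebraMap, sub_zero]

/-- `dx` on `U₀₁`. -/
theorem D_x₀₁ : KaehlerDifferential.D A W.B₀₁ W.x₀₁ = W.y₀₁ • kaehlerMap W.cover.res₀ W.w₀ := by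
  have := congrArg (kaehlerMap W.cover.res₀) (DoubleCover.y_smul_invDiff W.separable₀)
  rw [kaehlerMap_smul, kaehlerMap_D] at this
  exact this.symm

theorem D_inv' : KaehlerDifferential.D A W.B₀₁ W.inv =
    (-W.inv ^ 2) • W.y₀₁ • kaehlerMap W.cover.res₀ W.w₀ := by
  rw [D_inv, D_x₀₁]

/-- `2 dy` on `U₀₁`. -/
theorem D_y₀₁ : (2 : W.B₀₁) • KaehlerDifferential.D A W.B₀₁ W.y₀₁ =
    (12 * W.x₀₁ ^ 2 - algebraMap A _ W.t₂) • kaehlerMap W.cover.res₀ W.w₀ := by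
  have := congrArg (kaehlerMap W.cover.res₀) (DoubleCover.deriv_smul_invDiff W.separable₀)
  rw [kaehlerMap_smul, kaehlerMap_smul, kaehlerMap_D, ← aeval_algHom_apply, map_ofNat,
    aeval_derivative_f₀] at this
  exact this.symm

theorem glue_key {B : Type*} [CommRing B] {a b t x y i Q : B} (hx : (x - a) * i = 1)
    (hy : y ^ 2 = 4 * x ^ 3 - t * x - (4 * a ^ 3 - t * a - b ^ 2))
    (hQ : Q = 4 + 24 * a * i + 3 * (12 * a ^ 2 - t) * i ^ 2 + 4 * b ^ 2 * i ^ 3) :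
    i ^ 2 * (12 * x ^ 2 - t) - 4 * y ^ 2 * i ^ 3 = -Q := by
  have hx' : x * i = 1 + a * i := by linear_combination hx
  calc i ^ 2 * (12 * x ^ 2 - t) - 4 * y ^ 2 * i ^ 3 =
      12 * (x * i) ^ 2 - t * i ^ 2 - 4 * (4 * (x * i) ^ 3 -
        t * (x * i) * i ^ 2 - (4 * a ^ 3 - t * a - b ^ 2) * i ^ 3) := by
        rw [hy]; ring
    _ = _ := by rw [hx', hQ]; ring

theorem glue_aux {B M : Type*} [CommRing B] [AddCommGroup M] [Module B M]
    {a b t x y i p q Q : B} {n m e : M} (hx : (x - a) * i = 1)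
    (hy : y ^ 2 = 4 * x ^ 3 - t * x - (4 * a ^ 3 - t * a - b ^ 2))
    (hQ : Q = 4 + 24 * a * i + 3 * (12 * a ^ 2 - t) * i ^ 2 + 4 * b ^ 2 * i ^ 3)
    (hB : p * (y * i ^ 2) ^ 2 + q * Q = 1) (e1 : (y * i ^ 2) • n = (-i ^ 2) • y • m)
    (e2 : Q • n = (2 : B) • (y • (2 * i) • (-i ^ 2) • y • m + i ^ 2 • e))
    (e3 : (2 : B) • e = (12 * x ^ 2 - t) • m) : n + m = 0 := by
  have key := glue_key hx hy hQ
  have e4 : Q • n = -(Q • m) := by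
    calc Q • n = (-4 * y ^ 2 * i ^ 3) • m + i ^ 2 • ((2 : B) • e) := by rw [e2]; module
      _ = (i ^ 2 * (12 * x ^ 2 - t) - 4 * y ^ 2 * i ^ 3) • m := by rw [e3]; module
      _ = _ := by rw [key, neg_smul]
  calc n + m = (p * (y * i ^ 2) ^ 2 + q * Q) • (n + m) := by rw [hB, one_smul]
    _ = (p * (y * i ^ 2)) • ((y * i ^ 2) • n + (y * i ^ 2) • m) + q • (Q • n + Q • m) := by module
    _ = 0 := by rw [e1, e4]; module

theorem D_chart {A C : Type*} [CommRing A] [CommRing C] [Algebra A C] {y i : C} {m : Ω[C⁄A]}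
    (hi : KaehlerDifferential.D A C i = (-i ^ 2) • y • m) :
    KaehlerDifferential.D A C (y * i ^ 2) =
      y • (2 * i) • (-i ^ 2) • y • m + i ^ 2 • KaehlerDifferential.D A C y := by
  rw [Derivation.leibniz, Derivation.leibniz_pow, hi, Nat.add_one_sub_one, pow_one]
  module

theorem D_shift {A C : Type*} [CommRing A] [CommRing C] [Algebra A C] {y i e : C} {h : A}
    {m : Ω[C⁄A]} (hi : KaehlerDifferential.D A C i = (-i ^ 2) • y • m)
    (hy : KaehlerDifferential.D A C y = e • m) :
    KaehlerDifferential.D A C (-(algebraMap A C h * y * i)) =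
      (-(algebraMap A C h * (i * e - y ^ 2 * i ^ 2))) • m := by
  rw [map_neg, mul_assoc, Derivation.leibniz, Derivation.map_algebraMap, smul_zero, add_zero,
    Derivation.leibniz, hi, hy]
  module

theorem glue_aux' {B : Type*} [CommRing B] {a b t x y i h : B} (h2 : h * 2 = 1)
    (hx : x * i = 1 + a * i)
    (hy : y ^ 2 = 4 * x ^ 3 - t * x - (4 * a ^ 3 - t * a - b ^ 2)) :
    a + h * h * (12 * a ^ 2 - t) * i + h * b ^ 2 * i ^ 2 - x +
      h * (i * (h * (12 * x ^ 2 - t)) - y ^ 2 * i ^ 2) = 0 := by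
  have h4 : h * h * 4 = 1 := by linear_combination (h * 2 + 1) * h2
  have e : y ^ 2 * i ^ 2 = 4 * x * (1 + a * i) ^ 2 - t * (1 + a * i) * i -
      (4 * a ^ 3 - t * a - b ^ 2) * i ^ 2 := by
    rw [hy, ← hx]; ring
  have e' : i * x ^ 2 = (1 + a * i) * x := by rw [← hx]; ring
  rw [e]
  linear_combination (3 * a ^ 2 * i + 3 * (1 + a * i) * x) * h4 + 12 * h * h * e' +
    (-2 * x * (1 + a * i) ^ 2 - h * t * i + 2 * a ^ 3 * i ^ 2) * h2 + (-a - 2 * a ^ 2 * i) * hx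

/-- The two descriptions of `dx/y` agree on `U₀₁`. -/
theorem res_w : kaehlerMap W.cover.res₁ W.w₁ = kaehlerMap W.cover.res₀ W.w₀ := by
  obtain ⟨p, q, hpq⟩ := W.separable₁
  have hB : aeval W.inv p * (W.y₀₁ * W.inv ^ 2) ^ 2 +
      aeval W.inv q * aeval W.inv (derivative W.f₁) = 1 := by
    rw [W.chart_eq, ← map_mul, ← map_mul, ← map_add, hpq, map_one]
  have e1 := congrArg (kaehlerMap W.cover.res₁) (DoubleCover.y_smul_invDiff W.separable₁)
  rw [kaehlerMap_smul, kaehlerMap_D, res₁_u, res₁_v, W.D_inv'] at e1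
  have e2 := congrArg (kaehlerMap W.cover.res₁) (DoubleCover.deriv_smul_invDiff W.separable₁)
  rw [kaehlerMap_smul, kaehlerMap_smul, kaehlerMap_D, ← aeval_algHom_apply, map_ofNat, res₁_u,
    res₁_v, D_chart W.D_inv'] at e2
  have hy := W.y₀₁_sq
  simp only [t₃, map_sub, map_mul, map_pow, map_ofNat] at hy
  rw [w₁, map_neg]
  exact neg_eq_of_add_eq_zero_right
    (glue_aux W.mul_inv hy (W.aeval_derivative_f₁ W.inv) hB e1 e2 W.D_y₀₁)

/-! ### The frame -/

/-- The cocycle of the class of `df`, where `f(O) = 1` and `f(P) = 0`: it is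
`((0, 0), (df, 0), f)` for the function `f = 1` on `U₁` (note that `P` is not in `U₁`). -/
def z₁ : W.cover.Cochain := ((0, 0), (0, 0), 1)

theorem d₁_z₁ : W.cover.d₁ W.z₁ = 0 := by
  change kaehlerMap W.cover.res₁ 0 - kaehlerMap W.cover.res₀ 0 - KaehlerDifferential.D A _ 1 = 0
  simp

/-- The cocycle of the class of `dx/y`. -/
def z₂ : W.cover.Cochain := ((W.w₀, 0), (W.w₁, 0), 0)

theorem d₁_z₂ : W.cover.d₁ W.z₂ = 0 := by
  change kaehlerMap W.cover.res₁ W.w₁ - kaehlerMap W.cover.res₀ W.w₀ -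
    KaehlerDifferential.D A _ 0 = 0
  rw [res_w, map_zero, sub_self, sub_zero]

/-- The form `x dx/y + dg` on `U₁`, where `g = -y/(2(x - a)) = -v/(2u)`. On `U₁` it equals
`(a + (12a² - t₂)u/4 + b²u²/2) dx/y`. -/
def η₁ : Ω[W.B₁⁄A] :=
  (algebraMap A W.B₁ W.a +
    algebraMap A W.B₁ (⅟2 * ⅟2 * (12 * W.a ^ 2 - W.t₂)) * DoubleCover.x W.f₁ +
    algebraMap A W.B₁ (⅟2 * W.b ^ 2) * DoubleCover.x W.f₁ ^ 2) • W.w₁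

/-- The function `g = -y/(2(x - a))` on `U₀₁`. -/
def g₀₁ : W.B₀₁ := -(algebraMap A W.B₀₁ (⅟2) * W.y₀₁ * W.inv)

/-- The cocycle `((x dx/y, 0), (x dx/y + dg, 0), g)`, where `g = -y/(2(x - a))`. -/
def z₃ : W.cover.Cochain := ((DoubleCover.x W.f₀ • W.w₀, 0), (W.η₁, 0), W.g₀₁)

theorem d₁_z₃ : W.cover.d₁ W.z₃ = 0 := by
  change kaehlerMap W.cover.res₁ W.η₁ - kaehlerMap W.cover.res₀ (DoubleCover.x W.f₀ • W.w₀) -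
    KaehlerDifferential.D A _ W.g₀₁ = 0
  have h2 : algebraMap A W.B₀₁ (⅟2) * 2 = 1 := by
    rw [← map_ofNat (algebraMap A W.B₀₁) 2, ← map_mul, invOf_mul_self, map_one]
  have hy := W.y₀₁_sq
  simp only [t₃, map_sub, map_mul, map_pow, map_ofNat] at hy
  have hx : W.x₀₁ * W.inv = 1 + algebraMap A W.B₀₁ W.a * W.inv := by linear_combination W.mul_inv
  have hDy : KaehlerDifferential.D A _ W.y₀₁ = (algebraMap A W.B₀₁ (⅟2) *
      (12 * W.x₀₁ ^ 2 - algebraMap A _ W.t₂)) • kaehlerMap W.cover.res₀ W.w₀ := by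
    rw [mul_smul, ← W.D_y₀₁, smul_smul, h2, one_smul]
  have hD : KaehlerDifferential.D A _ W.g₀₁ = _ := D_shift (h := ⅟2) W.D_inv' hDy
  rw [hD, η₁, kaehlerMap_smul, kaehlerMap_smul, res_w, ← sub_smul, ← sub_smul]
  have key := glue_aux' h2 hx hy
  have h0 : W.cover.res₀ (DoubleCover.x W.f₀) = W.x₀₁ := rfl
  have h1 : W.cover.res₁ (algebraMap A W.B₁ W.a +
      algebraMap A W.B₁ (⅟2 * ⅟2 * (12 * W.a ^ 2 - W.t₂)) * DoubleCover.x W.f₁ +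
      algebraMap A W.B₁ (⅟2 * W.b ^ 2) * DoubleCover.x W.f₁ ^ 2) =
      algebraMap A W.B₀₁ W.a + algebraMap A W.B₀₁ (⅟2) * algebraMap A W.B₀₁ (⅟2) *
        (12 * algebraMap A W.B₀₁ W.a ^ 2 - algebraMap A W.B₀₁ W.t₂) * W.inv +
        algebraMap A W.B₀₁ (⅟2) * algebraMap A W.B₀₁ W.b ^ 2 * W.inv ^ 2 := by
    simp only [map_add, map_mul, map_pow, AlgHom.commutes, res₁_u, map_sub, map_ofNat]
  rw [h0, h1, sub_neg_eq_add, key, zero_smul]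

/-- The class `α₁` of `df`, where `f(O) = 1` and `f(P) = 0`. -/
def α₁ : W.H1 := W.cover.cls W.z₁ W.d₁_z₁

/-- The class `α₂` of `dx/y`. -/
def α₂ : W.H1 := W.cover.cls W.z₂ W.d₁_z₂

/-- The class `ω₃` of `((x dx/y, 0), (x dx/y + dg, 0), g)`. -/
def ω₃ : W.H1 := W.cover.cls W.z₃ W.d₁_z₃

/-! ### The Gauss–Manin connection -/

/-- The vertical vector field dual to `-dx/y` on `U₀₁`. -/
theorem exists_vertical : ∃ V : Derivation A W.B₀₁ W.B₀₁,
    V W.inv = W.y₀₁ * W.inv ^ 2 ∧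
      2 * V (W.y₀₁ * W.inv ^ 2) = aeval W.inv (derivative W.f₁) := by
  have h2 : (2 : W.B₀) * algebraMap A W.B₀ (⅟2) = 1 := by
    rw [← map_ofNat (algebraMap A W.B₀) 2, ← map_mul, mul_invOf_self, map_one]
  obtain ⟨E, hE, hx, hy⟩ := DoubleCover.exists_der W.f₀ (0 : Derivation A A A)
    (-DoubleCover.y W.f₀)
    (-(algebraMap A W.B₀ (⅟2) * aeval (DoubleCover.x W.f₀) (derivative W.f₀))) (by
      rw [coeffDer_zero, map_zero]
      linear_combination
        (-DoubleCover.y W.f₀ * aeval (DoubleCover.x W.f₀) (derivative W.f₀)) * h2)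
  obtain ⟨V, -, hV⟩ := exists_localize (0 : Derivation A A A) E hE
    (DoubleCover.x W.f₀ - algebraMap A W.B₀ W.a)
  have hVx : V W.x₀₁ = -W.y₀₁ := by
    rw [x₀₁, hV, hx, map_neg]; rfl
  have hVy : 2 * V W.y₀₁ = -(12 * W.x₀₁ ^ 2 - algebraMap A W.B₀₁ W.t₂) := by
    have h2' := congrArg (algebraMap W.B₀ W.B₀₁) h2
    rw [map_mul, map_ofNat, map_one] at h2'
    rw [y₀₁, hV, hy, map_neg, map_mul, ← aeval_algebraMap_apply, aeval_derivative_f₀]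
    change 2 * -(_ * (12 * W.x₀₁ ^ 2 - algebraMap A W.B₀₁ W.t₂)) = _
    linear_combination (-(12 * W.x₀₁ ^ 2 - algebraMap A W.B₀₁ W.t₂)) * h2'
  have hVi : V W.inv = W.y₀₁ * W.inv ^ 2 := by
    rw [Derivation.leibniz_of_mul_eq_one V ((mul_comm _ _).trans W.mul_inv), map_sub,
      V.map_algebraMap, hVx, smul_eq_mul]
    ring
  refine ⟨V, hVi, ?_⟩
  have hy' := W.y₀₁_sq
  simp only [t₃, map_sub, map_mul, map_pow, map_ofNat] at hy'
  have key := glue_key W.mul_inv hy' (W.aeval_derivative_f₁ W.inv)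
  rw [Derivation.leibniz, Derivation.leibniz_pow, hVi]
  simp only [Nat.add_one_sub_one, pow_one, smul_eq_mul, nsmul_eq_mul, Nat.cast_ofNat]
  linear_combination W.inv ^ 2 * hVy - key

section GaussManin

variable {k : Type*} [CommRing k] [Algebra k A]

/-- Local liftings of vector fields on the base exist. -/
theorem nonempty_lift (D : Derivation k A A) : Nonempty (W.cover.Lift D) := by
  obtain ⟨e₀, ext₀, hP⟩ := DoubleCover.exists_lift W.separable₀ W.a W.b (by
    rw [aeval_f₀, t₃, Algebra.algebraMap_self_apply, Algebra.algebraMap_self_apply]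
    ring) D
  obtain ⟨e₁, ext₁, hO⟩ := DoubleCover.exists_lift W.separable₁ 0 0 (by
    rw [aeval_f₁]
    ring) D
  obtain ⟨r₀, ext_r₀, hr₀⟩ := exists_localize D e₀ ext₀
    (DoubleCover.x W.f₀ - algebraMap A W.B₀ W.a)
  obtain ⟨V, hV, hV'⟩ := W.exists_vertical
  obtain ⟨r₁, hr₁⟩ := DoubleCover.exists_overlap W.separable₁ W.cover.res₁ D e₁ ext₁ r₀ ext_r₀ V
    (by rw [res₁_u, res₁_v]; exact hV) (by rw [res₁_u, res₁_v]; exact hV')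
  exact ⟨⟨e₀, e₁, r₀, r₁, ext₀, ext₁, hr₀, hr₁, hP, hO⟩⟩

/-- The Gauss–Manin connection `∇_D` on `H¹_dR((X, Y)/A)` along a vector field `D` on the base:
lift `D` locally to `(X, Y)` and act on cocycles by Lie derivatives. It does not depend on the
choice of the local lifting, see `gaussManin_eq`. -/
def gaussManin (D : Derivation k A A) : W.H1 →+ W.H1 :=
  (W.nonempty_lift D).some.onH1 W.span₀₁

theorem gaussManin_eq (D : Derivation k A A) (l : W.cover.Lift D) :
    W.gaussManin D = l.onH1 W.span₀₁ :=
  PairCover.Lift.onH1_eq _ _ W.span₀ W.span₁ W.span₀₁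

end GaussManin

end EllipticPair


/-! ### The universal family -/

section Universal

variable (k : Type*) [Field k]

/-- The polynomial `27 t₃² - t₂³` with `t₃ = 4a³ - t₂ a - b²`, in the variables
`a, b, c, t₁, t₂ = X 0, X 1, X 2, X 3, X 4`. -/
def discPoly : MvPolynomial (Fin 5) k :=
  27 * (4 * MvPolynomial.X 0 ^ 3 - MvPolynomial.X 4 * MvPolynomial.X 0 -
    MvPolynomial.X 1 ^ 2) ^ 2 - MvPolynomial.X 4 ^ 3

/-- The coordinate ring `k[a, b, c, t₁, t₂, 1/(27 t₃² - t₂³)]` of `T`. -/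
abbrev TRing : Type _ := Localization.Away (discPoly k)

namespace TRing

/-- The coordinate function `a` on `T`. -/
def a : TRing k := algebraMap (MvPolynomial (Fin 5) k) _ (MvPolynomial.X 0)

/-- The coordinate function `b` on `T`. -/
def b : TRing k := algebraMap (MvPolynomial (Fin 5) k) _ (MvPolynomial.X 1)

/-- The coordinate function `c` on `T`. -/
def c : TRing k := algebraMap (MvPolynomial (Fin 5) k) _ (MvPolynomial.X 2)

/-- The coordinate function `t₁` on `T`. -/
def t₁ : TRing k := algebraMap (MvPolynomial (Fin 5) k) _ (MvPolynomial.X 3)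

/-- The coordinate function `t₂` on `T`. -/
def t₂ : TRing k := algebraMap (MvPolynomial (Fin 5) k) _ (MvPolynomial.X 4)

/-- The function `t₃ = 4a³ - t₂ a - b²` on `T`. -/
def t₃ : TRing k := 4 * a k ^ 3 - t₂ k * a k - b k ^ 2

end TRing

variable [CharZero k]

instance : Invertible (2 : TRing k) where
  invOf := algebraMap k (TRing k) 2⁻¹
  invOf_mul_self := by
    rw [← map_ofNat (algebraMap k (TRing k)) 2, ← map_mul, inv_mul_cancel₀ two_ne_zero, map_one]
  mul_invOf_self := by
    rw [← map_ofNat (algebraMap k (TRing k)) 2, ← map_mul, mul_inv_cancel₀ two_ne_zero, map_one]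

/-- The universal family over `T`: the curve `y² = 4x³ - t₂ x - t₃` with the points `O` at
infinity and `P = (a, b)`. -/
def univ : EllipticPair (TRing k) where
  t₂ := TRing.t₂ k
  a := TRing.a k
  b := TRing.b k
  isUnit_disc := by
    have h := IsLocalization.Away.algebraMap_isUnit (S := TRing k) (discPoly k)
    have e : algebraMap (MvPolynomial (Fin 5) k) (TRing k) (discPoly k) =
        27 * (4 * TRing.a k ^ 3 - TRing.t₂ k * TRing.a k - TRing.b k ^ 2) ^ 2 -
          TRing.t₂ k ^ 3 := by
      simp only [discPoly, TRing.a, TRing.b, TRing.t₂, map_sub, map_mul, map_pow, map_ofNat]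
    rwa [e] at h

/-- The frame `(α₁, α₂, α₃)` of `H¹_dR((X, Y)/T)`, with `α₃ = c α₁ + t₁ α₂ + ω₃`. Where `a` is
invertible, `α₁` is the class of `d((x - a)/x)`, and `ω₃` is the class of
`x dx/y - d(y/(2x)) - (b/(2a)) d((x - a)/x)`: over `ℂ` this form and `ω₃` have the same
periods, namely `-ζ(z)` on a path from `O` to `P`, where `P = (℘(z), ℘'(z))`; the form
`d((x - a)/x)` has the period `-1` there. The cocycles used here have no denominator `a`. -/
def frame : Fin 3 → (univ k).H1 :=
  ![(univ k).α₁, (univ k).α₂,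
    TRing.c k • (univ k).α₁ + TRing.t₁ k • (univ k).α₂ + (univ k).ω₃]

/-- The Gauss–Manin connection along the vector field `R` on `T` has the matrix `M` in the frame
`α`, that is, `∇_R α = M α` for the column vector `α = (α₁, α₂, α₃)`. -/
def HasMatrix (R : Derivation k (TRing k) (TRing k)) (M : Matrix (Fin 3) (Fin 3) (TRing k)) :
    Prop :=
  ∀ i, (univ k).gaussManin R (frame k i) = ∑ j, M i j • frame k j

end Universal

end RelDR

end

/-!
A vector field `D` on the base acts on `H¹_dR((X, Y))` through local lifts to the two charts `U₀`
(the curve without `O`) and `U₁` (a neighbourhood of `O` with the coordinates `u = 1/(x - a)`,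
`v = y/(x - a)²`), and the result does not depend on the lifts. So it suffices to find good lifts.

There are three basic deformations of the pair `(X, {O, P})` which lift to polynomial vector fields
on both charts: `P` moves along the invariant vector field of the curve; the coordinates are
rescaled; and `t₂, t₃` move in the direction `6 t₃ ∂/∂t₂ + (t₂²/3) ∂/∂t₃`, with the lift
`(2x² - t₂/3) ∂/∂x + 3xy ∂/∂y` to `U₀`. A vector field with coefficients `p, q, r` with respect to
these (`HasCoords`) has a lift (`HasCoords.exists_isAdapted`) for which the cocycles of the frame
transform by explicit combinations, up to the coboundary of `(primitive₀, primitive₁)`. This gives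

* `∇ α₁ = 0`,
* `∇ α₂ = -p α₁ - q α₂ + r ω₃`,
* `∇ ω₃ = -(p a + r b/2) α₁ - (r t₂/12) α₂ + q ω₃`

(`gaussManin_α₁`, `HasCoords.gaussManin_α₂`, `HasCoords.gaussManin_ω₃`). Every `D` has such
coefficients, because the discriminant is invertible and the curve is smooth at `P`
(`EllipticPair.exists_hasCoords`).

The classes `α₁, α₂, ω₃` are linearly independent (`EllipticPair.eq_zero_of_comb`), as one sees by
expanding functions on the overlap in `u` and `v`. Hence, for `α₃ = c α₁ + t₁ α₂ + ω₃`, the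
equations `∇ α₂ = m α₁ + n α₃` and `∇ α₃ = 0` say precisely that `p = -(m + n c)`, `q = -n t₁`,
`r = n`, `D c = t₁ p + p a + r b/2` and `D t₁ = t₁ q + r t₂/12`, which fixes `D` on the five
coordinates of the moduli space (`hasMatrix_iff_derivation`). The two vector fields are the cases
`(m, n) = (0, -1)` and `(m, n) = (-1, 0)`.
-/

noncomputable section

namespace RelDR

open Polynomial
open scoped KaehlerDifferential

/-! ### Vector fields and differentials on a double cover -/

section Derivations

variable {k A C : Type*} [CommRing k] [CommRing A] [CommRing C]
  [Algebra k A] [Algebra A C]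

theorem coeffDer_X (D : Derivation k A A) : coeffDer D X = 0 := by
  rw [← monomial_one_one_eq_X, coeffDer_monomial, Derivation.map_one_eq_zero, map_zero]

theorem coeffDer_C (D : Derivation k A A) (r : A) :
    coeffDer D (Polynomial.C r) = Polynomial.C (D r) := by
  rw [← monomial_zero_left, coeffDer_monomial, monomial_zero_left]

theorem derivation_ofNat (D : Derivation k A A) (n : ℕ) [n.AtLeastTwo] :
    D (ofNat(n) : A) = 0 := by
  exact_mod_cast D.map_natCast n

theorem derivation_invOf_two [Invertible (2 : A)] (D : Derivation k A A) : D (⅟2 : A) = 0 := by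
  rw [Derivation.leibniz_invOf, derivation_ofNat, smul_zero]

namespace DoubleCover

variable {f : A[X]}

/-- The vertical vector field `y ∂/∂x + f'(x)/2 ∂/∂y`, dual to `dx/y`. -/
theorem exists_dual [Invertible (2 : A)] (hf : f.Separable) :
    ∃ V : Derivation A (DoubleCover f) (DoubleCover f), V (x f) = y f ∧
      V (y f) = algebraMap A _ (⅟2) * aeval (x f) (derivative f) ∧
      ∀ g, KaehlerDifferential.D A _ g = V g • invDiff hf := by
  have h2 : (2 : DoubleCover f) * algebraMap A _ (⅟2) = 1 := by
    rw [← map_ofNat (algebraMap A (DoubleCover f)) 2, ← map_mul, mul_invOf_self, map_one]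
  obtain ⟨V, -, hx, hy⟩ := exists_der f (0 : Derivation A A A) (y f)
    (algebraMap A _ (⅟2) * aeval (x f) (derivative f)) (by
      rw [coeffDer_zero, map_zero]
      linear_combination (y f * aeval (x f) (derivative f)) * h2)
  refine ⟨V, hx, hy, fun g => ?_⟩
  induction g using DoubleCover.induction with
  | hx => rw [hx, y_smul_invDiff]
  | hy => rw [hy, D_y]
  | hr r => rw [Derivation.map_algebraMap, Derivation.map_algebraMap, zero_smul]
  | hadd g h hg hh => rw [map_add, map_add, hg, hh, add_smul]
  | hmul g h hg hh =>
    rw [Derivation.leibniz, Derivation.leibniz, hg, hh, smul_eq_mul, smul_eq_mul]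
    module

/-- The functions `y` and `f'(x)` generate the unit ideal, so they do not both annihilate a nonzero
element of a module. -/
theorem eq_zero_of_smul {M : Type*} [AddCommGroup M] [Module C M] (hf : f.Separable)
    (ρ : DoubleCover f →ₐ[A] C) {m : M} (h1 : ρ (y f) • m = 0)
    (h2 : aeval (ρ (x f)) (derivative f) • m = 0) : m = 0 := by
  obtain ⟨p, q, hpq⟩ := exists_bezout hf
  have hB : aeval (ρ (x f)) p * ρ (y f) ^ 2 +
      aeval (ρ (x f)) q * aeval (ρ (x f)) (derivative f) = 1 := by
    rw [← map_pow, y_sq, ← aeval_algHom_apply, ← map_mul, ← map_mul, ← map_add, hpq, map_one]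
  calc m = (aeval (ρ (x f)) p * ρ (y f) ^ 2 +
        aeval (ρ (x f)) q * aeval (ρ (x f)) (derivative f)) • m := by rw [hB, one_smul]
    _ = (aeval (ρ (x f)) p * ρ (y f)) • (ρ (y f) • m) +
        aeval (ρ (x f)) q • (aeval (ρ (x f)) (derivative f) • m) := by module
    _ = 0 := by rw [h1, h2, smul_zero, smul_zero, add_zero]

/-- The contraction of `dx/y` with a vertical vector field `c (y ∂/∂x + f'(x)/2 ∂/∂y)`. -/
theorem contract_invDiff (hf : f.Separable) (ρ : DoubleCover f →ₐ[A] C) (V : Derivation A C C)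
    (c : C) (hx : V (ρ (x f)) = c * ρ (y f))
    (hy : 2 * V (ρ (y f)) = c * aeval (ρ (x f)) (derivative f)) :
    V.liftKaehlerDifferential (kaehlerMap ρ (invDiff hf)) = c := by
  have e1 := congrArg (fun m => V.liftKaehlerDifferential (kaehlerMap ρ m)) (y_smul_invDiff hf)
  have e2 := congrArg (fun m => V.liftKaehlerDifferential (kaehlerMap ρ m)) (deriv_smul_invDiff hf)
  simp only [kaehlerMap_smul, kaehlerMap_D, map_smul, Derivation.liftKaehlerDifferential_comp_D,
    smul_eq_mul, hx, map_ofNat, hy, ← aeval_algHom_apply] at e1 e2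
  refine sub_eq_zero.1 (eq_zero_of_smul hf ρ ?_ ?_)
  · rw [smul_eq_mul]; linear_combination e1
  · rw [smul_eq_mul]; linear_combination e2

/-- The Lie derivative of `dx/y` along `E` is `h dx/y`, provided that `h` satisfies the identities
obtained from `y · dx/y = dx` and `f'(x) · dx/y = 2 dy`. Here `V` is the vertical vector field dual
to `dx/y`. -/
theorem lieDeriv_invDiff [Invertible (2 : A)] (hf : f.Separable) (D : Derivation k A A)
    (E : Derivation k (DoubleCover f) (DoubleCover f)) (hE : Extends D E)
    (V : Derivation A (DoubleCover f) (DoubleCover f))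
    (hV : ∀ g, KaehlerDifferential.D A _ g = V g • invDiff hf) (h : DoubleCover f)
    (h1 : V (E (x f)) = h * y f + E (y f))
    (h2 : 2 * V (E (y f)) = h * aeval (x f) (derivative f) + E (aeval (x f) (derivative f))) :
    lieDeriv D E hE (invDiff hf) = h • invDiff hf := by
  have e1 := congrArg (lieDeriv D E hE) (y_smul_invDiff hf)
  have e2 := congrArg (lieDeriv D E hE) (deriv_smul_invDiff hf)
  rw [lieDeriv_smul, lieDeriv_D, hV, h1] at e1
  rw [lieDeriv_smul, lieDeriv_smul, lieDeriv_D, hV, smul_smul, h2, derivation_ofNat, zero_smul,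
    add_zero] at e2
  refine sub_eq_zero.1 (eq_zero_of_smul hf (AlgHom.id A _) ?_ ?_)
  · rw [AlgHom.id_apply, smul_sub, sub_eq_zero]
    exact add_right_cancel (e1.trans (by module))
  · rw [AlgHom.id_apply, smul_sub, sub_eq_zero]
    exact add_right_cancel (e2.trans (by module))

end DoubleCover

end Derivations

/-! ### The basic deformations of the pair -/

namespace EllipticPair

variable {A : Type*} [CommRing A] (W : EllipticPair A) {k : Type*} [CommRing k] [Algebra k A]

theorem coeffDer_f₀ (D : Derivation k A A) :
    coeffDer D W.f₀ = -(C (D W.t₂) * X) - C (D W.t₃) := by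
  simp only [f₀, map_sub, Derivation.leibniz, Derivation.leibniz_pow, coeffDer_X, coeffDer_C,
    derivation_ofNat, smul_zero, smul_eq_mul, mul_zero]
  ring

theorem coeffDer_f₁ (D : Derivation k A A) : coeffDer D W.f₁ =
    C (12 * D W.a) * X ^ 2 + C (24 * W.a * D W.a - D W.t₂) * X ^ 3 +
      C (2 * W.b * D W.b) * X ^ 4 := by
  simp only [f₁, map_sub, map_add, map_mul, map_pow, Derivation.leibniz, Derivation.leibniz_pow,
    coeffDer_X, coeffDer_C, derivation_ofNat, smul_zero, smul_eq_mul, mul_zero, nsmul_eq_mul,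
    map_ofNat]
  push_cast
  ring

theorem derivation_t₃ (D : Derivation k A A) :
    D W.t₃ = (12 * W.a ^ 2 - W.t₂) * D W.a - W.a * D W.t₂ - 2 * W.b * D W.b := by
  simp only [t₃, map_sub, Derivation.leibniz, Derivation.leibniz_pow, derivation_ofNat,
    smul_eq_mul, nsmul_eq_mul]
  push_cast
  ring

variable [Invertible (2 : A)]

/-- The vector field `D` on the base is the combination, with coefficients `p, q, r`, of the three
basic deformations of the pair:
* `p`: the point `P` moves along the vector field `y ∂/∂x + f₀'(x)/2 ∂/∂y` on the curve;
* `q`: the coordinates are rescaled, with the weights `2, 3, 4` of `x, y, t₂`;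
* `r`: the curve itself is deformed, along `(2x² - t₂/3) ∂/∂x + 3xy ∂/∂y`.

The element `s` is `t₂/3`; it is a parameter because `3` need not be invertible in `A`. -/
structure HasCoords (D : Derivation k A A) (s p q r : A) : Prop where
  three_mul : 3 * s = W.t₂
  map_a : D W.a = 2 * q * W.a + r * (2 * W.a ^ 2 - s) + p * W.b
  map_b : D W.b = 3 * q * W.b + 3 * r * W.a * W.b + p * (⅟2 * (12 * W.a ^ 2 - W.t₂))
  map_t₂ : D W.t₂ = 4 * q * W.t₂ + 6 * r * W.t₃

namespace HasCoords

variable {W} {D : Derivation k A A} {s p q r : A} (H : W.HasCoords D s p q r)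

include H

/-- The rule for `t₃` follows from the others, since `P` lies on the curve. -/
theorem map_t₃ : D W.t₃ = 6 * q * W.t₃ + r * W.t₂ * s := by
  rw [derivation_t₃, H.map_a, H.map_b, H.map_t₂, t₃]
  have h3 := H.three_mul
  have h2 := invOf_mul_self (2 : A)
  grind

/-- The basic deformations lift to polynomial vector fields on `U₀`. -/
theorem exists_e₀ : ∃ E : Derivation k W.B₀ W.B₀, Extends D E ∧
    E (DoubleCover.x W.f₀) = algebraMap A W.B₀ (2 * q) * DoubleCover.x W.f₀ +
      algebraMap A W.B₀ r * (2 * DoubleCover.x W.f₀ ^ 2 - algebraMap A W.B₀ s) +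
      algebraMap A W.B₀ p * DoubleCover.y W.f₀ ∧
    E (DoubleCover.y W.f₀) = algebraMap A W.B₀ (3 * q) * DoubleCover.y W.f₀ +
      algebraMap A W.B₀ (3 * r) * DoubleCover.x W.f₀ * DoubleCover.y W.f₀ +
      algebraMap A W.B₀ (p * ⅟2) * (12 * DoubleCover.x W.f₀ ^ 2 - algebraMap A W.B₀ W.t₂) := by
  refine DoubleCover.exists_der _ D _ _ ?_
  have hy := DoubleCover.y_sq W.f₀
  rw [aeval_f₀] at hy
  rw [coeffDer_f₀, aeval_derivative_f₀]
  have h3 := congrArg (algebraMap A W.B₀) H.three_mul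
  have h2 := congrArg (algebraMap A W.B₀) (invOf_mul_self (2 : A))
  have ht := congrArg (algebraMap A W.B₀) H.map_t₂
  have ht' := congrArg (algebraMap A W.B₀) H.map_t₃
  simp only [map_add, map_sub, map_mul, map_ofNat, map_neg, map_one, aeval_C, aeval_X]
    at h3 h2 ht ht' ⊢
  rw [ht, ht']
  grind

/-- The lift to `U₁`, in the coordinates `u = 1/(x - a)`, `v = y/(x - a)²`. On the
overlap it agrees for `q` with the lift to `U₀`; for `p` it leaves `x` and `y` fixed; for `r` the
vector field on `U₀` has a pole at `O`, which is removed by adding `-r g` times a vertical field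
without zeros, where `g = -v/(2u)`. -/
theorem exists_e₁ : ∃ E : Derivation k W.B₁ W.B₁, Extends D E ∧
    E (DoubleCover.x W.f₁) = -algebraMap A W.B₁ (2 * q) * DoubleCover.x W.f₁ +
      algebraMap A W.B₁ r * (algebraMap A W.B₁ (2 * W.a) * DoubleCover.x W.f₁ +
        algebraMap A W.B₁ (⅟2 * (12 * W.a ^ 2 - W.t₂)) * DoubleCover.x W.f₁ ^ 2 +
        algebraMap A W.B₁ (⅟2 * W.b ^ 2) * DoubleCover.x W.f₁ ^ 3) +
      algebraMap A W.B₁ (p * W.b) * DoubleCover.x W.f₁ ^ 2 ∧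
    E (DoubleCover.y W.f₁) = -algebraMap A W.B₁ q * DoubleCover.y W.f₁ +
      algebraMap A W.B₁ r * (algebraMap A W.B₁ W.a +
        algebraMap A W.B₁ (3 * ⅟2 * ⅟2 * (12 * W.a ^ 2 - W.t₂)) * DoubleCover.x W.f₁ +
        algebraMap A W.B₁ (W.b ^ 2) * DoubleCover.x W.f₁ ^ 2) * DoubleCover.y W.f₁ +
      algebraMap A W.B₁ (2 * p * W.b) * DoubleCover.x W.f₁ * DoubleCover.y W.f₁ := by
  refine DoubleCover.exists_der _ D _ _ ?_
  have hy := DoubleCover.y_sq W.f₁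
  rw [aeval_f₁] at hy
  rw [coeffDer_f₁, aeval_derivative_f₁]
  have h3 := congrArg (algebraMap A W.B₁) H.three_mul
  have h2 := congrArg (algebraMap A W.B₁) (invOf_mul_self (2 : A))
  have ht := congrArg (algebraMap A W.B₁) H.map_t₂
  have ha := congrArg (algebraMap A W.B₁) H.map_a
  have hb := congrArg (algebraMap A W.B₁) H.map_b
  simp only [t₃, map_add, map_sub, map_mul, map_pow, map_ofNat, map_one, aeval_C, aeval_X]
    at h3 h2 ht ha hb ⊢
  rw [ht, ha, hb]
  grind

end HasCoords

end EllipticPair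

/-! ### Adapted local liftings -/

namespace EllipticPair

variable {A : Type*} [CommRing A] (W : EllipticPair A) {k : Type*} [CommRing k] [Algebra k A]
variable [Invertible (2 : A)]

/-- A local lifting of `D` given on the two charts by the polynomial vector fields attached to the
coordinates `p, q, r` of `D`. -/
structure IsAdapted {D : Derivation k A A} (l : W.cover.Lift D) (s p q r : A) : Prop where
  e₀_x : l.e₀ (DoubleCover.x W.f₀) = algebraMap A W.B₀ (2 * q) * DoubleCover.x W.f₀ +
    algebraMap A W.B₀ r * (2 * DoubleCover.x W.f₀ ^ 2 - algebraMap A W.B₀ s) +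
    algebraMap A W.B₀ p * DoubleCover.y W.f₀
  e₀_y : l.e₀ (DoubleCover.y W.f₀) = algebraMap A W.B₀ (3 * q) * DoubleCover.y W.f₀ +
    algebraMap A W.B₀ (3 * r) * DoubleCover.x W.f₀ * DoubleCover.y W.f₀ +
    algebraMap A W.B₀ (p * ⅟2) * (12 * DoubleCover.x W.f₀ ^ 2 - algebraMap A W.B₀ W.t₂)
  e₁_u : l.e₁ (DoubleCover.x W.f₁) = -algebraMap A W.B₁ (2 * q) * DoubleCover.x W.f₁ +
    algebraMap A W.B₁ r * (algebraMap A W.B₁ (2 * W.a) * DoubleCover.x W.f₁ +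
      algebraMap A W.B₁ (⅟2 * (12 * W.a ^ 2 - W.t₂)) * DoubleCover.x W.f₁ ^ 2 +
      algebraMap A W.B₁ (⅟2 * W.b ^ 2) * DoubleCover.x W.f₁ ^ 3) +
    algebraMap A W.B₁ (p * W.b) * DoubleCover.x W.f₁ ^ 2
  e₁_v : l.e₁ (DoubleCover.y W.f₁) = -algebraMap A W.B₁ q * DoubleCover.y W.f₁ +
    algebraMap A W.B₁ r * (algebraMap A W.B₁ W.a +
      algebraMap A W.B₁ (3 * ⅟2 * ⅟2 * (12 * W.a ^ 2 - W.t₂)) * DoubleCover.x W.f₁ +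
      algebraMap A W.B₁ (W.b ^ 2) * DoubleCover.x W.f₁ ^ 2) * DoubleCover.y W.f₁ +
    algebraMap A W.B₁ (2 * p * W.b) * DoubleCover.x W.f₁ * DoubleCover.y W.f₁

variable {W} {D : Derivation k A A} {s p q r : A}

theorem HasCoords.exists_isAdapted (H : W.HasCoords D s p q r) :
    ∃ l : W.cover.Lift D, W.IsAdapted l s p q r := by
  obtain ⟨e₀, ext₀, hx, hy⟩ := H.exists_e₀
  obtain ⟨e₁, ext₁, hu, hv⟩ := H.exists_e₁
  obtain ⟨r₀, ext_r₀, hr₀⟩ := exists_localize D e₀ ext₀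
    (DoubleCover.x W.f₀ - algebraMap A W.B₀ W.a)
  obtain ⟨V, hV, hV'⟩ := W.exists_vertical
  obtain ⟨r₁, hr₁⟩ := DoubleCover.exists_overlap W.separable₁ W.cover.res₁ D e₁ ext₁ r₀ ext_r₀ V
    (by rw [res₁_u, res₁_v]; exact hV) (by rw [res₁_u, res₁_v]; exact hV')
  have Px : W.cover.P (DoubleCover.x W.f₀) = W.a := DoubleCover.algHom_x _ _ _ _
  have Py : W.cover.P (DoubleCover.y W.f₀) = W.b := DoubleCover.algHom_y _ _ _ _
  have Ou : W.cover.O (DoubleCover.x W.f₁) = 0 := DoubleCover.algHom_x _ _ _ _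
  have Ov : W.cover.O (DoubleCover.y W.f₁) = 0 := DoubleCover.algHom_y _ _ _ _
  refine ⟨⟨e₀, e₁, r₀, r₁, ext₀, ext₁, hr₀, hr₁,
    fun g => (DoubleCover.compat _ W.cover.P D e₀ D ext₀ (fun _ => rfl) ?_ ?_ g).symm,
    fun g => (DoubleCover.compat _ W.cover.O D e₁ D ext₁ (fun _ => rfl) ?_ ?_ g).symm⟩,
    hx, hy, hu, hv⟩
  · rw [hx]
    simp only [map_add, map_sub, map_mul, map_pow, map_ofNat, AlgHom.commutes, Px, Py,
      Algebra.algebraMap_self_apply, H.map_a]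
  · rw [hy]
    simp only [map_add, map_sub, map_mul, map_pow, map_ofNat, AlgHom.commutes, Px, Py,
      Algebra.algebraMap_self_apply, H.map_b]
    ring
  · simp [hu, Ou]
  · simp [hv, Ou, Ov]

namespace IsAdapted

variable {l : W.cover.Lift D} (hl : W.IsAdapted l s p q r) (H : W.HasCoords D s p q r)

include hl H

/-- `L(dx/y) = r x dx/y - q dx/y` on `U₀`. -/
theorem lie_w₀ : lieDeriv D l.e₀ l.ext₀ W.w₀ =
    (algebraMap A W.B₀ r * DoubleCover.x W.f₀ - algebraMap A W.B₀ q) • W.w₀ := by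
  obtain ⟨V, Vx, Vy, hV⟩ := DoubleCover.exists_dual W.separable₀
  have hy := DoubleCover.y_sq W.f₀
  have h2 := congrArg (algebraMap A W.B₀) (invOf_mul_self (2 : A))
  have h3 := congrArg (algebraMap A W.B₀) H.three_mul
  have ht := congrArg (algebraMap A W.B₀) H.map_t₂
  rw [aeval_f₀] at hy
  rw [aeval_derivative_f₀] at Vy
  refine DoubleCover.lieDeriv_invDiff W.separable₀ D l.e₀ l.ext₀ V hV _ ?_ ?_
  · rw [hl.e₀_x, hl.e₀_y]
    simp only [map_add, map_sub, map_mul, map_ofNat, map_one, Derivation.leibniz,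
      Derivation.leibniz_pow, Derivation.map_algebraMap, derivation_ofNat, smul_eq_mul,
      nsmul_eq_mul, Vx, Vy] at h2 h3 ht ⊢
    push_cast
    grind
  · rw [hl.e₀_y, aeval_derivative_f₀, map_sub, l.ext₀ W.t₂, Derivation.leibniz,
      Derivation.leibniz_pow, hl.e₀_x, ht]
    simp only [map_add, map_sub, map_mul, map_ofNat, map_one, Derivation.leibniz,
      Derivation.leibniz_pow, Derivation.map_algebraMap, derivation_ofNat, smul_eq_mul,
      nsmul_eq_mul, Vx, Vy] at h2 h3 ⊢
    push_cast
    grind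

/-- `L(dx/y) = r η₁ - q dx/y` on `U₁`, where `η₁` is the regular form `x dx/y + dg`. -/
theorem lie_w₁ : lieDeriv D l.e₁ l.ext₁ W.w₁ = algebraMap A W.B₁ r • W.η₁ -
    algebraMap A W.B₁ q • W.w₁ := by
  obtain ⟨V, Vx, Vy, hV⟩ := DoubleCover.exists_dual W.separable₁
  have hy := DoubleCover.y_sq W.f₁
  have h2 := congrArg (algebraMap A W.B₁) (invOf_mul_self (2 : A))
  have h3 := congrArg (algebraMap A W.B₁) H.three_mul
  have ht := congrArg (algebraMap A W.B₁) H.map_t₂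
  have ha := congrArg (algebraMap A W.B₁) H.map_a
  have hb := congrArg (algebraMap A W.B₁) H.map_b
  rw [aeval_f₁] at hy
  rw [aeval_derivative_f₁] at Vy
  rw [w₁, map_neg, DoubleCover.lieDeriv_invDiff W.separable₁ D l.e₁ l.ext₁ V hV
    (algebraMap A W.B₁ r * (algebraMap A W.B₁ W.a +
      algebraMap A W.B₁ (⅟2 * ⅟2 * (12 * W.a ^ 2 - W.t₂)) * DoubleCover.x W.f₁ +
      algebraMap A W.B₁ (⅟2 * W.b ^ 2) * DoubleCover.x W.f₁ ^ 2) - algebraMap A W.B₁ q),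
    η₁, w₁]
  · module
  · rw [hl.e₁_u, hl.e₁_v]
    simp only [map_add, map_sub, map_neg, map_mul, map_pow, map_ofNat, map_one, Derivation.leibniz,
      Derivation.leibniz_pow, Derivation.map_algebraMap, derivation_ofNat, smul_eq_mul,
      nsmul_eq_mul, Vx] at h2 ⊢
    push_cast
    grind
  · simp only [aeval_derivative_f₁, map_add, map_sub, Derivation.leibniz,
      Derivation.leibniz_pow, l.ext₁ _, hl.e₁_u, hl.e₁_v, ht, ha, hb, derivation_ofNat]
    simp only [t₃, map_sub, map_neg, map_mul, map_pow, map_ofNat, map_one, Derivation.leibniz,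
      Derivation.leibniz_pow, Derivation.map_algebraMap, derivation_ofNat, smul_eq_mul,
      nsmul_eq_mul, Vx, Vy] at h2 h3 ⊢
    push_cast
    grind

end IsAdapted

end EllipticPair

/-! ### The vertical difference of an adapted lifting -/

namespace EllipticPair

variable {A : Type*} [CommRing A] {W : EllipticPair A} {k : Type*} [CommRing k] [Algebra k A]
variable [Invertible (2 : A)]
variable {D : Derivation k A A} {s p q r : A}

theorem derivation_mul_sq {B : Type*} [CommRing B] [Algebra k B] (F : Derivation k B B) (y i : B) :
    F (y * i ^ 2) = y * (2 * (i * F i)) + i ^ 2 * F y := by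
  simp only [Derivation.leibniz, Derivation.leibniz_pow, smul_eq_mul, nsmul_eq_mul,
    Nat.add_one_sub_one, pow_one, Nat.cast_ofNat]

/-- The difference of the two lifts applied to `u = 1/(x - a)`. The variables `i` and `h` stand for
`u` and `1/2`, so that `-(h * y * i)` is the function `g`. -/
theorem vertical_u {B : Type*} [CommRing B] {a b s h x y i : B} (p q r : B) (hm : (x - a) * i = 1)
    (hy : y ^ 2 = 4 * x ^ 3 - 3 * s * x - (4 * a ^ 3 - 3 * s * a - b ^ 2)) (h2 : h * 2 = 1) :
    -(2 * q) * i + r * (2 * a * i + h * (12 * a ^ 2 - 3 * s) * i ^ 2 + h * b ^ 2 * i ^ 3) +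
        p * b * i ^ 2 -
      -i ^ 2 * (2 * q * x + r * (2 * x ^ 2 - s) + p * y -
        (2 * q * a + r * (2 * a ^ 2 - s) + p * b)) =
      (p - r * -(h * y * i)) * (y * i ^ 2) := by
  linear_combination (2 * q * i + 2 * r * i * (x + a) + 2 * r -
      h * r * (4 * (((x - a) * i) ^ 2 + (x - a) * i + 1) + 12 * a * i * ((x - a) * i + 1) +
        (12 * a ^ 2 - 3 * s) * i ^ 2)) * hm - h * r * i ^ 3 * hy - r * (2 + 6 * a * i) * h2

/-- Twice the difference of the two lifts applied to `v = y/(x - a)²`, in the notation of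
`vertical_u`. -/
theorem vertical_v {B : Type*} [CommRing B] {a b s h x y i : B} (p q r : B) (hm : (x - a) * i = 1)
    (hy : y ^ 2 = 4 * x ^ 3 - 3 * s * x - (4 * a ^ 3 - 3 * s * a - b ^ 2)) (h2 : h * 2 = 1) :
    2 * (-q * (y * i ^ 2) + r * (a + 3 * h * h * (12 * a ^ 2 - 3 * s) * i + b ^ 2 * i ^ 2) *
          (y * i ^ 2) + 2 * p * b * i * (y * i ^ 2) -
        (y * (2 * (i * (-i ^ 2 * (2 * q * x + r * (2 * x ^ 2 - s) + p * y -
            (2 * q * a + r * (2 * a ^ 2 - s) + p * b))))) +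
          i ^ 2 * (3 * q * y + 3 * r * x * y + p * h * (12 * x ^ 2 - 3 * s)))) =
      (p - r * -(h * y * i)) *
        (4 + 24 * a * i + 3 * (12 * a ^ 2 - 3 * s) * i ^ 2 + 4 * b ^ 2 * i ^ 3) := by
  have key := glue_key hm hy rfl
  linear_combination (8 * q * y * i ^ 2 + 8 * r * y * i ^ 2 * (x + a) + 2 * r * y * i) * hm -
    p * key + (r * y * i * (3 * h * (12 * a ^ 2 - 3 * s) * i ^ 2 - 2 - 12 * a * i -
      2 * b ^ 2 * i ^ 3) - p * i ^ 2 * (12 * x ^ 2 - 3 * s)) * h2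

theorem r₀_inv (l : W.cover.Lift D) :
    l.r₀ W.inv = -W.inv ^ 2 * (l.r₀ W.x₀₁ - algebraMap A W.B₀₁ (D W.a)) := by
  rw [Derivation.leibniz_of_mul_eq_one l.r₀ ((mul_comm _ _).trans W.mul_inv), map_sub, l.ext_r₀,
    smul_eq_mul]

namespace IsAdapted

variable {l : W.cover.Lift D} (hl : W.IsAdapted l s p q r) (H : W.HasCoords D s p q r)

include hl

theorem r₀_x : l.r₀ W.x₀₁ = algebraMap A W.B₀₁ (2 * q) * W.x₀₁ +
    algebraMap A W.B₀₁ r * (2 * W.x₀₁ ^ 2 - algebraMap A W.B₀₁ s) +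
    algebraMap A W.B₀₁ p * W.y₀₁ := by
  have h := l.res_r₀ (DoubleCover.x W.f₀)
  rw [hl.e₀_x] at h
  simp only [map_add, map_sub, map_mul, map_pow, map_ofNat, AlgHom.commutes] at h ⊢
  exact h

theorem r₀_y : l.r₀ W.y₀₁ = algebraMap A W.B₀₁ (3 * q) * W.y₀₁ +
    algebraMap A W.B₀₁ (3 * r) * W.x₀₁ * W.y₀₁ +
    algebraMap A W.B₀₁ (p * ⅟2) * (12 * W.x₀₁ ^ 2 - algebraMap A W.B₀₁ W.t₂) := by
  have h := l.res_r₀ (DoubleCover.y W.f₀)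
  rw [hl.e₀_y] at h
  simp only [map_add, map_sub, map_mul, map_pow, map_ofNat, AlgHom.commutes] at h ⊢
  exact h

theorem r₁_inv : l.r₁ W.inv = -algebraMap A W.B₀₁ (2 * q) * W.inv +
    algebraMap A W.B₀₁ r * (algebraMap A W.B₀₁ (2 * W.a) * W.inv +
      algebraMap A W.B₀₁ (⅟2 * (12 * W.a ^ 2 - W.t₂)) * W.inv ^ 2 +
      algebraMap A W.B₀₁ (⅟2 * W.b ^ 2) * W.inv ^ 3) +
    algebraMap A W.B₀₁ (p * W.b) * W.inv ^ 2 := by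
  have h := l.res_r₁ (DoubleCover.x W.f₁)
  rw [hl.e₁_u] at h
  simp only [map_add, map_sub, map_neg, map_mul, map_pow, map_ofNat, AlgHom.commutes, res₁_u] at h ⊢
  exact h

theorem r₁_v : l.r₁ (W.y₀₁ * W.inv ^ 2) = -algebraMap A W.B₀₁ q * (W.y₀₁ * W.inv ^ 2) +
    algebraMap A W.B₀₁ r * (algebraMap A W.B₀₁ W.a +
      algebraMap A W.B₀₁ (3 * ⅟2 * ⅟2 * (12 * W.a ^ 2 - W.t₂)) * W.inv +
      algebraMap A W.B₀₁ (W.b ^ 2) * W.inv ^ 2) * (W.y₀₁ * W.inv ^ 2) +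
    algebraMap A W.B₀₁ (2 * p * W.b) * W.inv * (W.y₀₁ * W.inv ^ 2) := by
  have h := l.res_r₁ (DoubleCover.y W.f₁)
  rw [hl.e₁_v] at h
  simp only [map_add, map_sub, map_neg, map_mul, map_pow, map_ofNat, AlgHom.commutes, res₁_u,
    res₁_v] at h ⊢
  exact h

/-- The action on the function `g`. It is computed from `g u = -v/2`, as `u` is invertible. -/
theorem r₁_g : l.r₁ W.g₀₁ = (algebraMap A W.B₀₁ q +
    algebraMap A W.B₀₁ r * (-algebraMap A W.B₀₁ W.a +
      algebraMap A W.B₀₁ (⅟2 * ⅟2 * (12 * W.a ^ 2 - W.t₂)) * W.inv +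
      algebraMap A W.B₀₁ (⅟2 * W.b ^ 2) * W.inv ^ 2) +
      algebraMap A W.B₀₁ (p * W.b) * W.inv) * W.g₀₁ := by
  have hm := W.mul_inv
  have h2 := congrArg (algebraMap A W.B₀₁) (invOf_mul_self (2 : A))
  have hr₁u := hl.r₁_inv
  have hr₁v := hl.r₁_v
  let K := -algebraMap A W.B₀₁ q + algebraMap A W.B₀₁ r * (algebraMap A W.B₀₁ W.a +
      algebraMap A W.B₀₁ (3 * ⅟2 * ⅟2 * (12 * W.a ^ 2 - W.t₂)) * W.inv +
      algebraMap A W.B₀₁ (W.b ^ 2) * W.inv ^ 2) + algebraMap A W.B₀₁ (2 * p * W.b) * W.inv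
  let M := -algebraMap A W.B₀₁ (2 * q) + algebraMap A W.B₀₁ r * (algebraMap A W.B₀₁ (2 * W.a) +
      algebraMap A W.B₀₁ (⅟2 * (12 * W.a ^ 2 - W.t₂)) * W.inv +
      algebraMap A W.B₀₁ (⅟2 * W.b ^ 2) * W.inv ^ 2) + algebraMap A W.B₀₁ (p * W.b) * W.inv
  have hg : W.g₀₁ * W.inv = algebraMap A W.B₀₁ (-⅟2) * (W.y₀₁ * W.inv ^ 2) := by
    rw [g₀₁, map_neg]
    ring
  have h := congrArg l.r₁ hg
  rw [Derivation.leibniz, Derivation.leibniz, l.ext_r₁, map_neg D, derivation_invOf_two,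
    hr₁u, hr₁v] at h
  simp only [map_sub, map_neg, map_mul, map_pow, map_ofNat, map_one, map_zero, neg_zero,
    smul_eq_mul] at h hg h2 ⊢
  -- `K` and `M` are the logarithmic derivatives of `v` and `u`, so that of `g` is `K - M`.
  linear_combination (norm := (simp only [K, M, map_sub, map_mul, map_pow, map_ofNat]; ring))
    (W.x₀₁ - algebraMap A W.B₀₁ W.a) * h - (W.x₀₁ - algebraMap A W.B₀₁ W.a) * K * hg -
      (l.r₁ W.g₀₁ - (K - M) * W.g₀₁) * hm +
      W.g₀₁ * algebraMap A W.B₀₁ r * (algebraMap A W.B₀₁ (12 * W.a ^ 2 - W.t₂) * W.inv *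
        algebraMap A W.B₀₁ ⅟2 - algebraMap A W.B₀₁ (W.b ^ 2) * W.inv ^ 2) * h2

include H

/-- Together with `diff_v`: the vector field `r₁ - r₀` is `p - r g` times the vertical vector field
with `u ↦ v` and `v ↦ f₁'(u)/2`, which is dual to `-dx/y`. -/
theorem diff_inv : l.diff W.inv =
    (algebraMap A W.B₀₁ p - algebraMap A W.B₀₁ r * W.g₀₁) * (W.y₀₁ * W.inv ^ 2) := by
  have hm := W.mul_inv
  have hy := W.y₀₁_sq
  have h2 := congrArg (algebraMap A W.B₀₁) (invOf_mul_self (2 : A))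
  have h3 := congrArg (algebraMap A W.B₀₁) H.three_mul
  have ha := congrArg (algebraMap A W.B₀₁) H.map_a
  have hr₀x := hl.r₀_x
  have hr₁u := hl.r₁_inv
  simp only [t₃, map_add, map_sub, map_mul, map_pow, map_ofNat, map_one]
    at hy h2 h3 ha hr₀x hr₁u
  rw [← h3] at hy hr₁u
  rw [PairCover.Lift.diff, vert_apply, hr₁u, r₀_inv, hr₀x, ha, g₀₁]
  exact vertical_u _ _ _ hm hy h2

theorem diff_v : 2 * l.diff (W.y₀₁ * W.inv ^ 2) =
    (algebraMap A W.B₀₁ p - algebraMap A W.B₀₁ r * W.g₀₁) * aeval W.inv (derivative W.f₁) := by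
  have hm := W.mul_inv
  have hy := W.y₀₁_sq
  have h2 := congrArg (algebraMap A W.B₀₁) (invOf_mul_self (2 : A))
  have h3 := congrArg (algebraMap A W.B₀₁) H.three_mul
  have ha := congrArg (algebraMap A W.B₀₁) H.map_a
  have hr₀x := hl.r₀_x
  have hr₀y := hl.r₀_y
  have hr₁v := hl.r₁_v
  have hd := W.aeval_derivative_f₁ W.inv
  simp only [t₃, map_add, map_sub, map_mul, map_pow, map_ofNat, map_one]
    at hy h2 h3 ha hr₀x hr₀y hr₁v
  rw [← h3] at hy hr₀y hr₁v hd
  rw [PairCover.Lift.diff, vert_apply, hr₁v, derivation_mul_sq, r₀_inv, hr₀x, hr₀y, ha, hd, g₀₁]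
  exact vertical_v _ _ _ hm hy h2

theorem contract_w₀ : l.diff.liftKaehlerDifferential (kaehlerMap W.cover.res₀ W.w₀) =
    algebraMap A W.B₀₁ r * W.g₀₁ - algebraMap A W.B₀₁ p := by
  rw [← res_w, w₁, map_neg, map_neg, DoubleCover.contract_invDiff W.separable₁ W.cover.res₁ l.diff
    (algebraMap A W.B₀₁ p - algebraMap A W.B₀₁ r * W.g₀₁), neg_sub]
  · rw [res₁_u, res₁_v, hl.diff_inv H]
  · rw [res₁_u, res₁_v, hl.diff_v H]

end IsAdapted

end EllipticPair

/-! ### Computations with classes -/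

namespace PairCover

variable {k A B₀ B₁ B₀₁ : Type*} [CommRing k] [CommRing A] [CommRing B₀] [CommRing B₁]
  [CommRing B₀₁] [Algebra A B₀] [Algebra A B₁] [Algebra A B₀₁]
  [Algebra k A] [Algebra k B₀] [Algebra k B₁] [Algebra k B₀₁]
  {X : PairCover A B₀ B₁ B₀₁}

theorem comb_cls_eq_zero {z₁ z₂ z₃ : X.Cochain} (h₁ : X.d₁ z₁ = 0) (h₂ : X.d₁ z₂ = 0)
    (h₃ : X.d₁ z₃ = 0) (a b c : A) :
    a • X.cls z₁ h₁ + b • X.cls z₂ h₂ + c • X.cls z₃ h₃ = 0 ↔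
      ∃ f, X.d₀ f = a • z₁ + b • z₂ + c • z₃ :=
  Submodule.Quotient.mk_eq_zero _

namespace Lift

variable {D : Derivation k A A} (l : X.Lift D)
  (hΩ : ∃ w : Ω[B₀₁⁄A], ∀ m : Ω[B₀₁⁄A], ∃ g : B₀₁, m = g • w)

/-- To compute `∇` of a class it suffices to write the transformed cocycle as a combination of
cocycles and a coboundary. -/
theorem onH1_cls_eq {z z₁ z₂ z₃ : X.Cochain} (hz : X.d₁ z = 0) (h₁ : X.d₁ z₁ = 0)
    (h₂ : X.d₁ z₂ = 0) (h₃ : X.d₁ z₃ = 0) (a b c : A) (f : B₀ × B₁)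
    (h : l.act z = a • z₁ + b • z₂ + c • z₃ + X.d₀ f) :
    l.onH1 hΩ (X.cls z hz) = a • X.cls z₁ h₁ + b • X.cls z₂ h₂ + c • X.cls z₃ h₃ := by
  rw [onH1_cls]
  refine (Submodule.Quotient.eq _).2 ⟨f, ?_⟩
  change X.d₀ f = l.act z - (a • z₁ + b • z₂ + c • z₃)
  rw [h, add_sub_cancel_left]

theorem onH1_cls_eq_zero {z : X.Cochain} (hz : X.d₁ z = 0) (h : l.act z = 0) :
    l.onH1 hΩ (X.cls z hz) = 0 := by
  rw [onH1_cls]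
  refine (Submodule.Quotient.mk_eq_zero _).2 ⟨0, ?_⟩
  change X.d₀ 0 = l.act z
  rw [h, map_zero]

theorem act_smul (g : A) (z : X.Cochain) : l.act (g • z) = g • l.act z + D g • z := by
  refine Prod.ext (Prod.ext ?_ ?_) (Prod.ext (Prod.ext ?_ ?_) ?_)
  · change lieDeriv D l.e₀ l.ext₀ (g • z.1.1) = g • lieDeriv D l.e₀ l.ext₀ z.1.1 + D g • z.1.1
    rw [← algebraMap_smul B₀ g z.1.1, lieDeriv_smul, l.ext₀, algebraMap_smul, algebraMap_smul]
  · change D (g • z.1.2) = g • D z.1.2 + D g • z.1.2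
    rw [smul_eq_mul, Derivation.leibniz, smul_eq_mul, smul_eq_mul, smul_eq_mul, mul_comm (D g)]
  · change lieDeriv D l.e₁ l.ext₁ (g • z.2.1.1) =
      g • lieDeriv D l.e₁ l.ext₁ z.2.1.1 + D g • z.2.1.1
    rw [← algebraMap_smul B₁ g z.2.1.1, lieDeriv_smul, l.ext₁, algebraMap_smul, algebraMap_smul]
  · change D (g • z.2.1.2) = g • D z.2.1.2 + D g • z.2.1.2
    rw [smul_eq_mul, Derivation.leibniz, smul_eq_mul, smul_eq_mul, smul_eq_mul, mul_comm (D g)]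
  · change l.r₁ (g • z.2.2) + l.diff.liftKaehlerDifferential
        (kaehlerMap X.res₀ (g • z.1.1)) =
      g • (l.r₁ z.2.2 + l.diff.liftKaehlerDifferential (kaehlerMap X.res₀ z.1.1)) +
        D g • z.2.2
    rw [Algebra.smul_def g z.2.2, Derivation.leibniz, l.ext_r₁, LinearMap.map_smul,
      ← algebraMap_smul B₀₁ g (kaehlerMap X.res₀ z.1.1), LinearMap.map_smul, Algebra.smul_def g,
      Algebra.smul_def (D g)]
    simp only [smul_eq_mul]
    ring

theorem onH1_smul (g : A) (c : X.H1) : l.onH1 hΩ (g • c) = g • l.onH1 hΩ c + D g • c := by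
  obtain ⟨⟨z, hz⟩, rfl⟩ := Submodule.Quotient.mk_surjective _ c
  exact congrArg (Submodule.Quotient.mk (p := (LinearMap.range X.d₀).submoduleOf
    (LinearMap.ker X.d₁))) (Subtype.ext (l.act_smul g z))

end Lift

end PairCover

/-! ### The connection matrix -/

namespace EllipticPair

variable {A : Type*} [CommRing A] {W : EllipticPair A} {k : Type*} [CommRing k] [Algebra k A]
variable [Invertible (2 : A)]
variable {D : Derivation k A A} {s p q r : A}

/-- The function on `U₀`, vanishing at `P`, which together with `primitive₁` exhibits
`∇ ω₃ - q ω₃ + (r t₂/12) α₂` as a multiple of `α₁`. -/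
def primitive₀ (W : EllipticPair A) (p r : A) : W.B₀ :=
  algebraMap A W.B₀ (r * ⅟2) * (DoubleCover.y W.f₀ - algebraMap A W.B₀ W.b) +
    algebraMap A W.B₀ p * (DoubleCover.x W.f₀ - algebraMap A W.B₀ W.a)

/-- The function on `U₁`, vanishing at `O`, which corresponds to `primitive₀` on `U₀`. -/
def primitive₁ (W : EllipticPair A) (p r : A) : W.B₁ :=
  -(algebraMap A W.B₁ (r * ⅟2) * (algebraMap A W.B₁ (⅟2 * ⅟2 * (12 * W.a ^ 2 - W.t₂)) +
      algebraMap A W.B₁ (⅟2 * W.b ^ 2) * DoubleCover.x W.f₁) +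
    algebraMap A W.B₁ (p * ⅟2 * W.b)) * DoubleCover.y W.f₁

namespace IsAdapted

variable {l : W.cover.Lift D} (hl : W.IsAdapted l s p q r) (H : W.HasCoords D s p q r)

include hl

theorem r₁_g_add : l.r₁ W.g₀₁ + W.x₀₁ * (algebraMap A W.B₀₁ r * W.g₀₁ - algebraMap A W.B₀₁ p) =
    algebraMap A W.B₀₁ q * W.g₀₁ - algebraMap A W.B₀₁ (p * W.a + r * (⅟2 * W.b)) +
      (W.cover.res₁ (W.primitive₁ p r) - W.cover.res₀ (W.primitive₀ p r)) := by
  have hm := W.mul_inv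
  have hx : W.cover.res₀ (DoubleCover.x W.f₀) = W.x₀₁ := rfl
  have hy : W.cover.res₀ (DoubleCover.y W.f₀) = W.y₀₁ := rfl
  rw [hl.r₁_g, g₀₁, primitive₁, primitive₀]
  simp only [map_add, map_sub, map_neg, map_mul, map_pow, map_ofNat,
    AlgHom.commutes, res₁_u, res₁_v, hx, hy]
  linear_combination -(algebraMap A W.B₀₁ r * algebraMap A W.B₀₁ ⅟2 * W.y₀₁) * hm

include H

theorem act_z₂ : l.act W.z₂ = (-p) • W.z₁ + (-q) • W.z₂ + r • W.z₃ := by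
  refine Prod.ext (Prod.ext ?_ ?_) (Prod.ext (Prod.ext ?_ ?_) ?_)
  · change lieDeriv D l.e₀ l.ext₀ W.w₀ = (-p) • (0 : Ω[W.B₀⁄A]) + (-q) • W.w₀ +
      r • (DoubleCover.x W.f₀ • W.w₀)
    rw [hl.lie_w₀ H, sub_smul, mul_smul, algebraMap_smul, algebraMap_smul]
    module
  · change D 0 = (-p) • (0 : A) + (-q) • (0 : A) + r • (0 : A)
    simp
  · change lieDeriv D l.e₁ l.ext₁ W.w₁ = (-p) • (0 : Ω[W.B₁⁄A]) + (-q) • W.w₁ + r • W.η₁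
    rw [hl.lie_w₁ H, algebraMap_smul, algebraMap_smul]
    module
  · change D 0 = (-p) • (0 : A) + (-q) • (0 : A) + r • (0 : A)
    simp
  · change l.r₁ 0 + l.diff.liftKaehlerDifferential (kaehlerMap W.cover.res₀ W.w₀) =
      (-p) • (1 : W.B₀₁) + (-q) • (0 : W.B₀₁) + r • W.g₀₁
    rw [hl.contract_w₀ H, map_zero, Algebra.smul_def (-p), Algebra.smul_def r, smul_zero,
      map_neg]
    ring

theorem lie_xw₀ : lieDeriv D l.e₀ l.ext₀ (DoubleCover.x W.f₀ • W.w₀) =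
    algebraMap A W.B₀ q • DoubleCover.x W.f₀ • W.w₀ -
      algebraMap A W.B₀ (r * (⅟2 * ⅟2 * s)) • W.w₀ +
      KaehlerDifferential.D A W.B₀ (W.primitive₀ p r) := by
  obtain ⟨V, Vx, Vy, hV⟩ := DoubleCover.exists_dual W.separable₀
  have h2 := congrArg (algebraMap A W.B₀) (invOf_mul_self (2 : A))
  have h3 := congrArg (algebraMap A W.B₀) H.three_mul
  rw [aeval_derivative_f₀] at Vy
  rw [lieDeriv_smul, hl.lie_w₀ H, hl.e₀_x, hV, primitive₀, ← w₀]
  simp only [smul_smul, ← add_smul, ← sub_smul]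
  congr 1
  simp only [map_add, map_sub, map_mul, map_ofNat, map_one, Derivation.leibniz,
    Derivation.map_algebraMap, smul_eq_mul, Vx, Vy] at h2 h3 ⊢
  grind

theorem lie_η₁ : lieDeriv D l.e₁ l.ext₁ W.η₁ =
    algebraMap A W.B₁ q • W.η₁ -
      algebraMap A W.B₁ (r * (⅟2 * ⅟2 * s)) • W.w₁ +
      KaehlerDifferential.D A W.B₁ (W.primitive₁ p r) := by
  obtain ⟨V, Vx, Vy, hV⟩ := DoubleCover.exists_dual W.separable₁
  have hy := DoubleCover.y_sq W.f₁
  have h2 := congrArg (algebraMap A W.B₁) (invOf_mul_self (2 : A))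
  have h3 := congrArg (algebraMap A W.B₁) H.three_mul
  have ht := congrArg (algebraMap A W.B₁) H.map_t₂
  have ha := congrArg (algebraMap A W.B₁) H.map_a
  have hb := congrArg (algebraMap A W.B₁) H.map_b
  have hw : ∀ g, KaehlerDifferential.D A W.B₁ g = (-V g) • W.w₁ := fun g => by
    rw [hV, w₁, smul_neg, neg_smul, neg_neg]
  rw [aeval_f₁] at hy
  rw [aeval_derivative_f₁] at Vy
  rw [η₁, lieDeriv_smul, hl.lie_w₁ H, hw, primitive₁, η₁]
  simp only [smul_smul, ← add_smul, ← sub_smul]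
  congr 1
  simp only [map_add, Derivation.leibniz, Derivation.leibniz_pow, l.ext₁ _, hl.e₁_u, map_sub,
    derivation_ofNat, derivation_invOf_two, smul_eq_mul, nsmul_eq_mul, Nat.cast_ofNat,
    Nat.add_one_sub_one, pow_one]
  simp only [t₃, map_add, map_sub, map_neg, map_mul, map_pow, map_ofNat, map_one, map_zero,
    Derivation.leibniz, Derivation.leibniz_pow, Derivation.map_algebraMap, derivation_ofNat,
    smul_eq_mul, nsmul_eq_mul, Vx, Vy] at h2 h3 ht ha hb ⊢
  push_cast
  rw [ha, hb, ht]
  grind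

theorem act_z₃ : l.act W.z₃ = (-(p * W.a + r * (⅟2 * W.b))) • W.z₁ +
    (-(r * (⅟2 * ⅟2 * s))) • W.z₂ + q • W.z₃ +
    W.cover.d₀ (W.primitive₀ p r, W.primitive₁ p r) := by
  refine Prod.ext (Prod.ext ?_ ?_) (Prod.ext (Prod.ext ?_ ?_) ?_)
  · change lieDeriv D l.e₀ l.ext₀ (DoubleCover.x W.f₀ • W.w₀) =
      (-(p * W.a + r * (⅟2 * W.b))) • (0 : Ω[W.B₀⁄A]) + (-(r * (⅟2 * ⅟2 * s))) • W.w₀ +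
        q • (DoubleCover.x W.f₀ • W.w₀) + KaehlerDifferential.D A W.B₀ (W.primitive₀ p r)
    rw [hl.lie_xw₀ H, algebraMap_smul, algebraMap_smul, smul_zero]
    module
  · change D 0 = (-(p * W.a + r * (⅟2 * W.b))) • (0 : A) + (-(r * (⅟2 * ⅟2 * s))) • (0 : A) +
      q • (0 : A) + W.cover.P (W.primitive₀ p r)
    have Px : W.cover.P (DoubleCover.x W.f₀) = W.a := DoubleCover.algHom_x _ _ _ _
    have Py : W.cover.P (DoubleCover.y W.f₀) = W.b := DoubleCover.algHom_y _ _ _ _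
    simp [primitive₀, Px, Py]
  · change lieDeriv D l.e₁ l.ext₁ W.η₁ =
      (-(p * W.a + r * (⅟2 * W.b))) • (0 : Ω[W.B₁⁄A]) + (-(r * (⅟2 * ⅟2 * s))) • W.w₁ +
        q • W.η₁ + KaehlerDifferential.D A W.B₁ (W.primitive₁ p r)
    rw [hl.lie_η₁ H, algebraMap_smul, algebraMap_smul, smul_zero]
    module
  · change D 0 = (-(p * W.a + r * (⅟2 * W.b))) • (0 : A) + (-(r * (⅟2 * ⅟2 * s))) • (0 : A) +
      q • (0 : A) + W.cover.O (W.primitive₁ p r)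
    have Ov : W.cover.O (DoubleCover.y W.f₁) = 0 := DoubleCover.algHom_y _ _ _ _
    simp [primitive₁, Ov]
  · change l.r₁ W.g₀₁ + l.diff.liftKaehlerDifferential
        (kaehlerMap W.cover.res₀ (DoubleCover.x W.f₀ • W.w₀)) =
      (-(p * W.a + r * (⅟2 * W.b))) • (1 : W.B₀₁) + (-(r * (⅟2 * ⅟2 * s))) • (0 : W.B₀₁) +
        q • W.g₀₁ + (W.cover.res₁ (W.primitive₁ p r) - W.cover.res₀ (W.primitive₀ p r))
    rw [kaehlerMap_smul, map_smul, hl.contract_w₀ H, smul_zero, Algebra.smul_def q,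
      Algebra.smul_def (-(p * W.a + r * (⅟2 * W.b))), mul_one, map_neg]
    refine hl.r₁_g_add.trans ?_
    ring

end IsAdapted

/-- The Leibniz rule for the Gauss–Manin connection. -/
theorem gaussManin_smul (D : Derivation k A A) (g : A) (c : W.H1) :
    W.gaussManin D (g • c) = g • W.gaussManin D c + D g • c :=
  PairCover.Lift.onH1_smul _ _ g c

theorem gaussManin_α₁ (D : Derivation k A A) : W.gaussManin D W.α₁ = 0 := by
  obtain ⟨l⟩ := W.nonempty_lift D
  have h : l.act W.z₁ = 0 := by
    refine Prod.ext (Prod.ext (map_zero _) (map_zero D)) (Prod.ext (Prod.ext (map_zero _)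
      (map_zero D)) ?_)
    change l.r₁ 1 + l.diff.liftKaehlerDifferential (kaehlerMap W.cover.res₀ 0) = 0
    simp
  exact (DFunLike.congr_fun (W.gaussManin_eq D l) W.α₁).trans
    (l.onH1_cls_eq_zero W.span₀₁ W.d₁_z₁ h)

namespace HasCoords

variable (H : W.HasCoords D s p q r)

include H

theorem gaussManin_α₂ :
    W.gaussManin D W.α₂ = (-p) • W.α₁ + (-q) • W.α₂ + r • W.ω₃ := by
  obtain ⟨l, hl⟩ := H.exists_isAdapted
  exact (DFunLike.congr_fun (W.gaussManin_eq D l) W.α₂).trans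
    (l.onH1_cls_eq W.span₀₁ W.d₁_z₂ W.d₁_z₁ W.d₁_z₂ W.d₁_z₃ _ _ _ 0
      ((hl.act_z₂ H).trans (by rw [map_zero, add_zero])))

theorem gaussManin_ω₃ : W.gaussManin D W.ω₃ = (-(p * W.a + r * (⅟2 * W.b))) • W.α₁ +
    (-(r * (⅟2 * ⅟2 * s))) • W.α₂ + q • W.ω₃ := by
  obtain ⟨l, hl⟩ := H.exists_isAdapted
  exact (DFunLike.congr_fun (W.gaussManin_eq D l) W.ω₃).trans
    (l.onH1_cls_eq W.span₀₁ W.d₁_z₃ W.d₁_z₁ W.d₁_z₂ W.d₁_z₃ _ _ _ _ (hl.act_z₃ H))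

end HasCoords

end EllipticPair

/-! ### Laurent polynomials -/

section Laurent

variable {A : Type*} [CommRing A]

theorem coeff_aeval_T_one (p : A[X]) (m : ℤ) :
    (aeval (LaurentPolynomial.T 1 : LaurentPolynomial A) p).coeff m =
      if 0 ≤ m then p.coeff m.toNat else 0 := by
  induction p using Polynomial.induction_on' with
  | add p q hp hq =>
    rw [map_add, AddMonoidAlgebra.coeff_add, Finsupp.add_apply, hp, hq]
    split_ifs <;> simp
  | monomial n r =>
    rw [aeval_monomial, LaurentPolynomial.T_pow, mul_one, ← LaurentPolynomial.C_eq_algebraMap,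
      ← LaurentPolynomial.single_eq_C_mul_T, coeff_monomial, AddMonoidAlgebra.coeff_single,
      Finsupp.single_apply]
    grind

theorem coeff_aeval_T_neg_one (p : A[X]) (m : ℤ) :
    (aeval (LaurentPolynomial.T (-1) : LaurentPolynomial A) p).coeff m =
      if m ≤ 0 then p.coeff (-m).toNat else 0 := by
  rw [← LaurentPolynomial.invert_T, aeval_algHom_apply, LaurentPolynomial.invert_apply,
    coeff_aeval_T_one]
  simp

/-- A difference of a polynomial in `T` without constant term and a polynomial in `T⁻¹` is constant
only if the latter is. -/
theorem eq_neg_C_of_aeval_T_sub {p p' : A[X]} {c : A} (h₀ : p'.coeff 0 = 0)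
    (h : aeval (LaurentPolynomial.T 1 : LaurentPolynomial A) p' -
      aeval (LaurentPolynomial.T (-1) : LaurentPolynomial A) p = c • 1) : p = -C c := by
  ext n
  have h1 := congrArg (fun g => AddMonoidAlgebra.coeff g (-(n : ℤ))) h
  rw [← LaurentPolynomial.T_zero] at h1
  simp only [AddMonoidAlgebra.coeff_sub, Finsupp.sub_apply, AddMonoidAlgebra.coeff_smul,
    Finsupp.smul_apply, coeff_aeval_T_one, coeff_aeval_T_neg_one, LaurentPolynomial.T_apply,
    neg_neg, Int.toNat_natCast, smul_eq_mul] at h1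
  rw [coeff_neg, coeff_C]
  rcases Nat.eq_zero_or_pos n with rfl | hn
  · simp [h₀] at h1
    simp [← h1]
  · rw [if_neg (by omega), if_pos (by omega), if_neg (by omega), zero_sub, mul_zero,
      neg_eq_zero] at h1
    rw [h1, if_neg hn.ne', neg_zero]

/-- The monomial `T⁻¹` is the gap between the polynomials in `T` and the multiples of `T⁻²` in
`A[T⁻¹]`. -/
theorem eq_zero_of_aeval_T_sub {q q' : A[X]} {c : A}
    (h : aeval (LaurentPolynomial.T 1 : LaurentPolynomial A) q' -
      aeval (LaurentPolynomial.T (-1) : LaurentPolynomial A) (q * X ^ 2) =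
        c • LaurentPolynomial.T (-1)) : c = 0 ∧ q = 0 := by
  have key : ∀ m : ℕ, 0 < m → -(q * X ^ 2).coeff m = if m = 1 then c else 0 := fun m hm => by
    have h1 := congrArg (fun g => AddMonoidAlgebra.coeff g (-(m : ℤ))) h
    simp only [AddMonoidAlgebra.coeff_sub, Finsupp.sub_apply, AddMonoidAlgebra.coeff_smul,
      Finsupp.smul_apply, coeff_aeval_T_one, coeff_aeval_T_neg_one, LaurentPolynomial.T_apply,
      neg_neg, Int.toNat_natCast, smul_eq_mul] at h1
    rw [if_neg (by omega), if_pos (by omega), zero_sub] at h1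
    rw [h1]
    grind
  refine ⟨?_, ?_⟩
  · have := key 1 one_pos
    rw [coeff_mul_X_pow', if_neg (by norm_num), neg_zero, if_pos rfl] at this
    exact this.symm
  · ext n
    have := key (n + 2) (by omega)
    rw [coeff_mul_X_pow, if_neg (by omega), neg_eq_zero] at this
    rw [this, coeff_zero]

end Laurent

/-! ### Linear independence of the frame -/

namespace DoubleCover

variable {A : Type*} [CommRing A] {f : A[X]}

/-- Every function on the double cover has the form `p(x - c) + q(x - c) y`. -/
theorem exists_eq_aeval (c : A) (g : DoubleCover f) : ∃ p q : A[X],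
    g = aeval (x f - algebraMap A _ c) p + aeval (x f - algebraMap A _ c) q * y f := by
  induction g using DoubleCover.induction with
  | hx => exact ⟨X + C c, 0, by simp⟩
  | hy => exact ⟨0, 1, by simp⟩
  | hr r => exact ⟨C r, 0, by simp⟩
  | hadd g h hg hh =>
    obtain ⟨p, q, rfl⟩ := hg
    obtain ⟨p', q', rfl⟩ := hh
    exact ⟨p + p', q + q', by simp only [map_add]; ring⟩
  | hmul g h hg hh =>
    obtain ⟨p, q, rfl⟩ := hg
    obtain ⟨p', q', rfl⟩ := hh
    refine ⟨p * p' + q * q' * f.comp (X + C c), p * q' + q * p', ?_⟩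
    have hy : aeval (x f - algebraMap A _ c) (f.comp (X + C c)) = y f ^ 2 := by
      rw [aeval_comp, y_sq]
      simp
    simp only [map_add, map_mul, hy]
    ring

/-- The form `dx/y` is torsion free: the vector field dual to it has contraction `1` with it. -/
theorem smul_invDiff_eq_zero [Invertible (2 : A)] (hf : f.Separable) {g : DoubleCover f}
    (h : g • invDiff hf = 0) : g = 0 := by
  obtain ⟨V, Vx, Vy, hV⟩ := exists_dual hf
  have h2 : (2 : DoubleCover f) * algebraMap A _ (⅟2) = 1 := by
    rw [← map_ofNat (algebraMap A (DoubleCover f)) 2, ← map_mul, mul_invOf_self, map_one]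
  have e1 := congrArg V.liftKaehlerDifferential (y_smul_invDiff hf)
  have e2 := congrArg V.liftKaehlerDifferential (deriv_smul_invDiff hf)
  rw [LinearMap.map_smul, Derivation.liftKaehlerDifferential_comp_D, Vx, smul_eq_mul] at e1
  rw [LinearMap.map_smul, LinearMap.map_smul, Derivation.liftKaehlerDifferential_comp_D, Vy,
    smul_eq_mul, smul_eq_mul, ← mul_assoc, h2, one_mul] at e2
  have e : V.liftKaehlerDifferential (invDiff hf) - 1 = 0 := by
    refine eq_zero_of_smul hf (AlgHom.id A _) ?_ ?_
    · rw [AlgHom.id_apply, smul_eq_mul, mul_sub, mul_one, e1, sub_self]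
    · rw [AlgHom.id_apply, smul_eq_mul, mul_sub, mul_one, e2, sub_self]
  have h' := congrArg V.liftKaehlerDifferential h
  rwa [LinearMap.map_smul, sub_eq_zero.1 e, map_zero, smul_eq_mul, mul_one] at h'

end DoubleCover

namespace EllipticPair

variable {A : Type*} [CommRing A] (W : EllipticPair A)

/-- The double cover `v² = f₁(u)` over `A[u, 1/u]`, where the variable `T` of the Laurent
polynomials is `u = 1/(x - a)`. Its elements `⟨g, h⟩` stand for `g + h v`. -/
abbrev LaurentCover : Type _ :=
  QuadraticAlgebra (LaurentPolynomial A)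
    (aeval (LaurentPolynomial.T 1 : LaurentPolynomial A) W.f₁) 0

variable [Invertible (2 : A)]

/-- The expansion of functions on `U₀₁` in terms of `u = 1/(x - a)` and `v = y/(x - a)²`. -/
theorem exists_expansion : ∃ φ : W.B₀₁ →ₐ[A] W.LaurentCover,
    φ (W.x₀₁ - algebraMap A _ W.a) =
      algebraMap (LaurentPolynomial A) _ (LaurentPolynomial.T (-1)) ∧
    φ W.inv = algebraMap (LaurentPolynomial A) _ (LaurentPolynomial.T 1) ∧
    φ W.y₀₁ = ⟨0, LaurentPolynomial.T (-2)⟩ := by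
  set L := LaurentPolynomial A
  set t : W.LaurentCover := algebraMap L _ (LaurentPolynomial.T (-1)) with ht
  set u : W.LaurentCover := algebraMap L _ (LaurentPolynomial.T 1) with hu
  have htu : t * u = 1 := by
    rw [ht, hu, ← map_mul, ← LaurentPolynomial.T_add]
    simp
  have hv : (⟨0, 1⟩ : W.LaurentCover) ^ 2 = aeval u W.f₁ := by
    rw [hu, aeval_algebraMap_apply, QuadraticAlgebra.algebraMap_eq, pow_two]
    ext <;> simp
  have hy : (⟨0, LaurentPolynomial.T (-2)⟩ : W.LaurentCover) = t ^ 2 * ⟨0, 1⟩ := by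
    rw [ht, ← map_pow, LaurentPolynomial.T_pow, QuadraticAlgebra.algebraMap_eq]
    ext <;> simp
  have h0 : (⟨0, LaurentPolynomial.T (-2)⟩ : W.LaurentCover) ^ 2 =
      aeval (t + algebraMap A _ W.a) W.f₀ := by
    rw [hy, mul_pow, hv.trans (W.aeval_f₁ u), aeval_f₀, t₃]
    simp only [map_sub, map_mul, map_pow, map_ofNat]
    generalize (algebraMap A W.LaurentCover) W.a = a
    generalize (algebraMap A W.LaurentCover) W.b = b
    generalize (algebraMap A W.LaurentCover) W.t₂ = t₂
    clear_value t u
    grind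
  have hunit : ∀ z : Submonoid.powers (DoubleCover.x W.f₀ - algebraMap A W.B₀ W.a),
      IsUnit (DoubleCover.algHom W.f₀ _ _ h0 z) := by
    rintro ⟨_, n, rfl⟩
    simp only [map_pow, map_sub, DoubleCover.algHom_x, AlgHom.commutes, add_sub_cancel_right]
    exact (IsUnit.of_mul_eq_one _ htu).pow n
  let φ : W.B₀₁ →ₐ[A] W.LaurentCover := IsLocalization.liftAlgHom hunit
  have hφ : ∀ g, φ (algebraMap W.B₀ W.B₀₁ g) = DoubleCover.algHom W.f₀ _ _ h0 g :=
    fun g => IsLocalization.lift_eq _ g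
  have hx : φ (W.x₀₁ - algebraMap A _ W.a) = t := by
    rw [map_sub, AlgHom.commutes, x₀₁, hφ, DoubleCover.algHom_x, add_sub_cancel_right]
  refine ⟨φ, hx, ?_, ?_⟩
  · have := congrArg φ W.mul_inv
    rw [map_mul, hx, map_one] at this
    calc φ W.inv = (t * φ W.inv) * u := by rw [mul_right_comm, htu, one_mul]
      _ = u := by rw [this, one_mul]
  · rw [y₀₁, hφ, DoubleCover.algHom_y]

section Expansion

variable {W} {φ : W.B₀₁ →ₐ[A] W.LaurentCover}

theorem expansion_res₀
    (hx : φ (W.x₀₁ - algebraMap A _ W.a) =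
      algebraMap (LaurentPolynomial A) _ (LaurentPolynomial.T (-1)))
    (hy : φ W.y₀₁ = ⟨0, LaurentPolynomial.T (-2)⟩) (p q : A[X]) :
    φ (W.cover.res₀ (aeval (DoubleCover.x W.f₀ - algebraMap A _ W.a) p +
      aeval (DoubleCover.x W.f₀ - algebraMap A _ W.a) q * DoubleCover.y W.f₀)) =
    ⟨aeval (LaurentPolynomial.T (-1)) p, aeval (LaurentPolynomial.T (-1)) (q * X ^ 2)⟩ := by
  have hx' : φ (W.cover.res₀ (DoubleCover.x W.f₀ - algebraMap A _ W.a)) =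
      algebraMap (LaurentPolynomial A) _ (LaurentPolynomial.T (-1)) := by
    rw [map_sub, AlgHom.commutes]; exact hx
  have hy' : φ (W.cover.res₀ (DoubleCover.y W.f₀)) = ⟨0, LaurentPolynomial.T (-2)⟩ := hy
  rw [map_add, map_mul, map_add, map_mul, hy', ← aeval_algHom_apply, ← aeval_algHom_apply,
    ← aeval_algHom_apply, ← aeval_algHom_apply, hx', aeval_algebraMap_apply,
    aeval_algebraMap_apply, map_mul, map_pow, aeval_X, LaurentPolynomial.T_pow]
  ext <;> simp [QuadraticAlgebra.algebraMap_eq]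

theorem expansion_res₁ (hi : φ W.inv = algebraMap (LaurentPolynomial A) _ (LaurentPolynomial.T 1))
    (hy : φ W.y₀₁ = ⟨0, LaurentPolynomial.T (-2)⟩) (p q : A[X]) :
    φ (W.cover.res₁ (aeval (DoubleCover.x W.f₁ - algebraMap A _ 0) p +
      aeval (DoubleCover.x W.f₁ - algebraMap A _ 0) q * DoubleCover.y W.f₁)) =
    ⟨aeval (LaurentPolynomial.T 1) p, aeval (LaurentPolynomial.T 1) q⟩ := by
  have hv : φ (W.cover.res₁ (DoubleCover.y W.f₁)) = ⟨0, 1⟩ := by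
    rw [res₁_v, map_mul, map_pow, hy, hi, ← map_pow, LaurentPolynomial.T_pow,
      QuadraticAlgebra.algebraMap_eq, QuadraticAlgebra.mk_mul_mk, ← LaurentPolynomial.T_add]
    simp
  rw [map_zero, sub_zero, map_add, map_mul, map_add, map_mul, hv, ← aeval_algHom_apply,
    ← aeval_algHom_apply, ← aeval_algHom_apply, ← aeval_algHom_apply, res₁_u, hi,
    aeval_algebraMap_apply, aeval_algebraMap_apply]
  ext <;> simp [QuadraticAlgebra.algebraMap_eq]

theorem expansion_g₀₁ (hi : φ W.inv = algebraMap (LaurentPolynomial A) _ (LaurentPolynomial.T 1))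
    (hy : φ W.y₀₁ = ⟨0, LaurentPolynomial.T (-2)⟩) :
    φ W.g₀₁ = ⟨0, -(⅟2 : A) • LaurentPolynomial.T (-1)⟩ := by
  rw [g₀₁, map_neg, map_mul, map_mul, hi, hy, AlgHom.commutes, ← Algebra.smul_def,
    QuadraticAlgebra.algebraMap_eq, QuadraticAlgebra.smul_mk, QuadraticAlgebra.mk_mul_mk,
    smul_mul_assoc (⅟2 : A) (LaurentPolynomial.T (-2)), ← LaurentPolynomial.T_add]
  ext <;> simp

end Expansion

/-- The classes `α₁`, `α₂`, `ω₃` are linearly independent. Indeed, a relation gives functions on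
`U₀` and `U₁` whose difference on `U₀₁` is `c₁ + c₃ g`. Among the monomials `uⁱ`, `uⁱ v`, the
functions on `U₁` use those with `i ≥ 0`, and the functions on `U₀` use `uⁱ` with `i ≤ 0` and
`uⁱ v` with `i ≤ -2`; hence `g = -u⁻¹ v/2` is no such difference, and `c₃ = 0`. The two functions
are then constants vanishing at `P` and `O`, so that `c₁ = 0` and `c₂ dx/y = 0`. -/
theorem eq_zero_of_comb {c₁ c₂ c₃ : A} (h : c₁ • W.α₁ + c₂ • W.α₂ + c₃ • W.ω₃ = 0) :
    c₁ = 0 ∧ c₂ = 0 ∧ c₃ = 0 := by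
  obtain ⟨⟨f₀, f₁⟩, hf⟩ := (PairCover.comb_cls_eq_zero W.d₁_z₁ W.d₁_z₂ W.d₁_z₃ c₁ c₂ c₃).1 h
  have hP : W.cover.P f₀ = c₁ • (0 : A) + c₂ • (0 : A) + c₃ • (0 : A) :=
    congrArg (fun z : W.cover.Cochain => z.1.2) hf
  have hO : W.cover.O f₁ = c₁ • (0 : A) + c₂ • (0 : A) + c₃ • (0 : A) :=
    congrArg (fun z : W.cover.Cochain => z.2.1.2) hf
  have hd : KaehlerDifferential.D A W.B₀ f₀ = c₁ • (0 : Ω[W.B₀⁄A]) + c₂ • W.w₀ +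
      c₃ • (DoubleCover.x W.f₀ • W.w₀) :=
    congrArg (fun z : W.cover.Cochain => z.1.1) hf
  have hU : W.cover.res₁ f₁ - W.cover.res₀ f₀ =
      c₁ • (1 : W.B₀₁) + c₂ • (0 : W.B₀₁) + c₃ • W.g₀₁ :=
    congrArg (fun z : W.cover.Cochain => z.2.2) hf
  simp only [smul_zero, add_zero, zero_add] at hP hO hd hU
  obtain ⟨p, q, rfl⟩ := DoubleCover.exists_eq_aeval W.a f₀
  obtain ⟨p', q', rfl⟩ := DoubleCover.exists_eq_aeval 0 f₁
  obtain ⟨φ, hx, hi, hy⟩ := W.exists_expansion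
  have Px : W.cover.P (DoubleCover.x W.f₀) = W.a := DoubleCover.algHom_x _ _ _ _
  have Py : W.cover.P (DoubleCover.y W.f₀) = W.b := DoubleCover.algHom_y _ _ _ _
  have Ou : W.cover.O (DoubleCover.x W.f₁) = 0 := DoubleCover.algHom_x _ _ _ _
  have Ov : W.cover.O (DoubleCover.y W.f₁) = 0 := DoubleCover.algHom_y _ _ _ _
  have hP' : p.coeff 0 + q.coeff 0 * W.b = 0 := by
    rw [map_add, map_mul, ← aeval_algHom_apply, ← aeval_algHom_apply, map_sub, Px, Py,
      AlgHom.commutes] at hP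
    simpa [← coeff_zero_eq_aeval_zero] using hP
  have hO' : p'.coeff 0 = 0 := by
    rw [map_add, map_mul, ← aeval_algHom_apply, ← aeval_algHom_apply, map_sub, Ou, Ov,
      AlgHom.commutes] at hO
    simpa [← coeff_zero_eq_aeval_zero] using hO
  have hφ := congrArg φ hU
  rw [map_sub, expansion_res₀ hx hy, expansion_res₁ hi hy, map_add, map_smul, map_smul, map_one,
    expansion_g₀₁ hi hy] at hφ
  have hre := congrArg QuadraticAlgebra.re hφ
  have him := congrArg QuadraticAlgebra.im hφ
  simp only [QuadraticAlgebra.re_sub, QuadraticAlgebra.re_add, QuadraticAlgebra.re_smul,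
    QuadraticAlgebra.re_one, smul_zero, add_zero] at hre
  simp only [QuadraticAlgebra.im_sub, QuadraticAlgebra.im_add, QuadraticAlgebra.im_smul,
    QuadraticAlgebra.im_one, smul_zero, zero_add, smul_smul] at him
  obtain ⟨hc, hq⟩ := eq_zero_of_aeval_T_sub him
  have hp := eq_neg_C_of_aeval_T_sub hO' hre
  have h₃ : c₃ = 0 := by
    linear_combination (-2) * hc - c₃ * mul_invOf_self (2 : A)
  have h₁ : c₁ = 0 := by
    simpa [hp, hq] using hP'
  rw [h₁, map_zero, neg_zero] at hp
  rw [hp, hq, map_zero, zero_mul, add_zero, map_zero, h₃, zero_smul, add_zero,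
    ← algebraMap_smul W.B₀ c₂] at hd
  have h₂ := congrArg W.cover.P (DoubleCover.smul_invDiff_eq_zero W.separable₀ hd.symm)
  rw [AlgHom.commutes, map_zero] at h₂
  exact ⟨h₁, h₂, h₃⟩

end EllipticPair

/-! ### The flatness equations -/

/-- The flatness conditions for a frame `x, y, c x + t y + z`, expressed by the matrix of the
connection `F` in the frame `x, y, z`. The trace of that matrix is zero, which is why the
coefficient of `z` in the second condition vanishes automatically. -/
theorem flat_iff {A M : Type*} [CommRing A] [AddCommGroup M] [Module A M] (F : M →+ M) (D : A → A)
    (hF : ∀ g x, F (g • x) = g • F x + D g • x) {x y z : M}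
    (h : ∀ {c₁ c₂ c₃ : A}, c₁ • x + c₂ • y + c₃ • z = 0 → c₁ = 0 ∧ c₂ = 0 ∧ c₃ = 0)
    {p q r u v : A} (hx : F x = 0) (hy : F y = (-p) • x + (-q) • y + r • z)
    (hz : F z = (-u) • x + (-v) • y + q • z) (m n c t : A) :
    (F y = m • x + n • (c • x + t • y + z) ∧ F (c • x + t • y + z) = 0) ↔
    (p = -(m + n * c) ∧ q = -(n * t) ∧ r = n) ∧ D c = t * p + u ∧ D t = t * q + v := by
  rw [map_add, map_add, hF, hF, hx, hy, hz]
  constructor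
  · rintro ⟨h₂, h₃⟩
    obtain ⟨e₁, e₂, e₃⟩ := h (c₁ := -p - m - n * c) (c₂ := -q - n * t) (c₃ := r - n) (by
      rw [← sub_eq_zero.2 h₂]
      module)
    obtain ⟨e₄, e₅, -⟩ := h (c₁ := D c - t * p - u) (c₂ := D t - t * q - v) (c₃ := t * r + q) (by
      rw [← h₃]
      module)
    exact ⟨⟨by linear_combination -e₁, by linear_combination -e₂, by linear_combination e₃⟩,
      by linear_combination e₄, by linear_combination e₅⟩
  · rintro ⟨⟨rfl, rfl, rfl⟩, hc, ht⟩
    rw [hc, ht]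
    constructor <;> module

/-- The matrix condition for a frame whose first member is flat. -/
theorem matrix_iff {A M : Type*} [CommRing A] [AddCommGroup M] [Module A M] (F : M →+ M)
    {x y z : M} (hx : F x = 0) (m n : A) :
    (∀ i, F (![x, y, z] i) = ∑ j, !![0, 0, 0; m, 0, n; 0, 0, 0] i j • ![x, y, z] j) ↔
      F y = m • x + n • z ∧ F z = 0 := by
  simp [Fin.forall_fin_succ, Fin.sum_univ_succ, hx]

namespace EllipticPair

variable {A : Type*} [CommRing A] (W : EllipticPair A) {k : Type*} [CommRing k] [Algebra k A]
  [Invertible (2 : A)]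

/-- Every vector field on the base has coordinates `p, q, r`: this is the surjectivity of the
Kodaira–Spencer map. -/
theorem exists_hasCoords (D : Derivation k A A) {s : A} (hs : 3 * s = W.t₂) :
    ∃ p q r : A, W.HasCoords D s p q r := by
  obtain ⟨d, hd⟩ := W.isUnit_disc.exists_left_inv
  have h2 := invOf_mul_self (2 : A)
  change d * (27 * W.t₃ ^ 2 - W.t₂ ^ 3) = 1 at hd
  rw [← hs] at hd
  -- The rules for `t₂` and `t₃` are a linear system for `q, r`, of determinant `36 s³ - 36 t₃²`;
  -- this is `-4/3` times the discriminant.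
  let e : A := -(3 * (⅟2 * ⅟2 * d))
  have he : e * (36 * s ^ 3 - 36 * W.t₃ ^ 2) = 1 := by
    linear_combination (norm := (simp only [e]; ring)) 4 * ⅟2 * ⅟2 * hd + (2 * ⅟2 + 1) * h2
  let q : A := e * (3 * s ^ 2 * D W.t₂ - 6 * W.t₃ * D W.t₃)
  let r : A := e * (12 * s * D W.t₃ - 6 * W.t₃ * D W.t₂)
  have e₂ : D W.t₂ = 4 * q * W.t₂ + 6 * r * W.t₃ := by
    rw [← hs]
    linear_combination (norm := (simp only [q, r, ← hs]; ring)) (-(D W.t₂)) * he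
  have e₃ : D W.t₃ = 6 * q * W.t₃ + 3 * r * s ^ 2 := by
    linear_combination (norm := (simp only [q, r, ← hs]; ring)) (-(D W.t₃)) * he
  clear_value q r
  -- It remains to divide the residual motion of `P` by the nowhere vanishing vector field on the
  -- curve, using that `f₀(a) = b²` and `f₀'(a)` generate the unit ideal.
  obtain ⟨u, v, huv⟩ := W.separable₀
  have hB : aeval W.a u * W.b ^ 2 + aeval W.a v * (12 * W.a ^ 2 - W.t₂) = 1 := by
    have h := congrArg (aeval W.a) huv
    rw [map_add, map_mul, map_mul, aeval_derivative_f₀, aeval_f₀, map_one, t₃,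
      Algebra.algebraMap_self_apply, Algebra.algebraMap_self_apply] at h
    linear_combination h
  have hD := W.derivation_t₃ D
  obtain ⟨h₁, h₂⟩ := solve_pair (M := A) hB
    (m := D W.a - 2 * q * W.a - r * (2 * W.a ^ 2 - s))
    (n := D W.b - 3 * q * W.b - 3 * r * W.a * W.b) (by
      simp only [smul_eq_mul]
      rw [e₃, e₂, t₃] at hD
      rw [← hs] at hD ⊢
      linear_combination hD)
  simp only [smul_eq_mul] at h₁ h₂
  refine ⟨aeval W.a u * W.b * (D W.a - 2 * q * W.a - r * (2 * W.a ^ 2 - s)) +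
    2 * aeval W.a v * (D W.b - 3 * q * W.b - 3 * r * W.a * W.b), q, r, hs, ?_, ?_, e₂⟩
  · linear_combination -h₁
  · linear_combination -⅟2 * h₂ - (D W.b - 3 * q * W.b - 3 * r * W.a * W.b) * h2

/-- For a frame `α₁, α₂, α₃ = c α₁ + t α₂ + ω₃`, the conditions `∇ α₂ = m α₁ + n α₃` and `∇ α₃ = 0`
determine the coordinates of the vector field and the derivatives of `c` and `t`. -/
theorem frame_iff {D : Derivation k A A} {s : A} (hs : 3 * s = W.t₂) (c t m n : A) :
    (W.gaussManin D W.α₂ = m • W.α₁ + n • (c • W.α₁ + t • W.α₂ + W.ω₃) ∧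
      W.gaussManin D (c • W.α₁ + t • W.α₂ + W.ω₃) = 0) ↔
    W.HasCoords D s (-(m + n * c)) (-(n * t)) n ∧
      D c = t * -(m + n * c) + (-(m + n * c) * W.a + n * (⅟2 * W.b)) ∧
      D t = t * -(n * t) + n * (⅟2 * ⅟2 * s) := by
  have key : ∀ p q r, W.HasCoords D s p q r → ((W.gaussManin D W.α₂ =
        m • W.α₁ + n • (c • W.α₁ + t • W.α₂ + W.ω₃) ∧
      W.gaussManin D (c • W.α₁ + t • W.α₂ + W.ω₃) = 0) ↔
      (p = -(m + n * c) ∧ q = -(n * t) ∧ r = n) ∧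
        D c = t * p + (p * W.a + r * (⅟2 * W.b)) ∧ D t = t * q + r * (⅟2 * ⅟2 * s)) := by
    intro p q r H
    exact flat_iff (W.gaussManin D) D (W.gaussManin_smul D) W.eq_zero_of_comb (gaussManin_α₁ D)
      H.gaussManin_α₂ H.gaussManin_ω₃ m n c t
  constructor
  · intro h
    obtain ⟨p, q, r, H⟩ := W.exists_hasCoords D hs
    obtain ⟨⟨rfl, rfl, rfl⟩, h'⟩ := (key p q r H).1 h
    exact ⟨H, h'⟩
  · rintro ⟨H, h'⟩
    exact (key _ _ _ H).2 ⟨⟨rfl, rfl, rfl⟩, h'⟩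

end EllipticPair

/-! ### Vector fields on the moduli space -/

namespace TRing

variable (k : Type*) [Field k]

/-- A derivation of the coordinate ring of `T` is determined by its values on the coordinates. -/
theorem derivation_ext {R R' : Derivation k (TRing k) (TRing k)} (ha : R (a k) = R' (a k))
    (hb : R (b k) = R' (b k)) (hc : R (c k) = R' (c k)) (h₁ : R (t₁ k) = R' (t₁ k))
    (h₂ : R (t₂ k) = R' (t₂ k)) : R = R' := by
  have h : ∀ g : MvPolynomial (Fin 5) k,
      R (algebraMap (MvPolynomial (Fin 5) k) _ g) =
        R' (algebraMap (MvPolynomial (Fin 5) k) _ g) := fun g => by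
    induction g using MvPolynomial.induction_on with
    | C r =>
      rw [← MvPolynomial.algebraMap_eq, ← IsScalarTower.algebraMap_apply, R.map_algebraMap,
        R'.map_algebraMap]
    | add p q hp hq => rw [map_add, map_add, map_add, hp, hq]
    | mul_X p i hp =>
      have hi : R (algebraMap (MvPolynomial (Fin 5) k) _ (MvPolynomial.X i)) =
          R' (algebraMap (MvPolynomial (Fin 5) k) _ (MvPolynomial.X i)) := by
        fin_cases i
        exacts [ha, hb, hc, h₁, h₂]
      rw [map_mul, Derivation.leibniz, Derivation.leibniz, hp, hi]
  ext z
  obtain ⟨⟨g, w⟩, hz⟩ := IsLocalization.surj (Submonoid.powers (discPoly k)) z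
  have e := congrArg R hz
  have e' := congrArg R' hz
  rw [Derivation.leibniz, h, h] at e
  rw [Derivation.leibniz, ← e] at e'
  have hw := IsLocalization.map_units (TRing k) w
  simp only [smul_eq_mul] at e'
  exact (hw.mul_left_cancel (add_left_cancel e')).symm

theorem exists_derivation (v : Fin 5 → MvPolynomial (Fin 5) k) :
    ∃ R : Derivation k (TRing k) (TRing k), ∀ i,
      R (algebraMap (MvPolynomial (Fin 5) k) _ (MvPolynomial.X i)) =
        algebraMap (MvPolynomial (Fin 5) k) _ (v i) := by
  obtain ⟨R, -, hR⟩ := exists_localize (0 : Derivation k k k) (MvPolynomial.mkDerivation k v)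
    (fun r => by rw [Derivation.map_algebraMap, Derivation.zero_apply, map_zero]) (discPoly k)
  exact ⟨R, fun i => by rw [hR, MvPolynomial.mkDerivation_X]⟩

theorem algebraMap_smul_polynomial (r : k) (g : MvPolynomial (Fin 5) k) :
    algebraMap (MvPolynomial (Fin 5) k) (TRing k) (r • g) =
      r • algebraMap (MvPolynomial (Fin 5) k) (TRing k) g :=
  map_smul (IsScalarTower.toAlgHom k (MvPolynomial (Fin 5) k) (TRing k)) r g

theorem exists_tau : ∃ R : Derivation k (TRing k) (TRing k),
    R (a k) = -2 * a k ^ 2 + 2 * a k * t₁ k + b k * c k + (1 / 3 : k) • t₂ k ∧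
    R (b k) = 6 * a k ^ 2 * c k - (1 / 2 : k) • (c k * t₂ k) - 3 * a k * b k + 3 * b k * t₁ k ∧
    R (c k) = a k * c k + c k * t₁ k - (1 / 2 : k) • b k ∧
    R (t₁ k) = t₁ k ^ 2 - (1 / 12 : k) • t₂ k ∧
    R (t₂ k) = 4 * t₁ k * t₂ k - 6 * t₃ k := by
  open MvPolynomial in
  obtain ⟨R, h⟩ := exists_derivation k
    ![-2 * X 0 ^ 2 + 2 * X 0 * X 3 + X 1 * X 2 + (1 / 3 : k) • X 4,
      6 * X 0 ^ 2 * X 2 - (1 / 2 : k) • (X 2 * X 4) - 3 * X 0 * X 1 + 3 * X 1 * X 3,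
      X 0 * X 2 + X 2 * X 3 - (1 / 2 : k) • X 1,
      X 3 ^ 2 - (1 / 12 : k) • X 4,
      4 * X 3 * X 4 - 6 * (4 * X 0 ^ 3 - X 4 * X 0 - X 1 ^ 2)]
  refine ⟨R, (h 0).trans ?_, (h 1).trans ?_, (h 2).trans ?_, (h 3).trans ?_, (h 4).trans ?_⟩ <;>
  simp only [a, b, c, t₁, t₂, t₃, Matrix.cons_val, map_add, map_sub, map_mul, map_pow, map_neg,
    map_ofNat, algebraMap_smul_polynomial]

theorem exists_z : ∃ R : Derivation k (TRing k) (TRing k),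
    R (a k) = b k ∧ R (b k) = 6 * a k ^ 2 - (1 / 2 : k) • t₂ k ∧ R (c k) = a k + t₁ k ∧
      R (t₁ k) = 0 ∧ R (t₂ k) = 0 := by
  open MvPolynomial in
  obtain ⟨R, h⟩ := exists_derivation k
    ![X 1, 6 * X 0 ^ 2 - (1 / 2 : k) • X 4, X 0 + X 3, 0, 0]
  refine ⟨R, h 0, (h 1).trans ?_, (h 2).trans ?_, (h 3).trans ?_, (h 4).trans ?_⟩ <;>
  simp only [a, t₁, t₂, Matrix.cons_val, map_add, map_sub, map_mul, map_pow, map_ofNat, map_zero,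
    algebraMap_smul_polynomial]

end TRing

section Universal

variable (k : Type*) [Field k] [CharZero k]

open TRing

theorem three_mul_third : 3 * ((1 / 3 : k) • t₂ k) = (univ k).t₂ := by
  change _ = t₂ k
  rw [Algebra.smul_def, ← mul_assoc, ← map_ofNat (algebraMap k (TRing k)) 3, ← map_mul,
    mul_one_div_cancel three_ne_zero, map_one, one_mul]

/-- The class `α₁` is flat, so the first row of the matrix condition is automatic. -/
theorem hasMatrix_iff (R : Derivation k (TRing k) (TRing k)) (m n : TRing k) :
    HasMatrix k R !![0, 0, 0; m, 0, n; 0, 0, 0] ↔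
      (univ k).gaussManin R (univ k).α₂ = m • (univ k).α₁ +
        n • (c k • (univ k).α₁ + t₁ k • (univ k).α₂ + (univ k).ω₃) ∧
      (univ k).gaussManin R (c k • (univ k).α₁ + t₁ k • (univ k).α₂ + (univ k).ω₃) = 0 := by
  exact matrix_iff ((univ k).gaussManin R) (EllipticPair.gaussManin_α₁ R) m n

theorem half_smul (g : TRing k) : (1 / 2 : k) • g = ⅟2 * g := by
  rw [Algebra.smul_def, one_div]
  rfl

theorem twelfth_smul (g : TRing k) : (1 / 12 : k) • g = ⅟2 * ⅟2 * ((1 / 3 : k) • g) := by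
  have h : (1 / 12 : k) = 1 / 2 * (1 / 2) * (1 / 3) := by norm_num
  rw [h, mul_smul, mul_smul, half_smul, half_smul, mul_assoc]

/-- The matrix condition, as a formula for `R` on the five coordinate functions. -/
theorem hasMatrix_iff_derivation (R : Derivation k (TRing k) (TRing k)) (m n : TRing k) :
    HasMatrix k R !![0, 0, 0; m, 0, n; 0, 0, 0] ↔
      R (a k) = -2 * (n * t₁ k) * a k + n * (2 * a k ^ 2 - (1 / 3 : k) • t₂ k) -
        (m + n * c k) * b k ∧
      R (b k) = -3 * (n * t₁ k) * b k + 3 * n * a k * b k -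
        (m + n * c k) * (⅟2 * (12 * a k ^ 2 - t₂ k)) ∧
      R (t₂ k) = -4 * (n * t₁ k) * t₂ k + 6 * n * t₃ k ∧
      R (c k) = -(t₁ k * (m + n * c k)) - (m + n * c k) * a k + n * (⅟2 * b k) ∧
      R (t₁ k) = -(t₁ k * (n * t₁ k)) + n * (⅟2 * ⅟2 * ((1 / 3 : k) • t₂ k)) := by
  rw [hasMatrix_iff]
  refine ((univ k).frame_iff (three_mul_third k) (c k) (t₁ k) m n).trans ?_
  constructor
  · rintro ⟨⟨_, h₁, h₂, h₃⟩, h₄, h₅⟩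
    refine ⟨h₁.trans ?_, h₂.trans ?_, h₃.trans ?_, h₄.trans ?_, h₅.trans ?_⟩
    · change 2 * -(n * t₁ k) * a k + n * (2 * a k ^ 2 - (1 / 3 : k) • t₂ k) +
        -(m + n * c k) * b k = _
      ring
    · change 3 * -(n * t₁ k) * b k + 3 * n * a k * b k +
        -(m + n * c k) * (⅟2 * (12 * a k ^ 2 - t₂ k)) = _
      ring
    · change 4 * -(n * t₁ k) * t₂ k + 6 * n * t₃ k = _
      ring
    · change t₁ k * -(m + n * c k) + (-(m + n * c k) * a k + n * (⅟2 * b k)) = _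
      ring
    · ring
  · rintro ⟨h₁, h₂, h₃, h₄, h₅⟩
    refine ⟨⟨three_mul_third k, h₁.trans ?_, h₂.trans ?_, h₃.trans ?_⟩, h₄.trans ?_, h₅.trans ?_⟩
    · change _ = 2 * -(n * t₁ k) * a k + n * (2 * a k ^ 2 - (1 / 3 : k) • t₂ k) +
        -(m + n * c k) * b k
      ring
    · change _ = 3 * -(n * t₁ k) * b k + 3 * n * a k * b k +
        -(m + n * c k) * (⅟2 * (12 * a k ^ 2 - t₂ k))
      ring
    · change _ = 4 * -(n * t₁ k) * t₂ k + 6 * n * t₃ k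
      ring
    · change _ = t₁ k * -(m + n * c k) + (-(m + n * c k) * a k + n * (⅟2 * b k))
      ring
    · ring

theorem hasMatrix_iff_eq {R R' : Derivation k (TRing k) (TRing k)} {m n : TRing k}
    (ha : R' (a k) = -2 * (n * t₁ k) * a k + n * (2 * a k ^ 2 - (1 / 3 : k) • t₂ k) -
      (m + n * c k) * b k)
    (hb : R' (b k) = -3 * (n * t₁ k) * b k + 3 * n * a k * b k -
      (m + n * c k) * (⅟2 * (12 * a k ^ 2 - t₂ k)))
    (h₂ : R' (t₂ k) = -4 * (n * t₁ k) * t₂ k + 6 * n * t₃ k)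
    (hc : R' (c k) = -(t₁ k * (m + n * c k)) - (m + n * c k) * a k + n * (⅟2 * b k))
    (h₁ : R' (t₁ k) = -(t₁ k * (n * t₁ k)) + n * (⅟2 * ⅟2 * ((1 / 3 : k) • t₂ k))) :
    HasMatrix k R !![0, 0, 0; m, 0, n; 0, 0, 0] ↔ R = R' := by
  rw [hasMatrix_iff_derivation]
  constructor
  · rintro ⟨ea, eb, e₂, ec, e₁⟩
    exact TRing.derivation_ext k (ea.trans ha.symm) (eb.trans hb.symm) (ec.trans hc.symm)
      (e₁.trans h₁.symm) (e₂.trans h₂.symm)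
  · rintro rfl
    exact ⟨ha, hb, h₂, hc, h₁⟩

end Universal

end RelDR

end

theorem theorem3 (k : Type*) [Field k] [CharZero k] :
    ∃ Rτ Rz : Derivation k (RelDR.TRing k) (RelDR.TRing k),
      (∀ R : Derivation k (RelDR.TRing k) (RelDR.TRing k),
        RelDR.HasMatrix k R !![0, 0, 0; 0, 0, -1; 0, 0, 0] ↔ R = Rτ) ∧
      (∀ R : Derivation k (RelDR.TRing k) (RelDR.TRing k),
        RelDR.HasMatrix k R !![0, 0, 0; -1, 0, 0; 0, 0, 0] ↔ R = Rz) ∧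
      (open RelDR.TRing in
        Rτ (a k) = -2 * a k ^ 2 + 2 * a k * t₁ k + b k * c k + (1 / 3 : k) • t₂ k ∧
        Rτ (b k) = 6 * a k ^ 2 * c k - (1 / 2 : k) • (c k * t₂ k) - 3 * a k * b k +
          3 * b k * t₁ k ∧
        Rτ (c k) = a k * c k + c k * t₁ k - (1 / 2 : k) • b k ∧
        Rτ (t₁ k) = t₁ k ^ 2 - (1 / 12 : k) • t₂ k ∧
        Rτ (t₂ k) = 4 * t₁ k * t₂ k - 6 * t₃ k) ∧
      (open RelDR.TRing in
        Rz (a k) = b k ∧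
        Rz (b k) = 6 * a k ^ 2 - (1 / 2 : k) • t₂ k ∧
        Rz (c k) = a k + t₁ k ∧
        Rz (t₁ k) = 0 ∧
        Rz (t₂ k) = 0) := by
  obtain ⟨Rτ, τa, τb, τc, τ₁, τ₂⟩ := RelDR.TRing.exists_tau k
  obtain ⟨Rz, za, zb, zc, z₁, z₂⟩ := RelDR.TRing.exists_z k
  refine ⟨Rτ, Rz, fun R => ?_, fun R => ?_, ⟨τa, τb, τc, τ₁, τ₂⟩, za, zb, zc, z₁, z₂⟩
  · have h2 := invOf_mul_self (2 : RelDR.TRing k)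
    refine RelDR.hasMatrix_iff_eq k ?_ ?_ ?_ ?_ ?_
    · rw [τa]; ring
    · rw [τb, RelDR.half_smul]
      linear_combination (-6 * RelDR.TRing.a k ^ 2 * RelDR.TRing.c k) * h2
    · rw [τ₂]; ring
    · rw [τc, RelDR.half_smul]; ring
    · rw [τ₁, RelDR.twelfth_smul]; ring
  · have h2 := invOf_mul_self (2 : RelDR.TRing k)
    refine RelDR.hasMatrix_iff_eq k ?_ ?_ ?_ ?_ ?_
    · rw [za]; ring
    · rw [zb, RelDR.half_smul]
      linear_combination (-6 * RelDR.TRing.a k ^ 2) * h2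
    · rw [z₂]; ring
    · rw [zc]; ring
    · rw [z₁]; ring
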